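/- **Setting.** Let $d\ge 1$, let $\Sigma$ be the complex linear span of the indicator functions of cubes in $\mathbb R^d$, let $\sigma(p,q)^{-1}=p^{-1}+q^{-1}$, and write $K^{1*}(x,y,z)=K(y,x,z)$, $K^{2*}(x,y,z)=K(z,y,x)$. A *non-degenerate bilinear SIO* is a bilinear operator $T:\Sigma\times\Sigma\to L^1_{\mathrm{loc}}(\mathbb R^d;\mathbb C)$ of one of the following two kinds. (a) *Variable kernel.* There is $K:(\mathbb R^d)^3\setminus\{x=y=z\}\to\mathbb C$ with $|K(x,y,z)|\le C_K(|x-y|+|x-z|)^{-2d}$ and $$|G(x,y,z)-G(x',y,z)|\le\omega\Big(\frac{|x-x'|}{|x-y|+|x-z|}\Big)(|x-y|+|x-z|)^{-2d}$$ for $G\in\{K,K^{1*},K^{2*}\}$ whenever $|x-x'|\le\frac12\max(|x-y|,|x-z|)$, where $\omega$ is increasing and subadditive, $\omega(0)=0$ and $\int_0^1\omega(t)\frac{dt}{t}<\infty$; one has $\int T(f_1,f_2)g=\iiint K(x,y,z)f_1(y)f_2(z)g(x)\,dy\,dz\,dx$ for all $f_1,f_2,g\in\Sigma$ with $\operatorname{supp}f_1\cap\operatorname{supp}f_2\cap\operatorname{supp}g=\emptyset$;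 and, for some $c_0>0$, for all $y$ and $\rho>0$ there are $x,z$ with $\max(|x-y|,|x-z|,|y-z|)>\rho$ and $|K(x,y,z)|\ge c_0\rho^{-2d}$, and for all $z$ and $\rho>0$ there are $x,y$ with the same two properties. (b) *Rough kernel.* There is $0\ne\Omega\in L^1(\mathbb S^{2d-1})$ such that, for all $f_1,f_2\in\Sigma$ and almost every $x$, $$T(f_1,f_2)(x)=\lim_{\varepsilon\to0}\iint_{\max(|x-y|,|x-z|)>\varepsilon}\frac{\Omega(h/|h|)}{|h|^{2d}}f_1(y)f_2(z)\,dy\,dz,\qquad h=(x-y,x-z)\in\mathbb R^{2d}.$$ **Theorem.** Let $1\le r,s,p,q<\infty$ with $\frac1r=\frac1s+\frac1p+\frac1q$, and let $T$ be a non-degenerate bilinear SIO that is bounded $L^p\times L^q\to L^{\sigma(p,q)}$ with norm at most $M_1$ and $L^{\sigma(s,p)}\times L^q\to L^r$ with norm at most $M_2$. Extend $T$ by density to these spaces, and hence to $(L^p+L^{\sigma(s,p)})\times L^q$. For $b\in L^1_{\mathrm{loc}}(\mathbb R^d;\mathbb C)$ put $$[b,T]_1(f,g)=bT(f,g)-T(bf,g)\qquad\text{for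 } f\in L^p,\ g\in L^q \text{ with } bf\in L^p+L^{\sigma(s,p)},$$ and let $\|[b,T]_1\|_{L^p\times L^q\to L^r}\in[0,\infty]$ be the least $N$ with $\|[b,T]_1(f,g)\|_{L^r}\le N\|f\|_{L^p}\|g\|_{L^q}$ for all such $f,g$. Then $$C^{-1}\,\|b\|_{\dot L^s}\le\|[b,T]_1\|_{L^p\times L^q\to L^r}\le C\,\|b\|_{\dot L^s},\qquad \|b\|_{\dot L^s}=\inf_{c\in\mathbb C}\|b-c\|_{L^s}\in[0,\infty],$$ and if these quantities are finite then $[b,T]_1$ is defined on all of $L^p\times L^q$. The constant $C$ depends only on $d,p,q,r,s,M_1,M_2$ and, in case (a), on $C_K,\omega,c_0$, in case (b), on $\Omega$; in particular it does not depend on $b$. -/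

import Mathlib

open MeasureTheory Filter Topology
open scoped ENNReal NNReal

noncomputable section

namespace BilinearSIO

/-- Euclidean space `ℝ^d`. -/
abbrev Rd (d : ℕ) : Type := EuclideanSpace ℝ (Fin d)

/-- The half-open cube with lower corner `a` and side length `ℓ`. -/
def cube {d : ℕ} (a : Rd d) (ℓ : ℝ) : Set (Rd d) :=
  {x | ∀ i, a i ≤ x i ∧ x i < a i + ℓ}

/-- The space `Σ`: the complex linear span of the indicator functions of cubes. -/
def Sig (d : ℕ) : Submodule ℂ (Rd d → ℂ) :=
  Submodule.span ℂ {f | ∃ (a : Rd d) (ℓ : ℝ), 0 < ℓ ∧ f = (cube a ℓ).indicator (fun _ => 1)}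

/-- Bilinear operators from `Σ × Σ` to (classes modulo null sets of) measurable functions.
That the values lie in `L^1_loc` is required in the definitions of singular integrals below. -/
abbrev BilinOp (d : ℕ) : Type :=
  Sig d →ₗ[ℂ] Sig d →ₗ[ℂ] (Rd d →ₘ[(volume : Measure (Rd d))] ℂ)

/-- The values of `T` are locally integrable. -/
def MapsToLocInt {d : ℕ} (T : BilinOp d) : Prop :=
  ∀ f g : Sig d, LocallyIntegrable (T f g) volume

/-- Moduli of continuity `ω` on `[0, ∞)`: increasing, subadditive, `ω 0 = 0`,
with `∫_0^1 ω(t) dt/t < ∞`. -/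
structure IsDiniModulus (ω : ℝ → ℝ) : Prop where
  zero : ω 0 = 0
  mono : MonotoneOn ω (Set.Ici 0)
  subadd : ∀ s t : ℝ, 0 ≤ s → 0 ≤ t → ω (s + t) ≤ ω s + ω t
  dini : IntegrableOn (fun t => ω t / t) (Set.Ioc 0 1) volume

/-- The regularity estimate in the first variable of a kernel `G`. -/
def KernelRegular {d : ℕ} (ω : ℝ → ℝ) (G : Rd d → Rd d → Rd d → ℂ) : Prop :=
  ∀ x x' y z : Rd d, ¬ (x = y ∧ y = z) →
    ‖x - x'‖ ≤ 1 / 2 * max ‖x - y‖ ‖x - z‖ →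
      ‖G x y z - G x' y z‖ ≤
        ω (‖x - x'‖ / (‖x - y‖ + ‖x - z‖)) * ((‖x - y‖ + ‖x - z‖) ^ (2 * d))⁻¹

/-- `K` is a bilinear Calderón-Zygmund kernel with size constant `CK` and modulus `ω`. The values
of `K` on the diagonal `x = y = z` are irrelevant. The last two fields are the regularity of
`K^{1*}(x,y,z) = K(y,x,z)` and `K^{2*}(x,y,z) = K(z,y,x)`. -/
structure IsCZKernel {d : ℕ} (CK : ℝ) (ω : ℝ → ℝ) (K : Rd d → Rd d → Rd d → ℂ) : Prop where
  size : ∀ x y z : Rd d, ¬ (x = y ∧ y = z) →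
    ‖K x y z‖ ≤ CK * ((‖x - y‖ + ‖x - z‖) ^ (2 * d))⁻¹
  reg : KernelRegular ω K
  reg₁ : KernelRegular ω (fun x y z => K y x z)
  reg₂ : KernelRegular ω (fun x y z => K z y x)

/-- Non-degeneracy of a variable kernel, with constant `c₀`. -/
structure IsNondegKernel {d : ℕ} (c₀ : ℝ) (K : Rd d → Rd d → Rd d → ℂ) : Prop where
  fst : ∀ (y : Rd d) (ρ : ℝ), 0 < ρ → ∃ x z : Rd d,
    ρ < max ‖x - y‖ (max ‖x - z‖ ‖y - z‖) ∧ c₀ * (ρ ^ (2 * d))⁻¹ ≤ ‖K x y z‖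
  snd : ∀ (z : Rd d) (ρ : ℝ), 0 < ρ → ∃ x y : Rd d,
    ρ < max ‖x - y‖ (max ‖x - z‖ ‖y - z‖) ∧ c₀ * (ρ ^ (2 * d))⁻¹ ≤ ‖K x y z‖

/-- `T : Σ × Σ → L^1_loc` is represented by `K` off the diagonal. -/
structure HasKernel {d : ℕ} (T : BilinOp d) (K : Rd d → Rd d → Rd d → ℂ) : Prop where
  locInt : MapsToLocInt T
  repr : ∀ f₁ f₂ g : Sig d,
    tsupport (f₁ : Rd d → ℂ) ∩ tsupport (f₂ : Rd d → ℂ) ∩ tsupport (g : Rd d → ℂ) = ∅ →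
      ∫ x, T f₁ f₂ x * (g : Rd d → ℂ) x =
        ∫ x, ∫ z, ∫ y, K x y z * (f₁ : Rd d → ℂ) y * (f₂ : Rd d → ℂ) z * (g : Rd d → ℂ) x

/-- `T` is a non-degenerate (variable kernel) bilinear SIO, with size constant `CK`, modulus `ω`
and non-degeneracy constant `c₀`. -/
def IsNondegVariableSIO {d : ℕ} (CK c₀ : ℝ) (ω : ℝ → ℝ) (T : BilinOp d) : Prop :=
  ∃ K : Rd d → Rd d → Rd d → ℂ, IsCZKernel CK ω K ∧ IsNondegKernel c₀ K ∧ HasKernel T K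

/-- `ℝ^d × ℝ^d` with its Euclidean norm, that is `ℝ^{2d}`. -/
abbrev Rdd (d : ℕ) : Type := WithLp 2 (Rd d × Rd d)

/-- The surface measure of the unit sphere `𝕊^{2d-1}` of `ℝ^{2d}`. -/
def sphereMeasure (d : ℕ) : Measure (Metric.sphere (0 : Rdd d) 1) :=
  (volume : Measure (Rdd d)).toSphere

/-- The rough kernel `Ω(h / |h|) / |h|^{2d}` with `h = (x - y, x - z)`. Only the values of `Ω` on
the unit sphere matter. -/
def roughKernel {d : ℕ} (Ω : Rdd d → ℂ) (x y z : Rd d) : ℂ :=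
  let h : Rdd d := WithLp.toLp 2 (x - y, x - z)
  Ω (‖h‖⁻¹ • h) / ((‖h‖ ^ (2 * d) : ℝ) : ℂ)

/-- `T` is the rough bilinear SIO of `Ω`: for `f₁, f₂ ∈ Σ` the limit of the truncated integrals
exists almost everywhere and is `T(f₁, f₂) ∈ L^1_loc`. -/
structure IsRoughSIO {d : ℕ} (Ω : Rdd d → ℂ) (T : BilinOp d) : Prop where
  locInt : MapsToLocInt T
  lim : ∀ f₁ f₂ : Sig d, ∀ᵐ x : Rd d,
    Tendsto (fun ε : ℝ =>
        ∫ w in {w : Rd d × Rd d | ε < max ‖x - w.1‖ ‖x - w.2‖},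
          roughKernel Ω x w.1 w.2 * (f₁ : Rd d → ℂ) w.1 * (f₂ : Rd d → ℂ) w.2)
      (𝓝[>] 0) (𝓝 (T f₁ f₂ x))

/-- `Ω ∈ L^1(𝕊^{2d-1})` and `Ω ≠ 0` as an element of `L^1`; by Lebesgue differentiation the latter
says that `Ω` has a non-zero Lebesgue point. -/
structure IsNondegOmega {d : ℕ} (Ω : Rdd d → ℂ) : Prop where
  integrable : Integrable (fun θ : Metric.sphere (0 : Rdd d) 1 => Ω θ) (sphereMeasure d)
  ne_zero : ¬ (fun θ : Metric.sphere (0 : Rdd d) 1 => Ω θ) =ᵐ[sphereMeasure d] 0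

/-- The Hölder exponent `σ(p,q)`, where `1/σ(p,q) = 1/p + 1/q`. -/
def hσ (p q : ℝ≥0∞) : ℝ≥0∞ := (p⁻¹ + q⁻¹)⁻¹

/-- `T` is bounded `L^p × L^q → L^t` with norm at most `M` (on the subspace `Σ`, which is dense for
finite exponents). -/
def BoundedBy {d : ℕ} (T : BilinOp d) (p q t : ℝ≥0∞) (M : ℝ≥0) : Prop :=
  ∀ f g : Sig d, eLpNorm (T f g) t volume ≤
    M * eLpNorm (f : Rd d → ℂ) p volume * eLpNorm (g : Rd d → ℂ) q volume

/-- `u ∈ L^t` is the value at `(f, g) ∈ L^p × L^q` of the extension of `T` to a bounded operator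
`L^p × L^q → L^t`: a limit of the values of `T` along approximations of `f` and `g` from `Σ`. -/
structure IsExtValue {d : ℕ} (T : BilinOp d) (p q t : ℝ≥0∞) (f g u : Rd d → ℂ) : Prop where
  memLp_left : MemLp f p volume
  memLp_right : MemLp g q volume
  memLp_value : MemLp u t volume
  approx : ∃ F G : ℕ → Sig d,
    Tendsto (fun n => eLpNorm ((F n : Rd d → ℂ) - f) p volume) atTop (𝓝 0) ∧
    Tendsto (fun n => eLpNorm ((G n : Rd d → ℂ) - g) q volume) atTop (𝓝 0) ∧
    Tendsto (fun n => eLpNorm ((T (F n) (G n) : Rd d → ℂ) - u) t volume) atTop (𝓝 0)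

/-- `w` is (a representative of) the commutator `[b,T]_1(f,g) = b T(f,g) - T(bf,g)`, where
`(f, g) ∈ L^p × L^q` and `bf ∈ L^p + L^{σ(s,p)}`. Here `T` is extended to `L^p × L^q` and to
`L^{σ(s,p)} × L^q`, and thus to `(L^p + L^{σ(s,p)}) × L^q`. -/
def IsCommValue {d : ℕ} (T : BilinOp d) (b : Rd d → ℂ) (p q r s : ℝ≥0∞)
    (f g w : Rd d → ℂ) : Prop :=
  ∃ v φ ψ u₁ u₂ : Rd d → ℂ,
    IsExtValue T p q (hσ p q) f g v ∧
    b * f = φ + ψ ∧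
    IsExtValue T p q (hσ p q) φ g u₁ ∧
    IsExtValue T (hσ s p) q r ψ g u₂ ∧
    w = b * v - (u₁ + u₂)

/-- The norm `‖[b,T]_1‖_{L^p × L^q → L^r} ∈ [0, ∞]`, over all pairs of functions in `L^p × L^q` at
which the commutator is defined. -/
def commNorm {d : ℕ} (T : BilinOp d) (b : Rd d → ℂ) (p q r s : ℝ≥0∞) : ℝ≥0∞ :=
  sInf {C : ℝ≥0∞ | ∀ f g w : Rd d → ℂ, IsCommValue T b p q r s f g w →
    eLpNorm w r volume ≤ C * eLpNorm f p volume * eLpNorm g q volume}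

/-- `‖b‖_{\dot L^s} = inf_c ‖b - c‖_{L^s} ∈ [0, ∞]`. -/
def homLsNorm {d : ℕ} (b : Rd d → ℂ) (s : ℝ≥0∞) : ℝ≥0∞ :=
  ⨅ c : ℂ, eLpNorm (fun x => b x - c) s volume

/-- With constant `C`, for all `b ∈ L^1_loc`: the norm of `[b,T]_1` and `‖b‖_{\dot L^s}` are
comparable, and if they are finite then `[b,T]_1` is defined on all of `L^p × L^q`. -/
def CommEquiv {d : ℕ} (T : BilinOp d) (p q r s : ℝ≥0∞) (C : ℝ≥0) : Prop :=
  ∀ b : Rd d → ℂ, LocallyIntegrable b volume →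
    commNorm T b p q r s ≤ C * homLsNorm b s ∧
    homLsNorm b s ≤ C * commNorm T b p q r s ∧
    (homLsNorm b s < ∞ → ∀ f g : Rd d → ℂ, MemLp f p volume → MemLp g q volume →
      ∃ w : Rd d → ℂ, IsCommValue T b p q r s f g w)

end BilinearSIO

end

open BilinearSIO

/-! The upper bound is Hölder's inequality. The commutator does not change when `b` is replaced by
`b₀ = b - c`; if `b₀ ∈ L^s`, then `b₀ T(f,g)` and `T(b₀ f, g)` both lie in `L^r`, by the first and
the second boundedness assumption. The splitting of `bf` is not unique, but the two extensions of
`T` agree on `L^p ∩ L^{σ(s,p)}`, because `Σ` approximates in both norms at once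
(`exists_Sig_tendsto`, `IsExtValue.ae_eq`).

The lower bound starts from one cube `P` of side `ℓ`. It has companions `X`, `Z` of the same size,
at distance at most a multiple of `ℓ`, such that on `X × P × Z` the kernel is, up to a small
relative error in `L^1`, a constant `K₀` with `|K₀| ≥ c ℓ^{-2d}` (`HasLocalKernels`). For a variable
kernel, non-degeneracy at a large multiple of the scale `ℓ` supplies the point and regularity
freezes the kernel around it; for a rough kernel, a Lebesgue point of the homogeneous kernel is
dilated. For a constant kernel the tested commutator is a multiple of `∬ (b(x) - b(y)) f(y) h(x)`,
and unimodular `f` or `h` recover the mean oscillations of `b`. The error is bounded by small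
multiples of the same oscillations and is absorbed (`osc_le_commForm`).

Many cubes are tested at once. Suitable signs make the off-diagonal terms of a trilinear sum
harmless (`exists_signs`), so that `∑ |⟨[b,T](f_i,g_i),h_i⟩|` is at most `N ‖∑|f_i|‖_p ‖∑|g_i|‖_q
‖∑|h_i|‖_{r'}`. Since `1/p + 1/q + 1/r' = 1 - 1/s`, weights `τ_i` on cubes `P_i` give `c ∑
τ_i^{1-1/s} osc(P_i) ≤ C N (∑ τ_i |P_i|)^{1-1/s}` (`testing`), with `osc(P_i)` the integral over
`P_i` of the distance of `b` to its mean. The companions are cut down to major subsets of bounded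
overlap (`exists_bounded_overlap`); the `f_i` keep the whole cubes, so there the weights have to
grow geometrically.

This is applied inside a cube `Q` to the stopping cubes of the dyadic maximal function of `|b -
⟨b⟩_Q|` at levels `t_j = a₀ 2^{(d+2)j}`, where `a₀` is the mean of that function, with `τ = t_j^s`.
The mass `S = ∑ t_j^s |P|` controls the `L^s` norm of the dyadic averages, and `S ≤ C ∑ t_j^{s-1}
osc(P)` (`sum_level_le`). Hence `c S ≤ C N S^{1-1/s}`. Only finitely many cells occur, so `S` is
finite and `c S^{1/s} ≤ C N` follows without knowing that `b` is in `L^s`. Fatou's lemma, first in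
the generation and then along cubes exhausting space, finishes the proof. -/

noncomputable section

namespace BilinearSIO

section

variable {d : ℕ}

/-! ### Cubes and grids -/

lemma mem_cube {a : Rd d} {ℓ : ℝ} {x : Rd d} :
    x ∈ cube a ℓ ↔ ∀ i, a i ≤ x i ∧ x i < a i + ℓ := Iff.rfl

lemma cube_eq_preimage (a : Rd d) (ℓ : ℝ) :
    cube a ℓ = WithLp.ofLp ⁻¹' (Set.univ.pi fun i => Set.Ico (a i) (a i + ℓ)) := by
  ext x
  simp [mem_cube, Set.mem_pi]

lemma measurableSet_cube (a : Rd d) (ℓ : ℝ) : MeasurableSet (cube a ℓ) := by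
  rw [cube_eq_preimage]
  exact (PiLp.volume_preserving_ofLp (Fin d)).measurable
    (MeasurableSet.univ_pi fun i => measurableSet_Ico)

lemma volume_cube (a : Rd d) {ℓ : ℝ} (hℓ : 0 ≤ ℓ) :
    volume (cube a ℓ) = ENNReal.ofReal (ℓ ^ d) := by
  rw [cube_eq_preimage, (PiLp.volume_preserving_ofLp (Fin d)).measure_preimage
    (MeasurableSet.univ_pi fun i => measurableSet_Ico).nullMeasurableSet]
  rw [Real.volume_pi_Ico]
  simp [ENNReal.ofReal_pow hℓ]

lemma volume_real_cube (a : Rd d) {ℓ : ℝ} (hℓ : 0 ≤ ℓ) :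
    volume.real (cube a ℓ) = ℓ ^ d := by
  rw [Measure.real, volume_cube a hℓ, ENNReal.toReal_ofReal (by positivity)]

lemma volume_cube_lt_top (a : Rd d) {ℓ : ℝ} (hℓ : 0 ≤ ℓ) : volume (cube a ℓ) < ∞ := by
  rw [volume_cube a hℓ]; exact ENNReal.ofReal_lt_top

lemma norm_le_of_forall_abs_le {x : Rd d} {ℓ : ℝ} (hℓ : 0 ≤ ℓ) (h : ∀ i, |x i| ≤ ℓ) :
    ‖x‖ ≤ √d * ℓ := by
  rw [EuclideanSpace.norm_eq]
  have : √(∑ i, ‖x i‖ ^ 2) ≤ √((d : ℝ) * ℓ ^ 2) := by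
    apply Real.sqrt_le_sqrt
    calc ∑ i, ‖x i‖ ^ 2 ≤ ∑ _i : Fin d, ℓ ^ 2 := by
          refine Finset.sum_le_sum fun i _ => ?_
          rw [Real.norm_eq_abs]
          gcongr
          exact h i
      _ = d * ℓ ^ 2 := by simp
  rwa [Real.sqrt_mul (Nat.cast_nonneg d), Real.sqrt_sq hℓ] at this

lemma norm_sub_le_of_mem_cube {a : Rd d} {ℓ : ℝ} (hℓ : 0 ≤ ℓ) {x y : Rd d}
    (hx : x ∈ cube a ℓ) (hy : y ∈ cube a ℓ) : ‖x - y‖ ≤ √d * ℓ := by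
  refine norm_le_of_forall_abs_le hℓ fun i => ?_
  rw [PiLp.sub_apply, abs_le]
  constructor <;> linarith [(hx i).1, (hx i).2, (hy i).1, (hy i).2]

lemma cube_subset_closedBall {a : Rd d} {ℓ : ℝ} (hℓ : 0 ≤ ℓ) {x : Rd d} (hx : x ∈ cube a ℓ) :
    cube a ℓ ⊆ Metric.closedBall x (√d * ℓ) := fun y hy => by
  rw [Metric.mem_closedBall, dist_eq_norm]
  exact norm_sub_le_of_mem_cube hℓ hy hx

lemma self_mem_cube (a : Rd d) {ℓ : ℝ} (hℓ : 0 < ℓ) : a ∈ cube a ℓ := fun i =>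
  ⟨le_rfl, by linarith⟩

lemma closure_cube_subset_closedBall {a : Rd d} {ℓ : ℝ} (hℓ : 0 ≤ ℓ) {x : Rd d}
    (hx : x ∈ cube a ℓ) : closure (cube a ℓ) ⊆ Metric.closedBall x (√d * ℓ) :=
  closure_minimal (cube_subset_closedBall hℓ hx) Metric.isClosed_closedBall

lemma integrableOn_cube {E : Type*} [NormedAddCommGroup E] {u : Rd d → E}
    (hu : LocallyIntegrable u volume) (a : Rd d) {ℓ : ℝ} (hℓ : 0 < ℓ) :
    IntegrableOn u (cube a ℓ) volume :=
  (hu.integrableOn_isCompact (isCompact_closedBall a (√d * ℓ))).mono_set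
    (cube_subset_closedBall hℓ.le (self_mem_cube a hℓ))

lemma indicator_cube_mem_Sig (a : Rd d) {ℓ : ℝ} (hℓ : 0 < ℓ) :
    (cube a ℓ).indicator (fun _ => (1 : ℂ)) ∈ Sig d :=
  Submodule.subset_span ⟨a, ℓ, hℓ, rfl⟩

/-- The index of the cell of the grid of mesh `h` with origin `a` that contains `x`. -/
def gridIdx (a : Rd d) (h : ℝ) (x : Rd d) : Fin d → ℤ := fun i => ⌊(x i - a i) / h⌋

/-- The corner of the cell with index `ν` of the grid of mesh `h` with origin `a`. -/
def gridPt (a : Rd d) (h : ℝ) (ν : Fin d → ℤ) : Rd d :=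
  a + h • WithLp.toLp 2 (fun i => (ν i : ℝ))

lemma gridPt_apply (a : Rd d) (h : ℝ) (ν : Fin d → ℤ) (i : Fin d) :
    gridPt a h ν i = a i + h * ν i := by
  simp [gridPt]

/-- The cell with index `ν` of the grid of mesh `h` with origin `a`. -/
def gridCell (a : Rd d) (h : ℝ) (ν : Fin d → ℤ) : Set (Rd d) := cube (gridPt a h ν) h

lemma mem_gridCell {a : Rd d} {h : ℝ} (hh : 0 < h) {ν : Fin d → ℤ} {x : Rd d} :
    x ∈ gridCell a h ν ↔ gridIdx a h x = ν := by
  rw [gridCell, mem_cube, funext_iff]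
  refine forall_congr' fun i => ?_
  rw [gridIdx, Int.floor_eq_iff, gridPt_apply, le_div_iff₀ hh, div_lt_iff₀ hh]
  constructor <;> rintro ⟨h1, h2⟩ <;> constructor <;> linarith

lemma mem_gridCell_gridIdx (a : Rd d) {h : ℝ} (hh : 0 < h) (x : Rd d) :
    x ∈ gridCell a h (gridIdx a h x) := (mem_gridCell hh).2 rfl

/-- Integer division by `2` rounds down for negative indices too, so the grids with a common origin
and meshes `ℓ / 2 ^ k` are nested. -/
lemma gridIdx_half (a : Rd d) {h : ℝ} (hh : 0 < h) (x : Rd d) :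
    gridIdx a h x = fun i => gridIdx a (h / 2) x i / 2 := by
  funext i
  have := Int.floor_div_natCast ((x i - a i) / (h / 2)) 2
  simp only [gridIdx]
  rw [← Nat.cast_ofNat (R := ℤ) (n := 2), ← this]
  congr 1
  push_cast
  field_simp

lemma gridIdx_eq_of_le (a : Rd d) {ℓ : ℝ} (hℓ : 0 < ℓ) {m k : ℕ} (hmk : m ≤ k) {x y : Rd d}
    (h : gridIdx a (ℓ / 2 ^ k) x = gridIdx a (ℓ / 2 ^ k) y) :
    gridIdx a (ℓ / 2 ^ m) x = gridIdx a (ℓ / 2 ^ m) y := by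
  induction k, hmk using Nat.le_induction with
  | base => exact h
  | succ k _ ih =>
    apply ih
    have e : ℓ / 2 ^ (k + 1) = ℓ / 2 ^ k / 2 := by rw [pow_succ]; field_simp
    rw [gridIdx_half a (by positivity) x, gridIdx_half a (by positivity) y, ← e, h]

/-- The grid cell of generation `k` containing `x`, in the dyadic grid generated by the
cube `cube a ℓ`. -/
def dcell (a : Rd d) (ℓ : ℝ) (k : ℕ) (x : Rd d) : Set (Rd d) :=
  gridCell a (ℓ / 2 ^ k) (gridIdx a (ℓ / 2 ^ k) x)

lemma mem_dcell {a : Rd d} {ℓ : ℝ} (hℓ : 0 < ℓ) {k : ℕ} {x y : Rd d} :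
    y ∈ dcell a ℓ k x ↔ gridIdx a (ℓ / 2 ^ k) y = gridIdx a (ℓ / 2 ^ k) x :=
  mem_gridCell (by positivity)

lemma gridCell_zero (a : Rd d) (ℓ : ℝ) : gridCell a ℓ 0 = cube a ℓ := by
  rw [gridCell]
  congr 1
  ext i
  simp [gridPt_apply]

lemma gridIdx_eq_zero {a : Rd d} {ℓ : ℝ} (hℓ : 0 < ℓ) {x : Rd d} :
    gridIdx a ℓ x = 0 ↔ x ∈ cube a ℓ := by
  rw [← mem_gridCell hℓ, gridCell_zero]

lemma dcell_subset_cube {a : Rd d} {ℓ : ℝ} (hℓ : 0 < ℓ) {k : ℕ} {x : Rd d}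
    (hx : x ∈ cube a ℓ) : dcell a ℓ k x ⊆ cube a ℓ := fun y hy => by
  rw [← gridIdx_eq_zero hℓ] at hx ⊢
  rw [mem_dcell hℓ] at hy
  have := gridIdx_eq_of_le a hℓ (Nat.zero_le k) hy
  simpa [hx] using this

lemma volume_real_gridCell (a : Rd d) {h : ℝ} (hh : 0 ≤ h) (ν : Fin d → ℤ) :
    volume.real (gridCell a h ν) = h ^ d := volume_real_cube _ hh

lemma measurableSet_gridCell (a : Rd d) (h : ℝ) (ν : Fin d → ℤ) :
    MeasurableSet (gridCell a h ν) := measurableSet_cube _ _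

lemma measurable_gridIdx (a : Rd d) {h : ℝ} : Measurable (gridIdx a h) := by
  refine measurable_pi_lambda _ fun i => Int.measurable_floor.comp ?_
  fun_prop

/-- Lebesgue's differentiation theorem along dyadic grids. -/
theorem ae_tendsto_average_dcell {E : Type*} [NormedAddCommGroup E] [NormedSpace ℝ E]
    [CompleteSpace E] {u : Rd d → E} (hu : LocallyIntegrable u volume) (a : Rd d) {ℓ : ℝ}
    (hℓ : 0 < ℓ) :
    ∀ᵐ x, Tendsto (fun k => ⨍ y in dcell a ℓ k x, u y) atTop (𝓝 (u x)) := by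
  filter_upwards [IsUnifLocDoublingMeasure.ae_tendsto_average_norm_sub
    (volume : Measure (Rd d)) hu 1] with x hx
  -- The ball about `x` of radius `√d + 1` times the mesh contains the cell of `x` and has
  -- comparable volume. The `+ 1` keeps the radius positive when `d = 0`.
  have hc : (0 : ℝ) < √d + 1 := by positivity
  set δ : ℕ → ℝ := fun k => (√d + 1) * (ℓ / 2 ^ k) with hδ
  have hδpos : ∀ k, 0 < δ k := fun k => by positivity
  have hδ0 : Tendsto δ atTop (𝓝[>] 0) := by
    refine tendsto_nhdsWithin_iff.2 ⟨?_, Eventually.of_forall hδpos⟩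
    have : Tendsto (fun k : ℕ => ℓ * (1 / 2 : ℝ) ^ k) atTop (𝓝 (ℓ * 0)) :=
      (tendsto_pow_atTop_nhds_zero_of_lt_one (by norm_num) (by norm_num)).const_mul _
    have h2 := this.const_mul (√d + 1)
    simp only [mul_zero] at h2
    refine h2.congr fun k => ?_
    simp [hδ, div_eq_mul_inv]
  have key := hx (fun _ => x) δ hδ0 (Eventually.of_forall fun k => by
    simpa using (hδpos k).le)
  set V := volume.real (Metric.ball (0 : Rd d) 1) with hV
  have hb : ∀ k, volume.real (Metric.closedBall x (δ k)) = (√d + 1) ^ d * V * (ℓ / 2 ^ k) ^ d := by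
    intro k
    rw [Measure.real, Measure.addHaar_closedBall _ _ (hδpos k).le, ENNReal.toReal_mul,
      ENNReal.toReal_ofReal (by have := hδpos k; positivity), finrank_euclideanSpace_fin, hV,
      Measure.real, hδ, mul_pow]
    ring
  rw [tendsto_iff_norm_sub_tendsto_zero]
  have key2 := key.const_mul ((√d + 1) ^ d * V)
  rw [mul_zero] at key2
  refine squeeze_zero (fun _ => norm_nonneg _) (fun k => ?_) key2
  have hk : (0 : ℝ) < ℓ / 2 ^ k := by positivity
  have hsub : dcell a ℓ k x ⊆ Metric.closedBall x (δ k) := by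
    refine (cube_subset_closedBall hk.le (mem_gridCell_gridIdx a hk x)).trans ?_
    exact Metric.closedBall_subset_closedBall (by simp only [hδ]; nlinarith)
  have hvol : volume.real (dcell a ℓ k x) = (ℓ / 2 ^ k) ^ d := volume_real_gridCell _ hk.le _
  have hvpos : 0 < (ℓ / 2 ^ k) ^ d := by positivity
  have hint : IntegrableOn u (Metric.closedBall x (δ k)) :=
    hu.integrableOn_isCompact (isCompact_closedBall _ _)
  have hfin : volume (Metric.closedBall x (δ k)) < ∞ := measure_closedBall_lt_top
  have hint2 : IntegrableOn (fun y => u y - u x) (Metric.closedBall x (δ k)) :=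
    hint.sub (integrableOn_const hfin.ne)
  have h1 : (⨍ y in dcell a ℓ k x, u y) - u x = ⨍ y in dcell a ℓ k x, (u y - u x) := by
    rw [setAverage_eq, setAverage_eq, integral_sub (hint.mono_set hsub)
      (integrableOn_const ((measure_mono hsub).trans_lt hfin).ne), smul_sub, setIntegral_const,
      hvol, smul_smul, inv_mul_cancel₀ hvpos.ne', one_smul]
  rw [h1, setAverage_eq, setAverage_eq, hb, hvol, norm_smul, smul_eq_mul, norm_inv,
    Real.norm_of_nonneg hvpos.le]
  have hVpos : 0 < V := by
    rw [hV]
    exact ENNReal.toReal_pos (Metric.measure_ball_pos _ _ one_pos).ne' measure_ball_lt_top.ne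
  calc ((ℓ / 2 ^ k) ^ d)⁻¹ * ‖∫ y in dcell a ℓ k x, (u y - u x)‖
      ≤ ((ℓ / 2 ^ k) ^ d)⁻¹ * ∫ y in Metric.closedBall x (δ k), ‖u y - u x‖ := by
        gcongr
        refine (norm_integral_le_integral_norm _).trans ?_
        exact setIntegral_mono_set hint2.norm (Eventually.of_forall fun _ => norm_nonneg _)
          hsub.eventuallyLE
    _ = _ := by
        field_simp

end

section

variable {d : ℕ}

/-! ### Approximation by elements of `Σ` -/

/-- Dominated convergence in `L^p`. -/
lemma tendsto_eLpNorm_of_dominated {α E : Type*} [MeasurableSpace α] {μ : Measure α}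
    [NormedAddCommGroup E] {p : ℝ≥0∞} (hp : p ≠ 0) (hp' : p ≠ ∞) {F : ℕ → α → E} {f : α → E}
    {g : α → ℝ} (hF : ∀ n, AEStronglyMeasurable (F n) μ) (hf : AEStronglyMeasurable f μ)
    (hg : MemLp g p μ) (hb : ∀ n, ∀ᵐ x ∂μ, ‖F n x - f x‖ ≤ g x)
    (hlim : ∀ᵐ x ∂μ, Tendsto (fun n => F n x) atTop (𝓝 (f x))) :
    Tendsto (fun n => eLpNorm (F n - f) p μ) atTop (𝓝 0) := by
  have hp0 : 0 < p.toReal := ENNReal.toReal_pos hp hp'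
  have key : Tendsto (fun n => ∫⁻ x, ‖F n x - f x‖ₑ ^ p.toReal ∂μ) atTop (𝓝 (∫⁻ _, 0 ∂μ)) := by
    refine tendsto_lintegral_of_dominated_convergence' (fun x => ‖g x‖ₑ ^ p.toReal)
      (fun n => ((hF n).sub hf).enorm.pow_const _) (fun n => ?_) ?_ ?_
    · filter_upwards [hb n] with x hx
      refine ENNReal.rpow_le_rpow ?_ hp0.le
      rw [enorm_le_iff_norm_le]
      exact hx.trans (le_abs_self _)
    · exact (lintegral_rpow_enorm_lt_top_of_eLpNorm_lt_top hp hp' hg.2).ne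
    · filter_upwards [hlim] with x hx
      have h0 : Tendsto (fun n => ‖F n x - f x‖ₑ) atTop (𝓝 0) := by
        have := (hx.sub_const (f x)).enorm
        simpa using this
      have := (ENNReal.continuous_rpow_const (y := p.toReal)).tendsto 0 |>.comp h0
      simpa [ENNReal.zero_rpow_of_pos hp0, Function.comp_def] using this
  rw [lintegral_zero] at key
  have h2 := (ENNReal.continuous_rpow_const (y := 1 / p.toReal)).tendsto 0 |>.comp key
  rw [ENNReal.zero_rpow_of_pos (by positivity)] at h2
  refine h2.congr fun n => ?_
  rw [eLpNorm_eq_lintegral_rpow_enorm_toReal hp hp']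
  rfl

/-- The averages of `f` over the dyadic cells of generation `k` of `cube a ℓ`. -/
def dyadicAvg (a : Rd d) (ℓ : ℝ) (k : ℕ) (f : Rd d → ℂ) : Rd d → ℂ :=
  (cube a ℓ).indicator fun x => ⨍ y in dcell a ℓ k x, f y

/-- Indices of the dyadic cells of generation `k` of `cube a ℓ`. -/
def dyadicIdx (d k : ℕ) : Finset (Fin d → ℤ) := Fintype.piFinset fun _ => Finset.Ico 0 (2 ^ k)

lemma gridIdx_mem_dyadicIdx {a : Rd d} {ℓ : ℝ} (hℓ : 0 < ℓ) {k : ℕ} {x : Rd d} :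
    gridIdx a (ℓ / 2 ^ k) x ∈ dyadicIdx d k ↔ x ∈ cube a ℓ := by
  simp only [dyadicIdx, Fintype.mem_piFinset, Finset.mem_Ico, gridIdx, mem_cube]
  refine forall_congr' fun i => ?_
  rw [Int.floor_nonneg, Int.floor_lt, le_div_iff₀ (by positivity), div_lt_iff₀ (by positivity)]
  push_cast
  rw [mul_div_cancel₀ _ (by positivity)]
  constructor <;> rintro ⟨h1, h2⟩ <;> constructor <;> linarith

lemma dyadicAvg_eq_sum {a : Rd d} {ℓ : ℝ} (hℓ : 0 < ℓ) (k : ℕ) (f : Rd d → ℂ) :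
    dyadicAvg a ℓ k f = ∑ ν ∈ dyadicIdx d k, (⨍ y in gridCell a (ℓ / 2 ^ k) ν, f y) •
      (gridCell a (ℓ / 2 ^ k) ν).indicator (fun _ => (1 : ℂ)) := by
  have hk : 0 < ℓ / 2 ^ k := by positivity
  funext x
  rw [Finset.sum_apply]
  by_cases hx : x ∈ cube a ℓ
  · rw [dyadicAvg, Set.indicator_of_mem hx,
      Finset.sum_eq_single_of_mem _ ((gridIdx_mem_dyadicIdx hℓ).2 hx)]
    · rw [Pi.smul_apply, Set.indicator_of_mem (mem_gridCell_gridIdx a hk x)]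
      simp [dcell]
    · intro ν _ hne
      rw [Pi.smul_apply, Set.indicator_of_notMem, smul_zero]
      rw [mem_gridCell hk]
      exact fun h => hne h.symm
  · rw [dyadicAvg, Set.indicator_of_notMem hx]
    symm
    refine Finset.sum_eq_zero fun ν hν => ?_
    rw [Pi.smul_apply, Set.indicator_of_notMem, smul_zero]
    rw [mem_gridCell hk]
    rintro rfl
    exact hx ((gridIdx_mem_dyadicIdx hℓ).1 hν)

lemma dyadicAvg_mem_Sig {a : Rd d} {ℓ : ℝ} (hℓ : 0 < ℓ) (k : ℕ) (f : Rd d → ℂ) :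
    dyadicAvg a ℓ k f ∈ Sig d := by
  rw [dyadicAvg_eq_sum hℓ]
  exact Submodule.sum_mem _ fun ν _ =>
    Submodule.smul_mem _ _ (indicator_cube_mem_Sig _ (by positivity))

lemma norm_dyadicAvg_le {a : Rd d} {ℓ : ℝ} (hℓ : 0 < ℓ) (k : ℕ) {f : Rd d → ℂ} {M : ℝ}
    (hM : ∀ x, ‖f x‖ ≤ M) (x : Rd d) : ‖dyadicAvg a ℓ k f x‖ ≤ M := by
  have hM0 : 0 ≤ M := (norm_nonneg _).trans (hM 0)
  have hk : 0 < ℓ / 2 ^ k := by positivity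
  refine (norm_indicator_le_norm_self _ _).trans ?_
  rw [setAverage_eq, dcell, volume_real_gridCell _ hk.le, norm_smul, norm_inv,
    Real.norm_of_nonneg (by positivity)]
  have := norm_setIntegral_le_of_norm_le_const (μ := volume) (f := f) (C := M)
    (volume_cube_lt_top (gridPt a (ℓ / 2 ^ k) (gridIdx a (ℓ / 2 ^ k) x)) hk.le) (fun y _ => hM y)
  rw [volume_real_cube _ hk.le] at this
  rw [inv_mul_le_iff₀ (by positivity), mul_comm]
  exact this

lemma memLp_of_bounded {f : Rd d → ℂ} (hf : AEStronglyMeasurable f volume) {M : ℝ}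
    (hM : ∀ x, ‖f x‖ ≤ M) {a : Rd d} {ℓ : ℝ} (hℓ : 0 < ℓ) (hs : ∀ x ∉ cube a ℓ, f x = 0)
    (p : ℝ≥0∞) : MemLp f p volume := by
  have h1 : f = (cube a ℓ).indicator f := by
    funext x
    by_cases hx : x ∈ cube a ℓ
    · rw [Set.indicator_of_mem hx]
    · rw [Set.indicator_of_notMem hx, hs x hx]
  rw [h1, memLp_indicator_iff_restrict (measurableSet_cube a ℓ)]
  have : IsFiniteMeasure (volume.restrict (cube a ℓ)) :=
    ⟨by rw [Measure.restrict_apply_univ]; exact volume_cube_lt_top a hℓ.le⟩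
  exact MemLp.of_bound hf.restrict M (Eventually.of_forall hM)

/-- Bounded functions supported in a cube are limits of bounded elements of `Σ` supported in the
same cube. -/
lemma exists_Sig_seq {f : Rd d → ℂ} (hf : AEStronglyMeasurable f volume) {M : ℝ}
    (hM : ∀ x, ‖f x‖ ≤ M) {a : Rd d} {ℓ : ℝ} (hℓ : 0 < ℓ) (hs : ∀ x ∉ cube a ℓ, f x = 0) :
    ∃ F : ℕ → Sig d, (∀ n x, ‖(F n : Rd d → ℂ) x‖ ≤ M) ∧
      (∀ n, ∀ x ∉ cube a ℓ, (F n : Rd d → ℂ) x = 0) ∧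
      ∀ᵐ x, Tendsto (fun n => (F n : Rd d → ℂ) x) atTop (𝓝 (f x)) := by
  refine ⟨fun k => ⟨dyadicAvg a ℓ k f, dyadicAvg_mem_Sig hℓ k f⟩,
    fun k x => norm_dyadicAvg_le hℓ k hM x, fun k x hx => by
      simp [dyadicAvg, hx], ?_⟩
  have hint : LocallyIntegrable f volume :=
    (memLp_one_iff_integrable.1 (memLp_of_bounded hf hM hℓ hs 1)).locallyIntegrable
  filter_upwards [ae_tendsto_average_dcell hint a hℓ] with x hx
  by_cases hxc : x ∈ cube a ℓ
  · simpa [dyadicAvg, hxc] using hx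
  · simp [dyadicAvg, hxc, hs x hxc]

lemma Sig_induction {P : (Rd d → ℂ) → Prop} (h0 : P 0) (hadd : ∀ f g, P f → P g → P (f + g))
    (hsmul : ∀ (c : ℂ) f, P f → P (c • f))
    (hcube : ∀ (a : Rd d) (ℓ : ℝ), 0 < ℓ → P ((cube a ℓ).indicator fun _ => 1)) (f : Sig d) :
    P f := by
  refine Submodule.span_induction (p := fun f _ => P f) ?_ h0 (fun f g _ _ => hadd f g)
    (fun c f _ => hsmul c f) f.2
  rintro _ ⟨a, ℓ, hℓ, rfl⟩
  exact hcube a ℓ hℓ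

lemma Sig_memLp (f : Sig d) (p : ℝ≥0∞) : MemLp (f : Rd d → ℂ) p volume := by
  refine Sig_induction (P := fun f => MemLp f p volume) MemLp.zero (fun f g hf hg => hf.add hg)
    (fun c f hf => hf.const_smul c) (fun a ℓ hℓ => ?_) f
  exact memLp_indicator_const p (measurableSet_cube a ℓ) 1 (Or.inr (volume_cube_lt_top a hℓ.le).ne)

lemma Sig_measurable (f : Sig d) : Measurable (f : Rd d → ℂ) := by
  refine Sig_induction (P := fun f => Measurable f) measurable_zero (fun f g hf hg => hf.add hg)
    (fun c f hf => hf.const_smul c) (fun a ℓ _ => ?_) f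
  exact measurable_const.indicator (measurableSet_cube a ℓ)

lemma exists_mem_cube_nat (x : Rd d) :
    ∀ᶠ n : ℕ in atTop, x ∈ cube (WithLp.toLp 2 (fun _ => -((n : ℝ) + 1)) : Rd d) (2 * (n + 1)) := by
  obtain ⟨N, hN⟩ := exists_nat_ge ‖x‖
  filter_upwards [eventually_ge_atTop N] with n hn i
  have h1 : |x i| ≤ n := by
    have := PiLp.norm_apply_le x i
    rw [Real.norm_eq_abs] at this
    exact this.trans (hN.trans (by exact_mod_cast hn))
  rw [abs_le] at h1
  constructor <;> simp <;> linarith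

/-- Elements of `L^p ∩ L^t` are limits of elements of `Σ` in both norms. -/
lemma exists_Sig_tendsto {p t : ℝ≥0∞} (hp : 1 ≤ p) (hp' : p ≠ ∞) (ht : 1 ≤ t) (ht' : t ≠ ∞)
    {f : Rd d → ℂ} (hfp : MemLp f p volume) (hft : MemLp f t volume) {ε : ℝ≥0∞} (hε : 0 < ε) :
    ∃ F : Sig d, eLpNorm ((F : Rd d → ℂ) - f) p volume < ε ∧
      eLpNorm ((F : Rd d → ℂ) - f) t volume < ε := by
  by_cases hεt : ε = ∞
  · subst hεt
    exact ⟨0, ((Sig_memLp 0 p).sub hfp).2, ((Sig_memLp 0 t).sub hft).2⟩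
  set h : Rd d → ℂ := hfp.1.mk f with hh
  have hfh : f =ᵐ[volume] h := hfp.1.ae_eq_mk
  have hhm : Measurable h := hfp.1.stronglyMeasurable_mk.measurable
  set Q : ℕ → Set (Rd d) := fun n =>
    cube (WithLp.toLp 2 (fun _ => -((n : ℝ) + 1)) : Rd d) (2 * (n + 1)) with hQ
  -- Cutting `f` both in size and in support leaves a bounded function on a cube. Its dyadic
  -- averages obey the same bounds, so dominated convergence applies to both exponents with the same
  -- approximants.
  set S : ℕ → Set (Rd d) := fun n => Q n ∩ {x | ‖h x‖ ≤ n} with hS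
  have hSm : ∀ n, MeasurableSet (S n) := fun n =>
    (measurableSet_cube _ _).inter (measurableSet_le hhm.norm measurable_const)
  have hlim : ∀ x, Tendsto (fun n => (S n).indicator h x) atTop (𝓝 (h x)) := by
    intro x
    refine tendsto_const_nhds.congr' ?_
    obtain ⟨N, hN⟩ := exists_nat_ge ‖h x‖
    filter_upwards [exists_mem_cube_nat x, eventually_ge_atTop N] with n h1 h2
    rw [Set.indicator_of_mem]
    exact ⟨h1, hN.trans (by exact_mod_cast h2)⟩
  have conv : ∀ v : ℝ≥0∞, v ≠ 0 → v ≠ ∞ → MemLp f v volume →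
      Tendsto (fun n => eLpNorm ((S n).indicator h - h) v volume) atTop (𝓝 0) := by
    intro v hv hv' hfv
    have hhv : MemLp h v volume := hfv.ae_eq hfh
    refine tendsto_eLpNorm_of_dominated hv hv'
      (fun n => (hhm.indicator (hSm n)).aestronglyMeasurable) hhm.aestronglyMeasurable hhv.norm
      (fun n => Eventually.of_forall fun x => ?_) (Eventually.of_forall hlim)
    by_cases hx : x ∈ S n <;> simp [hx]
  have hε2 : 0 < ε / 2 := ENNReal.half_pos hε.ne'
  obtain ⟨n, hn1, hn2⟩ := (((conv p (one_pos.trans_le hp).ne' hp' hfp).eventually_lt_const hε2).and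
    ((conv t (one_pos.trans_le ht).ne' ht' hft).eventually_lt_const hε2)).exists
  set w := (S n).indicator h with hw
  have hwm : AEStronglyMeasurable w volume := (hhm.indicator (hSm n)).aestronglyMeasurable
  have hwb : ∀ x, ‖w x‖ ≤ n := by
    intro x
    by_cases hx : x ∈ S n
    · rw [hw, Set.indicator_of_mem hx]; exact hx.2
    · rw [hw, Set.indicator_of_notMem hx]; simp
  have hl : (0 : ℝ) < 2 * (n + 1) := by positivity
  have hws : ∀ x ∉ Q n, w x = 0 := fun x hx => Set.indicator_of_notMem (fun h => hx h.1) _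
  obtain ⟨F, hF1, hF2, hF3⟩ := exists_Sig_seq hwm hwb hl hws
  have conv2 : ∀ v : ℝ≥0∞, v ≠ 0 → v ≠ ∞ →
      Tendsto (fun k => eLpNorm ((F k : Rd d → ℂ) - w) v volume) atTop (𝓝 0) := by
    intro v hv hv'
    refine tendsto_eLpNorm_of_dominated (g := (Q n).indicator fun _ => (2 * n : ℝ)) hv hv'
      (fun k => (Sig_measurable _).aestronglyMeasurable) hwm
      (memLp_indicator_const v (measurableSet_cube _ _) _
        (Or.inr (volume_cube_lt_top _ hl.le).ne))
      (fun k => Eventually.of_forall fun x => ?_) hF3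
    by_cases hx : x ∈ Q n
    · rw [Set.indicator_of_mem hx]
      refine (norm_sub_le _ _).trans ?_
      linarith [hF1 k x, hwb x]
    · rw [Set.indicator_of_notMem hx, hF2 k x hx, hws x hx]
      simp
  obtain ⟨k, hk1, hk2⟩ := (((conv2 p (one_pos.trans_le hp).ne' hp').eventually_lt_const hε2).and
    ((conv2 t (one_pos.trans_le ht).ne' ht').eventually_lt_const hε2)).exists
  have tri : ∀ v : ℝ≥0∞, 1 ≤ v → eLpNorm ((F k : Rd d → ℂ) - w) v volume < ε / 2 →
      eLpNorm (w - h) v volume < ε / 2 → eLpNorm ((F k : Rd d → ℂ) - f) v volume < ε := by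
    intro v hv h1 h2
    have e : eLpNorm ((F k : Rd d → ℂ) - f) v volume
        = eLpNorm (((F k : Rd d → ℂ) - w) + (w - h)) v volume := by
      refine eLpNorm_congr_ae ?_
      filter_upwards [hfh] with x hx
      simp [hx]
    rw [e, ← ENNReal.add_halves ε]
    exact (eLpNorm_add_le ((Sig_measurable _).aestronglyMeasurable.sub hwm)
      (hwm.sub hhm.aestronglyMeasurable) hv).trans_lt (ENNReal.add_lt_add h1 h2)
  exact ⟨F k, tri p hp hk1 hn1, tri t ht hk2 hn2⟩

end

section

variable {d : ℕ}

/-! ### The extension of a bounded bilinear operator -/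

lemma eLpNorm_sub_le_add {E : Type*} [NormedAddCommGroup E] {α : Type*} [MeasurableSpace α]
    {μ : Measure α} {p : ℝ≥0∞} (hp : 1 ≤ p) {f g h : α → E} (hf : AEStronglyMeasurable f μ)
    (hg : AEStronglyMeasurable g μ) (hh : AEStronglyMeasurable h μ) :
    eLpNorm (f - h) p μ ≤ eLpNorm (f - g) p μ + eLpNorm (g - h) p μ := by
  have := eLpNorm_add_le (hf.sub hg) (hg.sub hh) hp
  rwa [sub_add_sub_cancel] at this

lemma eLpNorm_le_sub_add {E : Type*} [NormedAddCommGroup E] {α : Type*} [MeasurableSpace α]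
    {μ : Measure α} {p : ℝ≥0∞} (hp : 1 ≤ p) {f g : α → E} (hf : AEStronglyMeasurable f μ)
    (hg : AEStronglyMeasurable g μ) :
    eLpNorm f p μ ≤ eLpNorm (f - g) p μ + eLpNorm g p μ := by
  have := eLpNorm_add_le (hf.sub hg) hg hp
  rwa [sub_add_cancel] at this

lemma tendsto_eLpNorm_of_sub {α E : Type*} [MeasurableSpace α] {μ : Measure α}
    [NormedAddCommGroup E] {p : ℝ≥0∞} (hp : 1 ≤ p) {F : ℕ → α → E} {f : α → E}
    (hF : ∀ n, MemLp (F n) p μ) (hf : MemLp f p μ)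
    (h : Tendsto (fun n => eLpNorm (F n - f) p μ) atTop (𝓝 0)) :
    Tendsto (fun n => eLpNorm (F n) p μ) atTop (𝓝 (eLpNorm f p μ)) := by
  have h1 : ∀ n, eLpNorm (F n) p μ ≤ eLpNorm (F n - f) p μ + eLpNorm f p μ := fun n =>
    eLpNorm_le_sub_add hp (hF n).1 hf.1
  have h2 : ∀ n, eLpNorm f p μ - eLpNorm (F n - f) p μ ≤ eLpNorm (F n) p μ := fun n => by
    rw [tsub_le_iff_left, eLpNorm_sub_comm]
    exact eLpNorm_le_sub_add hp hf.1 (hF n).1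
  refine tendsto_of_tendsto_of_tendsto_of_le_of_le ?_ ?_ h2 h1
  · have := ENNReal.Tendsto.sub (tendsto_const_nhds (x := eLpNorm f p μ)) h
      (Or.inl hf.2.ne)
    simpa using this
  · simpa using h.add_const (eLpNorm f p μ)

variable {T : BilinOp d} {p q t : ℝ≥0∞} {M : ℝ≥0}

lemma BoundedBy.memLp (hT : BoundedBy T p q t M) (F G : Sig d) : MemLp (T F G) t volume :=
  ⟨(T F G).aestronglyMeasurable, (hT F G).trans_lt
    (ENNReal.mul_lt_top (ENNReal.mul_lt_top ENNReal.coe_lt_top (Sig_memLp F p).2)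
      (Sig_memLp G q).2)⟩

lemma coeFn_sub_eq (T : BilinOp d) (F F' G G' : Sig d) :
    ((T F G : Rd d → ℂ) - (T F' G' : Rd d → ℂ)) =ᵐ[volume] ((T (F - F') G : Rd d → ℂ) + (T F' (G - G') : Rd d → ℂ)) := by
  have e : T F G - T F' G' = T (F - F') G + T F' (G - G') := by
    simp [map_sub, LinearMap.sub_apply]
  filter_upwards [AEEqFun.coeFn_sub (T F G) (T F' G'),
    AEEqFun.coeFn_add (T (F - F') G) (T F' (G - G'))] with x h1 h2
  rw [← h1, e, h2]

lemma BoundedBy.sub_le (ht : 1 ≤ t) (hT : BoundedBy T p q t M) (F F' G G' : Sig d) :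
    eLpNorm ((T F G : Rd d → ℂ) - (T F' G' : Rd d → ℂ)) t volume ≤
      M * eLpNorm ((F : Rd d → ℂ) - (F' : Rd d → ℂ)) p volume * eLpNorm (G : Rd d → ℂ) q volume +
      M * eLpNorm (F' : Rd d → ℂ) p volume * eLpNorm ((G : Rd d → ℂ) - (G' : Rd d → ℂ)) q volume := by
  rw [eLpNorm_congr_ae (coeFn_sub_eq T F F' G G')]
  refine (eLpNorm_add_le (AEEqFun.aestronglyMeasurable _) (AEEqFun.aestronglyMeasurable _)
    ht).trans ?_
  exact add_le_add (hT (F - F') G) (hT F' (G - G'))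

/-- By bilinearity and boundedness, two approximations of one pair have asymptotically equal values.
The general filter serves two purposes: independence of the extension from the approximation and,
along pairs of indices, the Cauchy property. -/
lemma BoundedBy.tendsto_sub (hp : 1 ≤ p) (hq : 1 ≤ q) (ht : 1 ≤ t) (hT : BoundedBy T p q t M)
    {f g : Rd d → ℂ} (hf : MemLp f p volume) (hg : MemLp g q volume) {ι : Type*} {l : Filter ι}
    {F F' G G' : ι → Sig d}
    (hF : Tendsto (fun n => eLpNorm ((F n : Rd d → ℂ) - f) p volume) l (𝓝 0))
    (hF' : Tendsto (fun n => eLpNorm ((F' n : Rd d → ℂ) - f) p volume) l (𝓝 0))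
    (hG : Tendsto (fun n => eLpNorm ((G n : Rd d → ℂ) - g) q volume) l (𝓝 0))
    (hG' : Tendsto (fun n => eLpNorm ((G' n : Rd d → ℂ) - g) q volume) l (𝓝 0)) :
    Tendsto (fun n => eLpNorm ((T (F n) (G n) : Rd d → ℂ) - (T (F' n) (G' n) : Rd d → ℂ)) t volume) l
      (𝓝 0) := by
  have m : ∀ {v : ℝ≥0∞} (H : Sig d), AEStronglyMeasurable (H : Rd d → ℂ) volume := fun H =>
    (Sig_measurable H).aestronglyMeasurable
  have b : ∀ n, eLpNorm ((T (F n) (G n) : Rd d → ℂ) - (T (F' n) (G' n) : Rd d → ℂ)) t volume ≤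
      M * (eLpNorm ((F n : Rd d → ℂ) - f) p volume + eLpNorm ((F' n : Rd d → ℂ) - f) p volume) *
        (eLpNorm ((G n : Rd d → ℂ) - g) q volume + eLpNorm g q volume) +
      M * (eLpNorm ((F' n : Rd d → ℂ) - f) p volume + eLpNorm f p volume) *
        (eLpNorm ((G n : Rd d → ℂ) - g) q volume +
          eLpNorm ((G' n : Rd d → ℂ) - g) q volume) := fun n => by
    refine (hT.sub_le ht _ _ _ _).trans ?_
    gcongr
    · rw [eLpNorm_sub_comm (F' n : Rd d → ℂ)]
      exact eLpNorm_sub_le_add hp (m (v := 1) _) hf.1 (m (v := 1) _)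
    · exact eLpNorm_le_sub_add hq (m (v := 1) _) hg.1
    · exact eLpNorm_le_sub_add hp (m (v := 1) _) hf.1
    · rw [eLpNorm_sub_comm (G' n : Rd d → ℂ)]
      exact eLpNorm_sub_le_add hq (m (v := 1) _) hg.1 (m (v := 1) _)
  refine tendsto_of_tendsto_of_tendsto_of_le_of_le tendsto_const_nhds ?_ (fun _ => zero_le) b
  have A : Tendsto (fun n => M * (eLpNorm ((F n : Rd d → ℂ) - f) p volume +
      eLpNorm ((F' n : Rd d → ℂ) - f) p volume)) l (𝓝 (M * (0 + 0))) :=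
    ENNReal.Tendsto.const_mul (hF.add hF') (Or.inr ENNReal.coe_ne_top)
  have B := hG.add_const (eLpNorm g q volume)
  have C : Tendsto (fun n => M * (eLpNorm ((F' n : Rd d → ℂ) - f) p volume +
      eLpNorm f p volume)) l (𝓝 (M * (0 + eLpNorm f p volume))) :=
    ENNReal.Tendsto.const_mul (hF'.add_const _) (Or.inr ENNReal.coe_ne_top)
  have D := hG.add hG'
  simp only [zero_add, mul_zero] at A B C D
  have AB := ENNReal.Tendsto.mul A (Or.inr hg.2.ne) B (Or.inr ENNReal.zero_ne_top)
  have CD := ENNReal.Tendsto.mul C (Or.inr ENNReal.zero_ne_top) D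
    (Or.inr (ENNReal.mul_ne_top ENNReal.coe_ne_top hf.2.ne))
  simpa using AB.add CD

/-- The value of the extension is the limit along any approximation. -/
lemma IsExtValue.tendsto (hp : 1 ≤ p) (hq : 1 ≤ q) (ht : 1 ≤ t) (hT : BoundedBy T p q t M)
    {f g u : Rd d → ℂ} (h : IsExtValue T p q t f g u) {F G : ℕ → Sig d}
    (hF : Tendsto (fun n => eLpNorm ((F n : Rd d → ℂ) - f) p volume) atTop (𝓝 0))
    (hG : Tendsto (fun n => eLpNorm ((G n : Rd d → ℂ) - g) q volume) atTop (𝓝 0)) :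
    Tendsto (fun n => eLpNorm ((T (F n) (G n) : Rd d → ℂ) - u) t volume) atTop (𝓝 0) := by
  obtain ⟨F', G', hF', hG', hu⟩ := h.approx
  have h1 := hT.tendsto_sub hp hq ht h.memLp_left h.memLp_right hF hF' hG hG'
  refine tendsto_of_tendsto_of_tendsto_of_le_of_le tendsto_const_nhds ?_ (fun _ => zero_le)
    (fun n => eLpNorm_sub_le_add ht (AEEqFun.aestronglyMeasurable _)
      (AEEqFun.aestronglyMeasurable (T (F' n) (G' n))) h.memLp_value.1)
  simpa using h1.add hu

/-- Limits in two Lebesgue spaces agree. -/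
lemma ae_eq_of_tendsto_eLpNorm {t t' : ℝ≥0∞} (ht : t ≠ 0) (ht' : t' ≠ 0) {F : ℕ → Rd d → ℂ}
    {u u' : Rd d → ℂ} (hF : ∀ n, AEStronglyMeasurable (F n) volume)
    (hu : AEStronglyMeasurable u volume) (hu' : AEStronglyMeasurable u' volume)
    (h : Tendsto (fun n => eLpNorm (F n - u) t volume) atTop (𝓝 0))
    (h' : Tendsto (fun n => eLpNorm (F n - u') t' volume) atTop (𝓝 0)) : u =ᵐ[volume] u' :=
  tendstoInMeasure_ae_unique (tendstoInMeasure_of_tendsto_eLpNorm ht hF hu h)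
    (tendstoInMeasure_of_tendsto_eLpNorm ht' hF hu' h')

lemma exists_Sig_seq_tendsto {p t : ℝ≥0∞} (hp : 1 ≤ p) (hp' : p ≠ ∞) (ht : 1 ≤ t) (ht' : t ≠ ∞)
    {f : Rd d → ℂ} (hfp : MemLp f p volume) (hft : MemLp f t volume) :
    ∃ F : ℕ → Sig d,
      Tendsto (fun n => eLpNorm ((F n : Rd d → ℂ) - f) p volume) atTop (𝓝 0) ∧
      Tendsto (fun n => eLpNorm ((F n : Rd d → ℂ) - f) t volume) atTop (𝓝 0) := by
  have hε : ∀ n : ℕ, (0 : ℝ≥0∞) < ((n : ℝ≥0∞) + 1)⁻¹ := fun n =>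
    ENNReal.inv_pos.2 (by simp)
  choose F hF1 hF2 using fun n : ℕ => exists_Sig_tendsto hp hp' ht ht' hfp hft (hε n)
  have h0 : Tendsto (fun n : ℕ => ((n : ℝ≥0∞) + 1)⁻¹) atTop (𝓝 0) := by
    have := (tendsto_add_atTop_iff_nat 1).2 ENNReal.tendsto_inv_nat_nhds_zero
    simpa using this
  exact ⟨F, tendsto_of_tendsto_of_tendsto_of_le_of_le tendsto_const_nhds h0
    (fun _ => zero_le) fun n => (hF1 n).le,
    tendsto_of_tendsto_of_tendsto_of_le_of_le tendsto_const_nhds h0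
    (fun _ => zero_le) fun n => (hF2 n).le⟩

/-- The extensions to `L^p × L^q` and to `L^{p'} × L^q` agree on the intersection. -/
lemma IsExtValue.ae_eq {p' t' : ℝ≥0∞} {M' : ℝ≥0} (hp : 1 ≤ p) (hpt : p ≠ ∞) (hp' : 1 ≤ p')
    (hpt' : p' ≠ ∞) (hq : 1 ≤ q) (hqt : q ≠ ∞) (ht : 1 ≤ t) (ht' : 1 ≤ t')
    (hT : BoundedBy T p q t M) (hT' : BoundedBy T p' q t' M') {f g u u' : Rd d → ℂ}
    (h : IsExtValue T p q t f g u) (h' : IsExtValue T p' q t' f g u') : u =ᵐ[volume] u' := by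
  obtain ⟨F, hF, hF'⟩ := exists_Sig_seq_tendsto hp hpt hp' hpt' h.memLp_left h'.memLp_left
  obtain ⟨G, hG, -⟩ := exists_Sig_seq_tendsto hq hqt hq hqt h.memLp_right h.memLp_right
  exact ae_eq_of_tendsto_eLpNorm (one_pos.trans_le ht).ne' (one_pos.trans_le ht').ne'
    (fun n => AEEqFun.aestronglyMeasurable (T (F n) (G n))) h.memLp_value.1 h'.memLp_value.1
    (h.tendsto hp hq ht hT hF hG) (h'.tendsto hp' hq ht' hT' hF' hG)

lemma IsExtValue.eLpNorm_le (hp : 1 ≤ p) (hq : 1 ≤ q) (ht : 1 ≤ t) (hT : BoundedBy T p q t M)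
    {f g u : Rd d → ℂ} (h : IsExtValue T p q t f g u) :
    eLpNorm u t volume ≤ M * eLpNorm f p volume * eLpNorm g q volume := by
  obtain ⟨F, G, hF, hG, hu⟩ := h.approx
  have h1 := tendsto_eLpNorm_of_sub hp (fun n => Sig_memLp (F n) p) h.memLp_left hF
  have h2 := tendsto_eLpNorm_of_sub hq (fun n => Sig_memLp (G n) q) h.memLp_right hG
  have h3 := tendsto_eLpNorm_of_sub ht (fun n => hT.memLp (F n) (G n)) h.memLp_value hu
  refine le_of_tendsto_of_tendsto' h3 ?_ (fun n => hT (F n) (G n))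
  have h4 : Tendsto (fun n => M * eLpNorm (F n : Rd d → ℂ) p volume) atTop
      (𝓝 (M * eLpNorm f p volume)) :=
    ENNReal.Tendsto.const_mul h1 (Or.inr ENNReal.coe_ne_top)
  exact ENNReal.Tendsto.mul h4 (Or.inr h.memLp_right.2.ne) h2
    (Or.inr (ENNReal.mul_ne_top ENNReal.coe_ne_top h.memLp_left.2.ne))

/-- The extension is defined on all of `L^p × L^q`. -/
lemma BoundedBy.exists_isExtValue (hp : 1 ≤ p) (hpt : p ≠ ∞) (hq : 1 ≤ q) (hqt : q ≠ ∞)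
    (ht : 1 ≤ t) (hT : BoundedBy T p q t M) {f g : Rd d → ℂ} (hf : MemLp f p volume)
    (hg : MemLp g q volume) : ∃ u, IsExtValue T p q t f g u := by
  obtain ⟨F, hF, -⟩ := exists_Sig_seq_tendsto hp hpt hp hpt hf hf
  obtain ⟨G, hG, -⟩ := exists_Sig_seq_tendsto hq hqt hq hqt hg hg
  have : Fact (1 ≤ t) := ⟨ht⟩
  set V : ℕ → Lp ℂ t (volume : Measure (Rd d)) := fun n => (hT.memLp (F n) (G n)).toLp _ with hV
  have hc : CauchySeq V := by
    rw [cauchySeq_iff_tendsto_dist_atTop_0]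
    have f1 : Tendsto (fun n : ℕ × ℕ => n.1) atTop atTop := (prod_atTop_atTop_eq (α := ℕ) (β := ℕ) ▸ tendsto_fst)
    have f2 : Tendsto (fun n : ℕ × ℕ => n.2) atTop atTop := (prod_atTop_atTop_eq (α := ℕ) (β := ℕ) ▸ tendsto_snd)
    have h1 := hT.tendsto_sub hp hq ht hf hg (hF.comp f1) (hF.comp f2) (hG.comp f1) (hG.comp f2)
    have h2 := (ENNReal.tendsto_toReal ENNReal.zero_ne_top).comp h1
    rw [ENNReal.toReal_zero] at h2
    refine h2.congr fun n => ?_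
    simp only [hV, Lp.dist_def, Function.comp_apply]
    congr 1
    refine eLpNorm_congr_ae ?_
    filter_upwards [MemLp.coeFn_toLp (hT.memLp (F n.1) (G n.1)),
      MemLp.coeFn_toLp (hT.memLp (F n.2) (G n.2))] with x hx hx'
    simp [hx, hx']
  obtain ⟨v, hv⟩ := cauchySeq_tendsto_of_complete hc
  refine ⟨v, hf, hg, Lp.memLp v, F, G, hF, hG, ?_⟩
  rw [Lp.tendsto_Lp_iff_tendsto_eLpNorm'] at hv
  refine hv.congr fun n => eLpNorm_congr_ae ?_
  filter_upwards [MemLp.coeFn_toLp (hT.memLp (F n) (G n))] with x hx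
  simp [hV, hx]

lemma tendsto_eLpNorm_add {α E : Type*} [MeasurableSpace α] {μ : Measure α}
    [NormedAddCommGroup E] {p : ℝ≥0∞} (hp : 1 ≤ p) {F F' : ℕ → α → E} {f f' : α → E}
    (hF : ∀ n, AEStronglyMeasurable (F n) μ) (hF' : ∀ n, AEStronglyMeasurable (F' n) μ)
    (hf : AEStronglyMeasurable f μ) (hf' : AEStronglyMeasurable f' μ)
    (h : Tendsto (fun n => eLpNorm (F n - f) p μ) atTop (𝓝 0))
    (h' : Tendsto (fun n => eLpNorm (F' n - f') p μ) atTop (𝓝 0)) :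
    Tendsto (fun n => eLpNorm (F n + F' n - (f + f')) p μ) atTop (𝓝 0) := by
  refine tendsto_of_tendsto_of_tendsto_of_le_of_le tendsto_const_nhds
    (by simpa using h.add h') (fun _ => zero_le) (fun n => ?_)
  rw [add_sub_add_comm]
  exact eLpNorm_add_le ((hF n).sub hf) ((hF' n).sub hf') hp

lemma tendsto_eLpNorm_smul {α : Type*} [MeasurableSpace α] {μ : Measure α}
    {p : ℝ≥0∞} (c : ℂ) {F : ℕ → α → ℂ} {f : α → ℂ}
    (h : Tendsto (fun n => eLpNorm (F n - f) p μ) atTop (𝓝 0)) :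
    Tendsto (fun n => eLpNorm (c • F n - c • f) p μ) atTop (𝓝 0) := by
  have : Tendsto (fun n => ‖c‖ₑ * eLpNorm (F n - f) p μ) atTop (𝓝 (‖c‖ₑ * 0)) :=
    ENNReal.Tendsto.const_mul h (Or.inr enorm_ne_top)
  rw [mul_zero] at this
  refine this.congr fun n => ?_
  rw [← smul_sub, eLpNorm_const_smul]

lemma IsExtValue.add_left (hp : 1 ≤ p) (hq : 1 ≤ q) (ht : 1 ≤ t) (hT : BoundedBy T p q t M)
    {f f' g u u' : Rd d → ℂ} (h : IsExtValue T p q t f g u) (h' : IsExtValue T p q t f' g u') :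
    IsExtValue T p q t (f + f') g (u + u') := by
  obtain ⟨F, G, hF, hG, hl⟩ := h.approx
  obtain ⟨F', -, hF', -, -⟩ := h'.approx
  have m := fun H : Sig d => (Sig_measurable H).aestronglyMeasurable (μ := volume)
  have hl' := h'.tendsto hp hq ht hT hF' hG
  refine ⟨h.memLp_left.add h'.memLp_left, h.memLp_right, h.memLp_value.add h'.memLp_value,
    fun n => F n + F' n, G, tendsto_eLpNorm_add hp (fun n => m _) (fun n => m _) h.memLp_left.1
      h'.memLp_left.1 hF hF', hG, ?_⟩
  refine (tendsto_eLpNorm_add ht (fun n => AEEqFun.aestronglyMeasurable _)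
    (fun n => AEEqFun.aestronglyMeasurable _) h.memLp_value.1 h'.memLp_value.1 hl hl').congr
    fun n => eLpNorm_congr_ae ?_
  rw [map_add, LinearMap.add_apply]
  filter_upwards [AEEqFun.coeFn_add (T (F n) (G n)) (T (F' n) (G n))] with x hx
  simp [hx]

lemma IsExtValue.add_right (hp : 1 ≤ p) (hq : 1 ≤ q) (ht : 1 ≤ t) (hT : BoundedBy T p q t M)
    {f g g' u u' : Rd d → ℂ} (h : IsExtValue T p q t f g u) (h' : IsExtValue T p q t f g' u') :
    IsExtValue T p q t f (g + g') (u + u') := by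
  obtain ⟨F, G, hF, hG, hl⟩ := h.approx
  obtain ⟨-, G', -, hG', -⟩ := h'.approx
  have m := fun H : Sig d => (Sig_measurable H).aestronglyMeasurable (μ := volume)
  have hl' := h'.tendsto hp hq ht hT hF hG'
  refine ⟨h.memLp_left, h.memLp_right.add h'.memLp_right, h.memLp_value.add h'.memLp_value,
    F, fun n => G n + G' n, hF, tendsto_eLpNorm_add hq (fun n => m _) (fun n => m _)
      h.memLp_right.1 h'.memLp_right.1 hG hG', ?_⟩
  refine (tendsto_eLpNorm_add ht (fun n => AEEqFun.aestronglyMeasurable _)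
    (fun n => AEEqFun.aestronglyMeasurable _) h.memLp_value.1 h'.memLp_value.1 hl hl').congr
    fun n => eLpNorm_congr_ae ?_
  rw [map_add]
  filter_upwards [AEEqFun.coeFn_add (T (F n) (G n)) (T (F n) (G' n))] with x hx
  simp [hx]

lemma IsExtValue.smul_left {f g u : Rd d → ℂ} (c : ℂ) (h : IsExtValue T p q t f g u) :
    IsExtValue T p q t (c • f) g (c • u) := by
  obtain ⟨F, G, hF, hG, hl⟩ := h.approx
  refine ⟨h.memLp_left.const_smul c, h.memLp_right, h.memLp_value.const_smul c,
    fun n => c • F n, G, tendsto_eLpNorm_smul c hF, hG, ?_⟩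
  refine (tendsto_eLpNorm_smul c hl).congr fun n => eLpNorm_congr_ae ?_
  rw [map_smul, LinearMap.smul_apply]
  filter_upwards [AEEqFun.coeFn_smul c (T (F n) (G n))] with x hx
  simp [hx]

lemma IsExtValue.smul_right {f g u : Rd d → ℂ} (c : ℂ) (h : IsExtValue T p q t f g u) :
    IsExtValue T p q t f (c • g) (c • u) := by
  obtain ⟨F, G, hF, hG, hl⟩ := h.approx
  refine ⟨h.memLp_left, h.memLp_right.const_smul c, h.memLp_value.const_smul c,
    F, fun n => c • G n, hF, tendsto_eLpNorm_smul c hG, ?_⟩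
  refine (tendsto_eLpNorm_smul c hl).congr fun n => eLpNorm_congr_ae ?_
  rw [map_smul]
  filter_upwards [AEEqFun.coeFn_smul c (T (F n) (G n))] with x hx
  simp [hx]

lemma IsExtValue.zero_left (hq : 1 ≤ q) (hqt : q ≠ ∞) {g : Rd d → ℂ} (hg : MemLp g q volume) :
    IsExtValue T p q t 0 g 0 := by
  obtain ⟨G, hG, -⟩ := exists_Sig_seq_tendsto hq hqt hq hqt hg hg
  refine ⟨MemLp.zero, hg, MemLp.zero, fun _ => 0, G, by simp, hG, ?_⟩
  have : ∀ n, eLpNorm ((T 0 (G n) : Rd d → ℂ) - 0) t volume = 0 := fun n => by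
    rw [map_zero, LinearMap.zero_apply, eLpNorm_congr_ae (g := 0), eLpNorm_zero]
    filter_upwards [AEEqFun.coeFn_zero (α := Rd d) (μ := volume) (β := ℂ)] with x hx
    simp [hx]
  exact (tendsto_congr this).2 tendsto_const_nhds

lemma IsExtValue.zero_right (hp : 1 ≤ p) (hpt : p ≠ ∞) {f : Rd d → ℂ} (hf : MemLp f p volume) :
    IsExtValue T p q t f 0 0 := by
  obtain ⟨F, hF, -⟩ := exists_Sig_seq_tendsto hp hpt hp hpt hf hf
  refine ⟨hf, MemLp.zero, MemLp.zero, F, fun _ => 0, hF, by simp, ?_⟩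
  have : ∀ n, eLpNorm ((T (F n) 0 : Rd d → ℂ) - 0) t volume = 0 := fun n => by
    rw [map_zero, eLpNorm_congr_ae (g := 0), eLpNorm_zero]
    filter_upwards [AEEqFun.coeFn_zero (α := Rd d) (μ := volume) (β := ℂ)] with x hx
    simp [hx]
  exact (tendsto_congr this).2 tendsto_const_nhds

lemma IsExtValue.sum_left (hp : 1 ≤ p) (hq : 1 ≤ q) (hqt : q ≠ ∞) (ht : 1 ≤ t)
    (hT : BoundedBy T p q t M) {ι : Type*} (s : Finset ι) (c : ι → ℂ) {f : ι → Rd d → ℂ}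
    {g : Rd d → ℂ} {u : ι → Rd d → ℂ} (hg : MemLp g q volume)
    (h : ∀ i ∈ s, IsExtValue T p q t (f i) g (u i)) :
    IsExtValue T p q t (∑ i ∈ s, c i • f i) g (∑ i ∈ s, c i • u i) := by
  classical
  induction s using Finset.induction_on with
  | empty => simpa using IsExtValue.zero_left hq hqt hg
  | insert i s hi ih =>
    rw [Finset.sum_insert hi, Finset.sum_insert hi]
    exact ((h i (Finset.mem_insert_self i s)).smul_left (c i)).add_left hp hq ht hT
      (ih fun j hj => h j (Finset.mem_insert_of_mem hj))

lemma IsExtValue.sum_right (hp : 1 ≤ p) (hpt : p ≠ ∞) (hq : 1 ≤ q) (ht : 1 ≤ t)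
    (hT : BoundedBy T p q t M) {ι : Type*} (s : Finset ι) (c : ι → ℂ) {g : ι → Rd d → ℂ}
    {f : Rd d → ℂ} {u : ι → Rd d → ℂ} (hf : MemLp f p volume)
    (h : ∀ i ∈ s, IsExtValue T p q t f (g i) (u i)) :
    IsExtValue T p q t f (∑ i ∈ s, c i • g i) (∑ i ∈ s, c i • u i) := by
  classical
  induction s using Finset.induction_on with
  | empty => simpa using IsExtValue.zero_right hp hpt hf
  | insert i s hi ih =>
    rw [Finset.sum_insert hi, Finset.sum_insert hi]
    exact ((h i (Finset.mem_insert_self i s)).smul_right (c i)).add_right hp hq ht hT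
      (ih fun j hj => h j (Finset.mem_insert_of_mem hj))

end

section

variable {d : ℕ}

/-! ### The upper bound, and the domain of the commutator -/

lemma inv_hσ (p q : ℝ≥0∞) : (hσ p q)⁻¹ = p⁻¹ + q⁻¹ := inv_inv _

lemma holderTriple_hσ (p q : ℝ≥0∞) : ENNReal.HolderTriple p q (hσ p q) := ⟨(inv_hσ p q).symm⟩

lemma one_le_hσ {p q r : ℝ≥0∞} (hr : 1 ≤ r) (h : p⁻¹ + q⁻¹ ≤ r⁻¹) : 1 ≤ hσ p q := by
  rw [hσ, ENNReal.one_le_inv]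
  exact h.trans (ENNReal.inv_le_one.2 hr)

lemma hσ_ne_top {p q : ℝ≥0∞} (hp : p ≠ ∞) : hσ p q ≠ ∞ := by
  rw [hσ, ENNReal.inv_ne_top]
  exact fun h => hp (ENNReal.inv_eq_zero.1 (add_eq_zero.1 h).1)

lemma eLpNorm_mul_le {p q r : ℝ≥0∞} (h : ENNReal.HolderTriple p q r) {f g : Rd d → ℂ}
    (hf : AEStronglyMeasurable f volume) (hg : AEStronglyMeasurable g volume) :
    eLpNorm (f * g) r volume ≤ eLpNorm f p volume * eLpNorm g q volume := by
  have e : f * g = f • g := by funext x; simp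
  rw [e]
  exact eLpNorm_smul_le_mul_eLpNorm hg hf (hpqr := h)

variable {T : BilinOp d} {p q r s : ℝ≥0∞} {M₁ M₂ : ℝ≥0}

/-- With `b₀ = b - c`, the function `φ - c f = b₀ f - ψ` belongs to `L^p` and to `L^{σ(s,p)}`, where
the two extensions of `T` agree. Hence the commutator equals `b₀ T(f,g) - T(b₀ f, g)` whatever the
splitting, and Hölder bounds each term. -/
lemma IsCommValue.eLpNorm_le (hp : 1 ≤ p) (hp' : p ≠ ∞) (hq : 1 ≤ q) (hq' : q ≠ ∞)
    (hr : 1 ≤ r) (hs' : s ≠ ∞) (hrel : r⁻¹ = s⁻¹ + p⁻¹ + q⁻¹)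
    (hT₁ : BoundedBy T p q (hσ p q) M₁) (hT₂ : BoundedBy T (hσ s p) q r M₂)
    {b : Rd d → ℂ} (hb : AEStronglyMeasurable b volume) {f g w : Rd d → ℂ}
    (h : IsCommValue T b p q r s f g w) (c : ℂ)
    (hc : eLpNorm (fun x => b x - c) s volume ≠ ∞) :
    eLpNorm w r volume ≤ (M₁ + M₂) * eLpNorm (fun x => b x - c) s volume *
      eLpNorm f p volume * eLpNorm g q volume := by
  obtain ⟨v, φ, ψ, u₁, u₂, hv, hbf, hu₁, hu₂, rfl⟩ := h
  have ht : 1 ≤ hσ p q := one_le_hσ hr (by rw [hrel, add_assoc]; exact le_add_self)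
  have hsp : 1 ≤ hσ s p := one_le_hσ hr (by rw [hrel]; exact le_self_add)
  have hspt : hσ s p ≠ ∞ := hσ_ne_top hs'
  have H1 : ENNReal.HolderTriple s (hσ p q) r := ⟨by rw [inv_hσ, hrel, add_assoc]⟩
  have H2 := holderTriple_hσ s p
  set b₀ : Rd d → ℂ := fun x => b x - c with hb₀
  have hb₀m : AEStronglyMeasurable b₀ volume := hb.sub aestronglyMeasurable_const
  have hb₀L : MemLp b₀ s volume := ⟨hb₀m, lt_top_iff_ne_top.2 hc⟩
  have hf := hv.memLp_left
  have hb₀f : MemLp (b₀ * f) (hσ s p) volume :=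
    ⟨hb₀m.mul hf.1, (eLpNorm_mul_le H2 hb₀m hf.1).trans_lt (ENNReal.mul_lt_top hb₀L.2 hf.2)⟩
  obtain ⟨u, hu⟩ := hT₂.exists_isExtValue hsp hspt hq hq' hr hb₀f hv.memLp_right
  have e1 := hu₁.add_left hp hq ht hT₁ (hv.smul_left (-c))
  have e2 := hu.add_left hsp hq hr hT₂ (hu₂.smul_left (-1))
  have e : φ + -c • f = b₀ * f + (-1 : ℂ) • ψ := by
    funext x
    have := congrFun hbf x
    simp only [Pi.mul_apply, Pi.add_apply] at this
    simp only [hb₀, Pi.mul_apply, Pi.add_apply, Pi.smul_apply, smul_eq_mul, sub_mul, this]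
    ring
  rw [e] at e1
  have key := IsExtValue.ae_eq hp hp' hsp hspt hq hq' ht hr hT₁ hT₂ e1 e2
  have hw : (b * v - (u₁ + u₂)) =ᵐ[volume] (b₀ * v - u) := by
    filter_upwards [key] with x hx
    simp only [Pi.add_apply, Pi.smul_apply, smul_eq_mul] at hx
    simp only [hb₀, Pi.sub_apply, Pi.mul_apply, Pi.add_apply]
    linear_combination -hx
  rw [eLpNorm_congr_ae hw]
  refine (eLpNorm_sub_le (hb₀m.mul hv.memLp_value.1) hu.memLp_value.1 hr).trans ?_
  have i1 := eLpNorm_mul_le H1 hb₀m hv.memLp_value.1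
  have i2 := hv.eLpNorm_le hp hq ht hT₁
  have i3 := hu.eLpNorm_le hsp hq hr hT₂
  have i4 := eLpNorm_mul_le H2 hb₀m hf.1
  calc eLpNorm (b₀ * v) r volume + eLpNorm u r volume
      ≤ eLpNorm b₀ s volume * (M₁ * eLpNorm f p volume * eLpNorm g q volume) +
        M₂ * (eLpNorm b₀ s volume * eLpNorm f p volume) * eLpNorm g q volume := by
        refine add_le_add (i1.trans ?_) (i3.trans ?_) <;> gcongr
    _ = _ := by ring

lemma commNorm_le (hp : 1 ≤ p) (hp' : p ≠ ∞) (hq : 1 ≤ q) (hq' : q ≠ ∞)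
    (hr : 1 ≤ r) (hs' : s ≠ ∞) (hrel : r⁻¹ = s⁻¹ + p⁻¹ + q⁻¹)
    (hT₁ : BoundedBy T p q (hσ p q) M₁) (hT₂ : BoundedBy T (hσ s p) q r M₂)
    {b : Rd d → ℂ} (hb : AEStronglyMeasurable b volume) :
    commNorm T b p q r s ≤ ((M₁ + M₂ + 1 : ℝ≥0) : ℝ≥0∞) * homLsNorm b s := by
  -- The summand `1` keeps the constant non-zero: where `b - c` is not in `L^s` the bound has to be
  -- `∞`, not `0 * ∞ = 0`.
  rw [homLsNorm, ENNReal.mul_iInf_of_ne (by simp) ENNReal.coe_ne_top]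
  refine le_iInf fun c => ?_
  by_cases hc : eLpNorm (fun x => b x - c) s volume = ∞
  · rw [hc, ENNReal.mul_top (by simp)]
    exact le_top
  · refine sInf_le fun f g w h => ?_
    refine (h.eLpNorm_le hp hp' hq hq' hr hs' hrel hT₁ hT₂ hb c hc).trans ?_
    gcongr
    push_cast
    exact le_self_add

lemma exists_isCommValue (hp : 1 ≤ p) (hp' : p ≠ ∞) (hq : 1 ≤ q) (hq' : q ≠ ∞)
    (hr : 1 ≤ r) (hs' : s ≠ ∞) (hrel : r⁻¹ = s⁻¹ + p⁻¹ + q⁻¹)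
    (hT₁ : BoundedBy T p q (hσ p q) M₁) (hT₂ : BoundedBy T (hσ s p) q r M₂)
    {b : Rd d → ℂ} (hb : AEStronglyMeasurable b volume) (hbs : homLsNorm b s < ∞)
    {f g : Rd d → ℂ} (hf : MemLp f p volume) (hg : MemLp g q volume) :
    ∃ w, IsCommValue T b p q r s f g w := by
  have ht : 1 ≤ hσ p q := one_le_hσ hr (by rw [hrel, add_assoc]; exact le_add_self)
  have hsp : 1 ≤ hσ s p := one_le_hσ hr (by rw [hrel]; exact le_self_add)
  have hspt : hσ s p ≠ ∞ := hσ_ne_top hs'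
  obtain ⟨c, hc⟩ := iInf_lt_iff.1 hbs
  have hb₀m : AEStronglyMeasurable (fun x => b x - c) volume := hb.sub aestronglyMeasurable_const
  have hψ : MemLp ((fun x => b x - c) * f) (hσ s p) volume :=
    ⟨hb₀m.mul hf.1, (eLpNorm_mul_le (holderTriple_hσ s p) hb₀m hf.1).trans_lt
      (ENNReal.mul_lt_top hc hf.2)⟩
  obtain ⟨v, hv⟩ := hT₁.exists_isExtValue hp hp' hq hq' ht hf hg
  obtain ⟨u, hu⟩ := hT₂.exists_isExtValue hsp hspt hq hq' hr hψ hg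
  refine ⟨_, v, c • f, _, c • v, u, hv, ?_, hv.smul_left c, hu, rfl⟩
  funext x
  simp only [Pi.mul_apply, Pi.add_apply, Pi.smul_apply, smul_eq_mul]
  ring

end

section

/-! ### Testing oscillations against a nearly constant kernel -/

/-- The unimodular factor `\bar z / |z|`, with value `0` at `0`. -/
def phase (z : ℂ) : ℂ := star z / ‖z‖

lemma phase_mul (z : ℂ) : z * phase z = ‖z‖ := by
  by_cases h : z = 0
  · simp [h]
  · have : (‖z‖ : ℂ) ≠ 0 := by simpa using h
    rw [phase, mul_div_assoc', div_eq_iff this]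
    simpa [sq] using Complex.mul_conj' z

lemma norm_phase_le (z : ℂ) : ‖phase z‖ ≤ 1 := by
  rw [phase, norm_div, norm_star, Complex.norm_real, norm_norm]
  exact div_self_le_one _

lemma measurable_phase : Measurable phase := by
  unfold phase
  exact (continuous_star.measurable).div (Complex.measurable_ofReal.comp measurable_norm)

section Test

variable {α β γ : Type*} [MeasurableSpace α] [MeasurableSpace β] [MeasurableSpace γ]
  {μ : Measure α} {ν : Measure β} {ρ : Measure γ} [IsFiniteMeasure μ] [IsFiniteMeasure ν]
  [IsFiniteMeasure ρ]

/-- The commutator form with kernel `K`, tested against `f` and `h`. -/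
def commForm (μ : Measure α) (ν : Measure β) (ρ : Measure γ) (K : α × β × γ → ℂ) (u : α → ℂ)
    (v : β → ℂ) (f : β → ℂ) (h : α → ℂ) : ℂ :=
  ∫ x, (∫ w, (u x - v w.1) * K (x, w) * f w.1 ∂(ν.prod ρ)) * h x ∂μ

lemma integrable_of_bdd {u : α → ℂ} (hu : Measurable u) {n : ℝ} (hn : ∀ x, ‖u x‖ ≤ n) :
    Integrable u μ :=
  Integrable.of_bound hu.aestronglyMeasurable n (Eventually.of_forall hn)

lemma norm_mul_le_of_le_one {z w : ℂ} {n : ℝ} (hz : ‖z‖ ≤ n) (hw : ‖w‖ ≤ 1) : ‖z * w‖ ≤ n := by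
  rw [norm_mul]
  nlinarith [norm_nonneg z, norm_nonneg w]

/-- Write `u x - v y = (u x - m) - (v y - m)`. Against `|K - K₀|`, the first difference needs only
the integral in `(y, z)` and the second only that in `(x, z)`. Two marginal `L^1` bounds therefore
suffice, which is what a rough kernel can provide. -/
lemma norm_commForm_sub_le {K : α × β × γ → ℂ} (hK : Measurable K) {K₀ : ℂ} {e : ℝ}
    (he : 0 ≤ e)
    (h1 : ∀ᵐ x ∂μ, ∫⁻ w, ‖K (x, w) - K₀‖ₑ ∂(ν.prod ρ) ≤ ENNReal.ofReal e)
    (h2 : ∀ᵐ y ∂ν, ∫⁻ x, ∫⁻ z, ‖K (x, y, z) - K₀‖ₑ ∂ρ ∂μ ≤ ENNReal.ofReal e)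
    {u : α → ℂ} {v : β → ℂ} (hu : Measurable u) (hv : Measurable v) {n : ℝ}
    (hun : ∀ x, ‖u x‖ ≤ n) (hvn : ∀ y, ‖v y‖ ≤ n) {f : β → ℂ} {h : α → ℂ} (hf : Measurable f)
    (hh : Measurable h) (hf1 : ∀ y, ‖f y‖ ≤ 1) (hh1 : ∀ x, ‖h x‖ ≤ 1) (m : ℂ) :
    ‖commForm μ ν ρ K u v f h -
      K₀ * ρ.real Set.univ * ∫ x, (∫ y, (u x - v y) * f y ∂ν) * h x ∂μ‖ ≤
      e * (∫ x, ‖u x - m‖ ∂μ + ∫ y, ‖v y - m‖ ∂ν) := by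
  have hn : ∀ (x : α) (y : β), ‖u x - v y‖ ≤ 2 * n := fun x y =>
    (norm_sub_le _ _).trans (by linarith [hun x, hvn y])
  have hm1 : Measurable fun p : α × β × γ => (u p.1 - v p.2.1) * (K p - K₀) * f p.2.1 := by
    fun_prop
  have hKint : ∀ᵐ x ∂μ, Integrable (fun w => K (x, w) - K₀) (ν.prod ρ) := by
    filter_upwards [h1] with x hx
    exact ⟨((hK.comp measurable_prodMk_left).sub_const _).aestronglyMeasurable,
      hx.trans_lt ENNReal.ofReal_lt_top⟩
  have hbd : ∀ x, ∀ {k : β × γ → ℂ}, Integrable k (ν.prod ρ) →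
      Integrable (fun w : β × γ => (u x - v w.1) * k w * f w.1) (ν.prod ρ) := by
    intro x k hk
    have e1 : (fun w : β × γ => (u x - v w.1) * k w * f w.1)
        = fun w => ((u x - v w.1) * f w.1) * k w := by funext w; ring
    rw [e1]
    refine hk.bdd_mul (c := 2 * n) (by fun_prop) (Eventually.of_forall fun w => ?_)
    exact norm_mul_le_of_le_one (hn x w.1) (hf1 w.1)
  -- the constant part
  have hconst : ∀ x, ∫ w, (u x - v w.1) * K₀ * f w.1 ∂(ν.prod ρ) =
      K₀ * ρ.real Set.univ * ∫ y, (u x - v y) * f y ∂ν := by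
    intro x
    have := integral_prod_mul (μ := ν) (ν := ρ) (fun y => (u x - v y) * f y) (fun _ => K₀)
    rw [integral_const] at this
    rw [Complex.real_smul] at this
    rw [show K₀ * (ρ.real Set.univ : ℂ) * ∫ y, (u x - v y) * f y ∂ν
      = (∫ y, (u x - v y) * f y ∂ν) * ((ρ.real Set.univ : ℂ) * K₀) by ring, ← this]
    refine integral_congr_ae (Eventually.of_forall fun w => ?_)
    simp only
    ring
  have hsplit : ∀ᵐ x ∂μ, ∫ w, (u x - v w.1) * K (x, w) * f w.1 ∂(ν.prod ρ) =
      ∫ w, (u x - v w.1) * (K (x, w) - K₀) * f w.1 ∂(ν.prod ρ) +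
        K₀ * ρ.real Set.univ * ∫ y, (u x - v y) * f y ∂ν := by
    filter_upwards [hKint] with x hx
    rw [← hconst x, ← integral_add (hbd x hx) (hbd x (integrable_const K₀))]
    refine integral_congr_ae (Eventually.of_forall fun w => ?_)
    simp only
    ring
  -- the error
  set err : α → ℂ := fun x => ∫ w, (u x - v w.1) * (K (x, w) - K₀) * f w.1 ∂(ν.prod ρ) with herr
  have herrm : StronglyMeasurable err := hm1.stronglyMeasurable.integral_prod_right'
  have hE1 : ∀ x, ‖err x * h x‖ₑ ≤
      ∫⁻ w, (‖u x - m‖ₑ + ‖v w.1 - m‖ₑ) * ‖K (x, w) - K₀‖ₑ ∂(ν.prod ρ) := by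
    intro x
    calc ‖err x * h x‖ₑ ≤ ‖err x‖ₑ := by
          rw [enorm_le_iff_norm_le]
          exact norm_mul_le_of_le_one le_rfl (hh1 x)
      _ ≤ ∫⁻ w, ‖(u x - v w.1) * (K (x, w) - K₀) * f w.1‖ₑ ∂(ν.prod ρ) :=
          enorm_integral_le_lintegral_enorm _
      _ ≤ _ := by
          refine lintegral_mono fun w => ?_
          have : ‖(u x - v w.1) * (K (x, w) - K₀) * f w.1‖ₑ
              ≤ ‖(u x - v w.1) * (K (x, w) - K₀)‖ₑ := by
            rw [enorm_le_iff_norm_le]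
            exact norm_mul_le_of_le_one le_rfl (hf1 w.1)
          refine this.trans ?_
          rw [enorm_mul]
          gcongr
          rw [show u x - v w.1 = (u x - m) - (v w.1 - m) by ring]
          exact enorm_sub_le
  have hum : Integrable (fun x => u x - m) μ :=
    (integrable_of_bdd hu hun).sub (integrable_const m)
  have hvm : Integrable (fun y => v y - m) ν :=
    (integrable_of_bdd hv hvn).sub (integrable_const m)
  have hE2 : ∫⁻ x, ‖err x * h x‖ₑ ∂μ ≤
      ENNReal.ofReal (e * (∫ x, ‖u x - m‖ ∂μ + ∫ y, ‖v y - m‖ ∂ν)) := by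
    calc ∫⁻ x, ‖err x * h x‖ₑ ∂μ
        ≤ ∫⁻ x, ∫⁻ w, (‖u x - m‖ₑ + ‖v w.1 - m‖ₑ) * ‖K (x, w) - K₀‖ₑ ∂(ν.prod ρ) ∂μ :=
          lintegral_mono hE1
      _ = ∫⁻ x, ‖u x - m‖ₑ * ∫⁻ w, ‖K (x, w) - K₀‖ₑ ∂(ν.prod ρ) ∂μ +
          ∫⁻ x, ∫⁻ w, ‖v w.1 - m‖ₑ * ‖K (x, w) - K₀‖ₑ ∂(ν.prod ρ) ∂μ := by
          rw [← lintegral_add_left (by fun_prop)]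
          refine lintegral_congr fun x => ?_
          rw [← lintegral_const_mul _ (by fun_prop), ← lintegral_add_left (by fun_prop)]
          simp_rw [add_mul]
      _ ≤ ∫⁻ x, ‖u x - m‖ₑ * ENNReal.ofReal e ∂μ + ∫⁻ y, ‖v y - m‖ₑ * ENNReal.ofReal e ∂ν := by
          refine add_le_add (lintegral_mono_ae ?_) ?_
          · filter_upwards [h1] with x hx
            gcongr
          · calc ∫⁻ x, ∫⁻ w, ‖v w.1 - m‖ₑ * ‖K (x, w) - K₀‖ₑ ∂(ν.prod ρ) ∂μ
                = ∫⁻ x, ∫⁻ y, ‖v y - m‖ₑ * ∫⁻ z, ‖K (x, y, z) - K₀‖ₑ ∂ρ ∂ν ∂μ := by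
                  refine lintegral_congr fun x => ?_
                  rw [lintegral_prod _ (by fun_prop)]
                  refine lintegral_congr fun y => ?_
                  exact lintegral_const_mul (‖v y - m‖ₑ) (f := fun z => ‖K (x, y, z) - K₀‖ₑ)
                    (by fun_prop)
              _ = ∫⁻ y, ∫⁻ x, ‖v y - m‖ₑ * ∫⁻ z, ‖K (x, y, z) - K₀‖ₑ ∂ρ ∂μ ∂ν := by
                  refine lintegral_lintegral_swap ?_
                  have : Measurable fun p : α × β => ∫⁻ z, ‖K (p.1, p.2, z) - K₀‖ₑ ∂ρ :=
                    Measurable.lintegral_prod_right' (f := fun q : (α × β) × γ =>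
                      ‖K (q.1.1, q.1.2, q.2) - K₀‖ₑ) (by fun_prop)
                  exact (by fun_prop : Measurable fun p : α × β =>
                    ‖v p.2 - m‖ₑ * ∫⁻ z, ‖K (p.1, p.2, z) - K₀‖ₑ ∂ρ).aemeasurable
              _ ≤ _ := by
                  refine lintegral_mono_ae ?_
                  filter_upwards [h2] with y hy
                  rw [lintegral_const_mul]
                  · gcongr
                  · exact Measurable.lintegral_prod_right' (f := fun q : α × γ =>
                      ‖K (q.1, y, q.2) - K₀‖ₑ) (by fun_prop)
      _ = _ := by
          rw [lintegral_mul_const _ (by fun_prop), lintegral_mul_const _ (by fun_prop),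
            ← ofReal_integral_norm_eq_lintegral_enorm hum,
            ← ofReal_integral_norm_eq_lintegral_enorm hvm, ← add_mul,
            ← ENNReal.ofReal_add (by positivity) (by positivity),
            ← ENNReal.ofReal_mul (by positivity), mul_comm]
  have herrint : Integrable (fun x => err x * h x) μ :=
    ⟨(herrm.measurable.mul hh).aestronglyMeasurable, hE2.trans_lt ENNReal.ofReal_lt_top⟩
  have hmain : Integrable (fun x => (∫ y, (u x - v y) * f y ∂ν) * h x) μ := by
    refine Integrable.of_bound (C := 2 * n * ν.real Set.univ) ?_ (Eventually.of_forall fun x => ?_)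
    · refine (StronglyMeasurable.measurable ?_).mul hh |>.aestronglyMeasurable
      exact Measurable.stronglyMeasurable (by fun_prop : Measurable fun p : α × β =>
        (u p.1 - v p.2) * f p.2) |>.integral_prod_right'
    · refine norm_mul_le_of_le_one ?_ (hh1 x)
      exact norm_integral_le_of_norm_le_const (Eventually.of_forall fun y =>
        norm_mul_le_of_le_one (hn x y) (hf1 y))
  have hfin : commForm μ ν ρ K u v f h - K₀ * ρ.real Set.univ *
      ∫ x, (∫ y, (u x - v y) * f y ∂ν) * h x ∂μ = ∫ x, err x * h x ∂μ := by
    rw [commForm, sub_eq_iff_eq_add, ← integral_const_mul,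
      ← integral_add herrint (hmain.const_mul _)]
    refine integral_congr_ae ?_
    filter_upwards [hsplit] with x hx
    rw [hx]
    ring
  rw [hfin]
  have h3 := (enorm_integral_le_lintegral_enorm (μ := μ) fun x => err x * h x).trans hE2
  rwa [← ofReal_norm, ENNReal.ofReal_le_ofReal_iff] at h3
  positivity

/-- If `K` is close to a constant, the oscillation of `b` is controlled by two values of the
commutator form. -/
lemma osc_le_commForm {K : α × β × γ → ℂ} (hK : Measurable K) {K₀ : ℂ} {V : ℝ}
    (h1 : ∀ᵐ x ∂μ, ∫⁻ w, ‖K (x, w) - K₀‖ₑ ∂(ν.prod ρ) ≤ ENNReal.ofReal (‖K₀‖ * V ^ 2 / 8))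
    (h2 : ∀ᵐ y ∂ν, ∫⁻ x, ∫⁻ z, ‖K (x, y, z) - K₀‖ₑ ∂ρ ∂μ ≤ ENNReal.ofReal (‖K₀‖ * V ^ 2 / 8))
    {u : α → ℂ} {v : β → ℂ} (hu : Measurable u) (hv : Measurable v) {n : ℝ}
    (hun : ∀ x, ‖u x‖ ≤ n) (hvn : ∀ y, ‖v y‖ ≤ n) (hV : 0 < V) (hμ : V ≤ μ.real Set.univ)
    (hν : V ≤ ν.real Set.univ) (hρ : V ≤ ρ.real Set.univ) :
    ‖K₀‖ * V ^ 2 * ∫ y, ‖v y - ⨍ x, u x ∂μ‖ ∂ν ≤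
      2 * (‖commForm μ ν ρ K u v (fun y => phase ((⨍ x, u x ∂μ) - v y)) 1‖ +
        ‖commForm μ ν ρ K u v 1 (fun x => phase (u x - ⨍ y, v y ∂ν))‖) := by
  set m := ⨍ x, u x ∂μ with hm
  set m' := ⨍ y, v y ∂ν with hm'
  have hui : Integrable u μ := integrable_of_bdd hu hun
  have hvi : Integrable v ν := integrable_of_bdd hv hvn
  have hμ0 : μ.real Set.univ ≠ 0 := (hV.trans_le hμ).ne'
  have hν0 : ν.real Set.univ ≠ 0 := (hV.trans_le hν).ne'
  have hmu : ∫ x, u x ∂μ = μ.real Set.univ * m := by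
    rw [hm, average_eq, Complex.real_smul, ← mul_assoc, ← Complex.ofReal_mul,
      mul_inv_cancel₀ hμ0, Complex.ofReal_one, one_mul]
  have hmv : ∫ x, v x ∂ν = ν.real Set.univ * m' := by
    rw [hm', average_eq, Complex.real_smul, ← mul_assoc, ← Complex.ofReal_mul,
      mul_inv_cancel₀ hν0, Complex.ofReal_one, one_mul]
  set A := ∫ y, ‖v y - m‖ ∂ν with hA
  set B := ∫ x, ‖u x - m'‖ ∂μ with hB
  have hA0 : 0 ≤ A := integral_nonneg fun _ => norm_nonneg _
  have hB0 : 0 ≤ B := integral_nonneg fun _ => norm_nonneg _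
  -- The mean `m'` differs from `m` by at most the mean of `‖v - m‖`.
  have hA' : ∫ y, ‖v y - m'‖ ∂ν ≤ 2 * A := by
    have h3 : ν.real Set.univ * ‖m - m'‖ ≤ A := by
      have : ∫ y, (v y - m) ∂ν = ν.real Set.univ * (m' - m) := by
        rw [integral_sub hvi (integrable_const _), hmv, integral_const, Complex.real_smul]
        ring
      have h4 := norm_integral_le_integral_norm (μ := ν) fun y => v y - m
      rw [this, norm_mul, Complex.norm_real, Real.norm_of_nonneg (by positivity)] at h4
      rwa [norm_sub_rev]
    have hvm : Integrable (fun y => v y - m) ν := hvi.sub (integrable_const m)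
    calc ∫ y, ‖v y - m'‖ ∂ν ≤ ∫ y, (‖v y - m‖ + ‖m - m'‖) ∂ν := by
          refine integral_mono (hvi.sub (integrable_const _)).norm
            ((hvi.sub (integrable_const _)).norm.add (integrable_const _)) fun y => ?_
          simp only
          rw [show v y - m' = (v y - m) + (m - m') by ring]
          exact norm_add_le _ _
      _ = A + ν.real Set.univ * ‖m - m'‖ := by
          rw [integral_add hvm.norm (integrable_const _),
            integral_const, smul_eq_mul]
      _ ≤ 2 * A := by linarith
  have he : 0 ≤ ‖K₀‖ * V ^ 2 / 8 := by positivity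
  -- first choice of test functions
  have k1 := norm_commForm_sub_le hK he h1 h2 hu hv hun hvn
    (f := fun y => phase (m - v y)) (h := 1)
    (measurable_phase.comp (measurable_const.sub hv)) measurable_one
    (fun y => norm_phase_le _) (fun _ => by simp) m'
  have k2 := norm_commForm_sub_le hK he h1 h2 hu hv hun hvn
    (f := 1) (h := fun x => phase (u x - m')) measurable_one
    (measurable_phase.comp (hu.sub measurable_const))
    (fun _ => by simp) (fun y => norm_phase_le _) m'
  have fi : Integrable (fun y => phase (m - v y)) ν :=
    integrable_of_bdd (measurable_phase.comp (measurable_const.sub hv)) fun y => norm_phase_le _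
  have fvi : Integrable (fun y => v y * phase (m - v y)) ν :=
    integrable_of_bdd (hv.mul (measurable_phase.comp (measurable_const.sub hv)))
      fun y => norm_mul_le_of_le_one (hvn y) (norm_phase_le _)
  -- As `m` is the mean of `u`, integration in `x` turns `u x - v y` into a multiple of `m - v y`,
  -- which the phase makes non-negative.
  have i1 : ∫ x, (∫ y, (u x - v y) * phase (m - v y) ∂ν) * (1 : α → ℂ) x ∂μ
      = (μ.real Set.univ * A : ℝ) := by
    have : ∀ x, ∫ y, (u x - v y) * phase (m - v y) ∂ν =
        u x * ∫ y, phase (m - v y) ∂ν - ∫ y, v y * phase (m - v y) ∂ν := by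
      intro x
      rw [← integral_const_mul, ← integral_sub (fi.const_mul _) fvi]
      simp_rw [sub_mul]
    simp only [this, Pi.one_apply, mul_one]
    rw [integral_sub (hui.mul_const _) (integrable_const _), integral_mul_const, hmu,
      integral_const, Complex.real_smul, mul_assoc, ← mul_sub, ← integral_const_mul,
      ← integral_sub (fi.const_mul _) fvi]
    simp_rw [← sub_mul, phase_mul]
    rw [integral_complex_ofReal, hA]
    simp_rw [norm_sub_rev m]
    push_cast
    rfl
  have i2 : ∫ x, (∫ y, (u x - v y) * (1 : β → ℂ) y ∂ν) * phase (u x - m') ∂μ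
      = (ν.real Set.univ * B : ℝ) := by
    have : ∀ x, ∫ y, (u x - v y) * (1 : β → ℂ) y ∂ν = ν.real Set.univ * (u x - m') := by
      intro x
      simp only [Pi.one_apply, mul_one]
      rw [integral_sub (integrable_const _) hvi, hmv, integral_const, Complex.real_smul]
      ring
    simp only [this]
    simp_rw [mul_assoc, phase_mul]
    rw [integral_const_mul, integral_complex_ofReal, hB]
    push_cast
    rfl
  rw [i1] at k1
  rw [i2] at k2
  have n1 : ‖K₀‖ * V ^ 2 * A ≤ ‖K₀ * (ρ.real Set.univ : ℂ) * ((μ.real Set.univ * A : ℝ) : ℂ)‖ := by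
    rw [norm_mul, norm_mul, Complex.norm_real, Complex.norm_real,
      Real.norm_of_nonneg (by positivity), Real.norm_of_nonneg (by positivity), sq,
      mul_assoc, mul_assoc, mul_assoc]
    gcongr
  have n2 : ‖K₀‖ * V ^ 2 * B ≤ ‖K₀ * (ρ.real Set.univ : ℂ) * ((ν.real Set.univ * B : ℝ) : ℂ)‖ := by
    rw [norm_mul, norm_mul, Complex.norm_real, Complex.norm_real,
      Real.norm_of_nonneg (by positivity), Real.norm_of_nonneg (by positivity), sq,
      mul_assoc, mul_assoc, mul_assoc]
    gcongr
  have t1 := norm_le_norm_add_norm_sub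
    (commForm μ ν ρ K u v (fun y => phase (m - v y)) 1)
    (K₀ * (ρ.real Set.univ : ℂ) * ((μ.real Set.univ * A : ℝ) : ℂ))
  have t2 := norm_le_norm_add_norm_sub
    (commForm μ ν ρ K u v 1 (fun x => phase (u x - m')))
    (K₀ * (ρ.real Set.univ : ℂ) * ((ν.real Set.univ * B : ℝ) : ℂ))
  -- The two main terms add up to at least `‖K₀‖ V² (A + B)`, the two errors to at most `‖K₀‖ V² (A
  -- / 2 + B / 4)`. The second test is needed because `B` occurs in the error of the first.
  have hAB : ‖K₀‖ * V ^ 2 / 8 * (B + ∫ y, ‖v y - m'‖ ∂ν) ≤ ‖K₀‖ * V ^ 2 / 8 * (B + 2 * A) := by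
    gcongr
  have : 0 ≤ ‖K₀‖ * V ^ 2 * B := by positivity
  nlinarith

end Test

end

section

variable {d : ℕ}

/-! ### Local kernels -/

/-- `K` represents `T` on `X × Y × Z` (sets of size `ℓ`), is close to the constant `K₀`
there, and `|K₀| ℓ^{2d} ≥ c`. -/
structure LocalKernel (T : BilinOp d) (X Y Z : Set (Rd d)) (ℓ c : ℝ)
    (K : Rd d × Rd d × Rd d → ℂ) (K₀ : ℂ) : Prop where
  meas : Measurable K
  repr : ∀ F G : Sig d, (∀ y ∉ Y, (F : Rd d → ℂ) y = 0) → (∀ z ∉ Z, (G : Rd d → ℂ) z = 0) →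
    ∀ᵐ x, x ∈ X → T F G x =
      ∫ w in Y ×ˢ Z, K (x, w) * (F : Rd d → ℂ) w.1 * (G : Rd d → ℂ) w.2
  fst : ∀ x ∈ X, ∫⁻ w in Y ×ˢ Z, ‖K (x, w) - K₀‖ₑ ≤ ENNReal.ofReal (‖K₀‖ * ℓ ^ (2 * d) / 128)
  snd : ∀ y ∈ Y, ∫⁻ x in X, ∫⁻ z in Z, ‖K (x, y, z) - K₀‖ₑ ≤
    ENNReal.ofReal (‖K₀‖ * ℓ ^ (2 * d) / 128)
  lower : c ≤ ‖K₀‖ * ℓ ^ (2 * d)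

variable {T : BilinOp d} {p q t : ℝ≥0∞} {M : ℝ≥0} {X Y Z : Set (Rd d)} {ℓ c : ℝ}
  {K : Rd d × Rd d × Rd d → ℂ} {K₀ : ℂ}

lemma volume_prod_lt_top (hY : volume Y < ∞) (hZ : volume Z < ∞) :
    (volume : Measure (Rd d × Rd d)) (Y ×ˢ Z) < ∞ := by
  rw [Measure.volume_eq_prod, Measure.prod_prod]
  exact ENNReal.mul_lt_top hY hZ

lemma LocalKernel.integrableOn (hK : LocalKernel T X Y Z ℓ c K K₀) (hY : volume Y < ∞)
    (hZ : volume Z < ∞) {x : Rd d} (hx : x ∈ X) :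
    IntegrableOn (fun w => K (x, w)) (Y ×ˢ Z) volume := by
  have h1 : IntegrableOn (fun w => K (x, w) - K₀) (Y ×ˢ Z) volume :=
    ⟨((hK.meas.comp measurable_prodMk_left).sub_const _).aestronglyMeasurable,
      (hK.fst x hx).trans_lt ENNReal.ofReal_lt_top⟩
  have h2 := h1.add (integrableOn_const (C := K₀) (volume_prod_lt_top hY hZ).ne)
  have e : (fun w => K (x, w)) = (fun w => K (x, w) - K₀) + fun _ => K₀ := by
    funext w
    simp
  rw [e]
  exact h2

/-- The kernel represents the extension of `T` on bounded functions. -/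
lemma LocalKernel.repr_of_bounded (hp : 1 ≤ p) (hp' : p ≠ ∞) (hq : 1 ≤ q) (hq' : q ≠ ∞)
    (ht : 1 ≤ t) (hT : BoundedBy T p q t M) {aY aZ : Rd d} (hℓ : 0 < ℓ)
    (hK : LocalKernel T X (cube aY ℓ) (cube aZ ℓ) ℓ c K K₀) {f g v : Rd d → ℂ} {m n : ℝ}
    (hfm : ∀ y, ‖f y‖ ≤ m) (hgn : ∀ z, ‖g z‖ ≤ n) (hf : ∀ y ∉ cube aY ℓ, f y = 0)
    (hg : ∀ z ∉ cube aZ ℓ, g z = 0) (hv : IsExtValue T p q t f g v) :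
    ∀ᵐ x, x ∈ X → v x = ∫ w in cube aY ℓ ×ˢ cube aZ ℓ, K (x, w) * f w.1 * g w.2 := by
  obtain ⟨F, hF1, hF2, hF3⟩ := exists_Sig_seq hv.memLp_left.1 hfm hℓ hf
  obtain ⟨G, hG1, hG2, hG3⟩ := exists_Sig_seq hv.memLp_right.1 hgn hℓ hg
  have conv : ∀ (v : ℝ≥0∞) (_ : 1 ≤ v) (_ : v ≠ ∞) {a : Rd d} {f : Rd d → ℂ} {m : ℝ}
      (_ : AEStronglyMeasurable f volume)
      {F : ℕ → Sig d} (_ : ∀ y, ‖f y‖ ≤ m) (_ : ∀ y ∉ cube a ℓ, f y = 0)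
      (_ : ∀ n x, ‖(F n : Rd d → ℂ) x‖ ≤ m) (_ : ∀ n, ∀ x ∉ cube a ℓ, (F n : Rd d → ℂ) x = 0)
      (_ : ∀ᵐ x, Tendsto (fun n => (F n : Rd d → ℂ) x) atTop (𝓝 (f x))),
      Tendsto (fun k => eLpNorm ((F k : Rd d → ℂ) - f) v volume) atTop (𝓝 0) := by
    intro v hv hv' a f m hfm F hf hfs hF hFs hlim
    refine tendsto_eLpNorm_of_dominated (g := (cube a ℓ).indicator fun _ => (2 * m : ℝ))
      (one_pos.trans_le hv).ne' hv'
      (fun k => (Sig_measurable _).aestronglyMeasurable) hfm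
      (memLp_indicator_const v (measurableSet_cube _ _) _
        (Or.inr (volume_cube_lt_top _ hℓ.le).ne))
      (fun k => Eventually.of_forall fun x => ?_) hlim
    by_cases hx : x ∈ cube a ℓ
    · rw [Set.indicator_of_mem hx]
      refine (norm_sub_le _ _).trans ?_
      linarith [hF k x, hf x]
    · rw [Set.indicator_of_notMem hx, hFs k x hx, hfs x hx]
      simp
  have hu := hv.tendsto hp hq ht hT (conv p hp hp' hv.memLp_left.1 hfm hf hF1 hF2 hF3)
    (conv q hq hq' hv.memLp_right.1 hgn hg hG1 hG2 hG3)
  -- Convergence in `L^t` is pointwise along a subsequence, which is enough to identify the limit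
  -- with the integral.
  obtain ⟨ns, hns, hlim⟩ := (tendstoInMeasure_of_tendsto_eLpNorm (one_pos.trans_le ht).ne'
    (fun n => AEEqFun.aestronglyMeasurable (T (F n) (G n))) hv.memLp_value.1
    hu).exists_seq_tendsto_ae
  have hrep : ∀ᵐ x, ∀ n, x ∈ X → T (F n) (G n) x = ∫ w in cube aY ℓ ×ˢ cube aZ ℓ,
      K (x, w) * (F n : Rd d → ℂ) w.1 * (G n : Rd d → ℂ) w.2 :=
    ae_all_iff.2 fun n => hK.repr (F n) (G n) (hF2 n) (hG2 n)
  filter_upwards [hlim, hrep] with x hx1 hx2 hxX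
  have hKint := hK.integrableOn (volume_cube_lt_top aY hℓ.le) (volume_cube_lt_top aZ hℓ.le) hxX
  refine tendsto_nhds_unique hx1 ?_
  simp_rw [fun n => hx2 n hxX]
  refine Tendsto.comp (f := ns) (y := atTop) (g := fun n => ∫ w in cube aY ℓ ×ˢ cube aZ ℓ,
      K (x, w) * (F n : Rd d → ℂ) w.1 * (G n : Rd d → ℂ) w.2) ?_ hns.tendsto_atTop
  have mf : ∀ H : Sig d, Measurable fun w : Rd d × Rd d => (H : Rd d → ℂ) w.1 := fun H =>
    (Sig_measurable H).comp measurable_fst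
  have mg : ∀ H : Sig d, Measurable fun w : Rd d × Rd d => (H : Rd d → ℂ) w.2 := fun H =>
    (Sig_measurable H).comp measurable_snd
  have mK : Measurable fun w => K (x, w) := hK.meas.comp measurable_prodMk_left
  refine tendsto_integral_of_dominated_convergence (fun w => ‖K (x, w)‖ * (m * n))
    (fun k => ((mK.mul (mf _)).mul (mg _)).aestronglyMeasurable) (hKint.norm.mul_const _)
    (fun k => Eventually.of_forall fun w => ?_) ?_
  · rw [norm_mul, norm_mul, mul_assoc]
    have hm0 : 0 ≤ m := (norm_nonneg _).trans (hfm 0)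
    gcongr
    · exact hF1 k w.1
    · exact hG1 k w.2
  · refine ae_restrict_of_ae ?_
    have a1 : ∀ᵐ w : Rd d × Rd d, Tendsto (fun n => (F n : Rd d → ℂ) w.1) atTop (𝓝 (f w.1)) :=
      Measure.quasiMeasurePreserving_fst.ae hF3
    have a2 : ∀ᵐ w : Rd d × Rd d, Tendsto (fun n => (G n : Rd d → ℂ) w.2) atTop (𝓝 (g w.2)) :=
      Measure.quasiMeasurePreserving_snd.ae hG3
    filter_upwards [a1, a2] with w h1 h2
    exact (h1.const_mul _).mul h2

/-- The sets `X'`, `Y'`, `Z'` enter through the supports of `h`, `f` and the indicator of `Z'`.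
Since `b` is bounded on `Y'`, also `b f` is bounded, and the kernel represents both terms of the
commutator. -/
lemma integral_comm_eq_commForm (hp : 1 ≤ p) (hp' : p ≠ ∞) (hq : 1 ≤ q) (hq' : q ≠ ∞)
    (ht : 1 ≤ t) (hT : BoundedBy T p q t M) {aY aZ : Rd d} (hℓ : 0 < ℓ)
    (hK : LocalKernel T X (cube aY ℓ) (cube aZ ℓ) ℓ c K K₀) {X' Y' Z' : Set (Rd d)}
    (hX' : X' ⊆ X) (hY' : Y' ⊆ cube aY ℓ) (hZ' : Z' ⊆ cube aZ ℓ) (mX' : MeasurableSet X')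
    (mY' : MeasurableSet Y') (mZ' : MeasurableSet Z') {b : Rd d → ℂ} (hb : Measurable b) {n : ℝ}
    (hbY : ∀ y ∈ Y', ‖b y‖ ≤ n) {f h v u : Rd d → ℂ} (hf : Measurable f)
    (hf1 : ∀ y, ‖f y‖ ≤ 1) (hf0 : ∀ y ∉ Y', f y = 0) (hh0 : ∀ x ∉ X', h x = 0)
    (hv : IsExtValue T p q t f (Z'.indicator 1) v)
    (hu : IsExtValue T p q t (b * f) (Z'.indicator 1) u) :
    ∫ x, (b * v - u) x * h x = commForm (volume.restrict X') (volume.restrict Y')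
      (volume.restrict Z') K (X'.indicator b) (Y'.indicator b) f h := by
  have hn : ∀ y, ‖(b * f) y‖ ≤ max n 0 := fun y => by
    by_cases hy : y ∈ Y'
    · exact (norm_mul_le_of_le_one (hbY y hy) (hf1 y)).trans (le_max_left _ _)
    · simp [hf0 y hy]
  have hZ1 : ∀ z, ‖Z'.indicator (1 : Rd d → ℂ) z‖ ≤ 1 := fun z => by
    by_cases hz : z ∈ Z' <;> simp [hz]
  have r1 := hK.repr_of_bounded hp hp' hq hq' ht hT hℓ hf1 hZ1
    (fun y hy => hf0 y fun h => hy (hY' h))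
    (fun z hz => Set.indicator_of_notMem (fun h => hz (hZ' h)) _) hv
  have r2 := hK.repr_of_bounded hp hp' hq hq' ht hT hℓ hn hZ1
    (fun y hy => by simp [hf0 y fun h => hy (hY' h)])
    (fun z hz => Set.indicator_of_notMem (fun h => hz (hZ' h)) _) hu
  have e0 : ∫ x, (b * v - u) x * h x = ∫ x in X', (b * v - u) x * h x := by
    refine (setIntegral_eq_integral_of_forall_compl_eq_zero fun x hx => ?_).symm
    rw [hh0 x hx, mul_zero]
  rw [e0, commForm]
  refine integral_congr_ae ?_
  filter_upwards [ae_restrict_of_ae r1, ae_restrict_of_ae r2, ae_restrict_mem mX'] with x h1 h2 hx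
  congr 1
  have hKint := hK.integrableOn (volume_cube_lt_top aY hℓ.le) (volume_cube_lt_top aZ hℓ.le)
    (hX' hx)
  rw [Pi.sub_apply, Pi.mul_apply, h1 (hX' hx), h2 (hX' hx), ← integral_const_mul]
  have mZ1 : Measurable (Z'.indicator (1 : Rd d → ℂ)) := measurable_one.indicator mZ'
  have ii : ∀ {k : Rd d → ℂ} {m : ℝ}, Measurable k → (∀ y, ‖k y‖ ≤ m) →
      IntegrableOn (fun w : Rd d × Rd d => K (x, w) * k w.1 * Z'.indicator (1 : Rd d → ℂ) w.2)
        (cube aY ℓ ×ˢ cube aZ ℓ) volume := by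
    intro k m hk hkm
    have e1 : (fun w : Rd d × Rd d => K (x, w) * k w.1 * Z'.indicator (1 : Rd d → ℂ) w.2)
        = fun w => (k w.1 * Z'.indicator (1 : Rd d → ℂ) w.2) * K (x, w) := by
      funext w; ring
    rw [e1]
    refine hKint.bdd_mul (c := m) ?_ (Eventually.of_forall fun w =>
      norm_mul_le_of_le_one (hkm _) (hZ1 _))
    exact ((hk.comp measurable_fst).mul (mZ1.comp measurable_snd)).aestronglyMeasurable
  rw [← integral_sub ((ii hf hf1).const_mul _) (ii (hb.mul hf) hn), Measure.prod_restrict,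
    ← Measure.volume_eq_prod]
  have e2 : ∀ w : Rd d × Rd d, w ∈ Y' ×ˢ Z' →
      b x * (K (x, w) * f w.1 * Z'.indicator (1 : Rd d → ℂ) w.2) -
        K (x, w) * (b * f) w.1 * Z'.indicator (1 : Rd d → ℂ) w.2 =
      (X'.indicator b x - Y'.indicator b w.1) * K (x, w) * f w.1 := by
    rintro w ⟨hw1, hw2⟩
    rw [Set.indicator_of_mem hx, Set.indicator_of_mem hw1, Set.indicator_of_mem hw2]
    simp only [Pi.one_apply, Pi.mul_apply]
    ring
  rw [← setIntegral_congr_fun (mY'.prod mZ') e2]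
  refine (setIntegral_eq_of_subset_of_forall_sdiff_eq_zero
    ((measurableSet_cube _ _).prod (measurableSet_cube _ _)) (Set.prod_mono hY' hZ') ?_)
  rintro w ⟨-, hw⟩
  rw [Set.mem_prod, not_and_or] at hw
  rcases hw with hw | hw
  · simp [hf0 _ hw]
  · simp [hw]

/-- The oscillation of `b` is controlled by two values of the commutator. -/
lemma LocalKernel.exists_test (hp : 1 ≤ p) (hp' : p ≠ ∞) (hq : 1 ≤ q) (hq' : q ≠ ∞)
    (ht : 1 ≤ t) (hT : BoundedBy T p q t M) {aX aY aZ : Rd d} (hℓ : 0 < ℓ)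
    (hK : LocalKernel T (cube aX ℓ) (cube aY ℓ) (cube aZ ℓ) ℓ c K K₀) {X' Y' Z' : Set (Rd d)}
    (hX' : X' ⊆ cube aX ℓ) (hY' : Y' ⊆ cube aY ℓ) (hZ' : Z' ⊆ cube aZ ℓ)
    (mX' : MeasurableSet X') (mY' : MeasurableSet Y') (mZ' : MeasurableSet Z')
    (vX : ℓ ^ d / 4 ≤ volume.real X') (vY : ℓ ^ d / 4 ≤ volume.real Y')
    (vZ : ℓ ^ d / 4 ≤ volume.real Z') {b : Rd d → ℂ} (hb : Measurable b) {n : ℝ} (hn : 0 ≤ n)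
    (hbX : ∀ x ∈ X', ‖b x‖ ≤ n) (hbY : ∀ y ∈ Y', ‖b y‖ ≤ n) :
    ∃ f h : Bool → Rd d → ℂ, (∀ i, Measurable (f i)) ∧ (∀ i, Measurable (h i)) ∧
      (∀ i x, ‖f i x‖ ≤ Y'.indicator 1 x) ∧ (∀ i x, ‖h i x‖ ≤ X'.indicator 1 x) ∧
      ∀ v u : Bool → Rd d → ℂ, (∀ i, IsExtValue T p q t (f i) (Z'.indicator 1) (v i)) →
        (∀ i, IsExtValue T p q t (b * f i) (Z'.indicator 1) (u i)) →
        c * ∫ y in Y', ‖b y - ⨍ x in X', b x‖ ≤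
          32 * ∑ i, ‖∫ x, (b * v i - u i) x * h i x‖ := by
  have fin : ∀ {S : Set (Rd d)} {a : Rd d}, S ⊆ cube a ℓ →
      IsFiniteMeasure ((volume : Measure (Rd d)).restrict S) := fun hS =>
    ⟨by rw [Measure.restrict_apply_univ]
        exact (measure_mono hS).trans_lt (volume_cube_lt_top _ hℓ.le)⟩
  have := fin hX'
  have := fin hY'
  have := fin hZ'
  set V := ℓ ^ d / 4 with hV
  have hVpos : 0 < V := by positivity
  -- The subsets may shrink to a quarter of the cubes, so `V² = ℓ^{2d} / 16`. This explains `128 = 8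
  -- · 16` in `LocalKernel` and `32 = 2 · 16` in the conclusion.
  have hV2 : ‖K₀‖ * V ^ 2 / 8 = ‖K₀‖ * ℓ ^ (2 * d) / 128 := by rw [hV]; ring
  set u₀ := X'.indicator b with hu₀
  set v₀ := Y'.indicator b with hv₀
  have bu : ∀ x, ‖u₀ x‖ ≤ n := fun x => by
    by_cases hx : x ∈ X'
    · simpa [hu₀, hx] using hbX x hx
    · simpa [hu₀, hx] using hn
  have bv : ∀ x, ‖v₀ x‖ ≤ n := fun x => by
    by_cases hx : x ∈ Y'
    · simpa [hv₀, hx] using hbY x hx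
    · simpa [hv₀, hx] using hn
  have key := osc_le_commForm (μ := volume.restrict X') (ν := volume.restrict Y')
    (ρ := volume.restrict Z') hK.meas (K₀ := K₀) (V := V)
    (by
      filter_upwards [ae_restrict_mem mX'] with x hx
      rw [hV2, Measure.prod_restrict, ← Measure.volume_eq_prod]
      exact (lintegral_mono_set (Set.prod_mono hY' hZ')).trans (hK.fst x (hX' hx)))
    (by
      filter_upwards [ae_restrict_mem mY'] with y hy
      rw [hV2]
      refine le_trans ?_ (hK.snd y (hY' hy))
      exact (lintegral_mono fun x => lintegral_mono_set hZ').trans (lintegral_mono_set hX'))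
    (hb.indicator mX') (hb.indicator mY') bu bv hVpos (by simpa using vX) (by simpa using vY)
    (by simpa using vZ)
  simp only [← hu₀, ← hv₀] at key
  set m := ⨍ x in X', u₀ x with hm
  set m' := ⨍ x in Y', v₀ x with hm'
  have em : m = ⨍ x in X', b x := setAverage_congr_fun mX' (Eventually.of_forall fun x hx => by
    simp [hu₀, hx])
  have eint : ∫ y in Y', ‖v₀ y - m‖ = ∫ y in Y', ‖b y - ⨍ x in X', b x‖ := by
    rw [← em]
    exact setIntegral_congr_fun mY' fun y hy => by simp [hv₀, hy]
  refine ⟨fun i => Y'.indicator (bif i then (fun y => phase (m - v₀ y)) else 1),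
    fun i => X'.indicator (bif i then 1 else (fun x => phase (u₀ x - m'))), ?_, ?_, ?_, ?_, ?_⟩
  · rintro (_ | _)
    · exact measurable_one.indicator mY'
    · exact (measurable_phase.comp (measurable_const.sub (hb.indicator mY'))).indicator mY'
  · rintro (_ | _)
    · exact (measurable_phase.comp ((hb.indicator mX').sub measurable_const)).indicator mX'
    · exact measurable_one.indicator mX'
  · rintro (_ | _) x <;> by_cases hx : x ∈ Y' <;> simp [hx, norm_phase_le]
  · rintro (_ | _) x <;> by_cases hx : x ∈ X' <;> simp [hx, norm_phase_le]
  intro v u hv hu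
  have form : ∀ {f h v u : Rd d → ℂ}, Measurable f → (∀ y, ‖f y‖ ≤ 1) →
      IsExtValue T p q t (Y'.indicator f) (Z'.indicator 1) v →
      IsExtValue T p q t (b * Y'.indicator f) (Z'.indicator 1) u →
      ∫ x, (b * v - u) x * X'.indicator h x = commForm (volume.restrict X') (volume.restrict Y')
        (volume.restrict Z') K u₀ v₀ f h := by
    intro f h v u hf hf1 hv hu
    rw [integral_comm_eq_commForm hp hp' hq hq' ht hT hℓ hK hX' hY' hZ' mX' mY' mZ' hb hbY
      (hf.indicator mY') (fun y => (norm_indicator_le_norm_self _ _).trans (hf1 y))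
      (fun y hy => Set.indicator_of_notMem hy _) (fun y hy => Set.indicator_of_notMem hy _) hv hu]
    rw [commForm, commForm]
    refine setIntegral_congr_fun mX' fun x hx => ?_
    simp only [Set.indicator_of_mem hx]
    congr 1
    rw [Measure.prod_restrict]
    refine setIntegral_congr_fun (mY'.prod mZ') fun w hw => ?_
    simp only [hu₀, hv₀, Set.indicator_of_mem hw.1, Set.indicator_of_mem hx]
  have f1 := form (f := fun y => phase (m - v₀ y)) (h := 1) (measurable_phase.comp (measurable_const.sub (hb.indicator mY')))
    (fun y => norm_phase_le _) (hv true) (hu true)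
  have f2 := form (f := 1) (h := fun x => phase (u₀ x - m')) measurable_one (by simp)
    (hv false) (hu false)
  rw [Fintype.sum_bool]
  simp only [cond_true, cond_false]
  have A0 : 0 ≤ ∫ y in Y', ‖v₀ y - m‖ := integral_nonneg fun _ => norm_nonneg _
  rw [← eint, f1, f2]
  have h5 : ‖K₀‖ * V ^ 2 = ‖K₀‖ * ℓ ^ (2 * d) / 16 := by rw [hV]; ring
  rw [h5] at key
  have h6 := mul_le_mul_of_nonneg_right hK.lower A0
  linarith

end

section

variable {d : ℕ}

/-! ### Bounded overlap -/

lemma gridCell_abs_le {a : Rd d} {ℓ : ℝ} {n : Fin d → ℤ} {Λ : ℕ} (hℓ : 0 < ℓ)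
    (hn : ∀ i, |n i| ≤ Λ) {x : Rd d} (hx : x ∈ gridCell a ℓ n) (i : Fin d) :
    |x i - a i| ≤ (Λ + 1) * ℓ := by
  have h1 := hx i
  rw [gridPt_apply] at h1
  have h2 : |(n i : ℝ)| ≤ Λ := by exact_mod_cast hn i
  rw [abs_le] at h2 ⊢
  constructor <;> nlinarith

/-- A family of cubes with disjoint major subsets has, after moving each cube by a bounded multiple
of its size, major subsets of bounded overlap. -/
lemma exists_bounded_overlap {ι : Type*} (s : Finset ι) (a : ι → Rd d) (ℓ : ι → ℝ)
    (E : ι → Set (Rd d)) (n : ι → Fin d → ℤ) (Λ : ℕ) (hℓ : ∀ i ∈ s, 0 < ℓ i)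
    (hn : ∀ i ∈ s, ∀ k, |n i k| ≤ Λ) (hE : ∀ i ∈ s, E i ⊆ cube (a i) (ℓ i))
    (mE : ∀ i ∈ s, MeasurableSet (E i))
    (dE : (s : Set ι).PairwiseDisjoint E)
    (vE : ∀ i ∈ s, ℓ i ^ d / 2 ≤ volume.real (E i)) :
    ∃ H : ι → Set (Rd d), (∀ i ∈ s, H i ⊆ gridCell (a i) (ℓ i) (n i)) ∧
      (∀ i, MeasurableSet (H i)) ∧ (∀ i ∈ s, ℓ i ^ d / 2 ≤ volume.real (H i)) ∧
      ∀ x, ∑ i ∈ s, (H i).indicator (1 : Rd d → ℝ) x ≤ 4 * (4 * Λ + 7) ^ d := by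
  classical
  set X : ι → Set (Rd d) := fun i => gridCell (a i) (ℓ i) (n i) with hX
  have mX : ∀ i, MeasurableSet (X i) := fun i => measurableSet_gridCell _ _ _
  set N : ℝ := 4 * (4 * Λ + 7) ^ d with hN
  have hNpos : 0 < N := by positivity
  -- `S i x` counts the cubes `X j ∋ x` that are no larger than `X i`. Packing bounds the mean of `S
  -- i` over `X i` by `N / 2`, so removing the points where `S i > N` costs at most half of `X i`.
  -- At any `x`, the largest cube whose remaining part contains `x` counts all the others.
  set S : ι → Rd d → ℝ := fun i x => ∑ j ∈ s.filter (fun j => ℓ j ≤ ℓ i),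
    (X j).indicator (1 : Rd d → ℝ) x with hS
  have mS : ∀ i, Measurable (S i) := fun i =>
    Finset.measurable_fun_sum _ fun j _ => measurable_one.indicator (mX j)
  have ind0 : ∀ (A : Set (Rd d)) x, 0 ≤ A.indicator (1 : Rd d → ℝ) x := fun A x =>
    Set.indicator_nonneg (fun _ _ => zero_le_one) x
  refine ⟨fun i => X i ∩ {x | S i x ≤ N}, fun i _ => Set.inter_subset_left,
    fun i => (mX i).inter (measurableSet_le (mS i) measurable_const), fun i hi => ?_, fun x => ?_⟩
  · have hli := hℓ i hi
    have vX : volume.real (X i) = ℓ i ^ d := volume_real_gridCell _ hli.le _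
    have fX : volume (X i) ≠ ∞ := (volume_cube_lt_top _ hli.le).ne
    -- the packing estimate
    set D : Finset ι := s.filter (fun j => ℓ j ≤ ℓ i ∧ (X j ∩ X i).Nonempty) with hD
    -- If `X j` meets `X i` and is no larger, each coordinate of `a j` is within `2 (Λ + 1) ℓ i` of
    -- that of `a i`, so `B` contains all of `E j`.
    set B : Set (Rd d) := cube (WithLp.toLp 2 fun k => a i k - (2 * Λ + 3) * ℓ i)
      ((4 * Λ + 7) * ℓ i) with hB
    have hBl : 0 ≤ (4 * Λ + 7) * ℓ i := by positivity
    have hsub : ∀ j ∈ D, E j ⊆ B := by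
      intro j hj y hy k
      obtain ⟨hjs, hji, x, hxj, hxi⟩ := Finset.mem_filter.1 hj
      have h1 := gridCell_abs_le (hℓ j hjs) (hn j hjs) hxj k
      have h2 := gridCell_abs_le hli (hn i hi) hxi k
      have h3 := hE j hjs hy k
      have h4 : (Λ + 1) * ℓ j ≤ (Λ + 1) * ℓ i := by gcongr
      rw [abs_le] at h1 h2
      simp only
      constructor <;> nlinarith
    have hpack : ∑ j ∈ D, ℓ j ^ d ≤ 2 * ((4 * Λ + 7) ^ d * ℓ i ^ d) := by
      have h1 : ∑ j ∈ D, ℓ j ^ d / 2 ≤ volume.real B := by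
        calc ∑ j ∈ D, ℓ j ^ d / 2 ≤ ∑ j ∈ D, volume.real (E j) :=
              Finset.sum_le_sum fun j hj => vE j (Finset.mem_filter.1 hj).1
          _ = volume.real (⋃ j ∈ D, E j) := by
              exact (measureReal_biUnion_finset
                (dE.subset fun j hj => (Finset.mem_filter.1 hj).1)
                (fun j hj => mE j (Finset.mem_filter.1 hj).1)
                (fun j hj => ((measure_mono (hsub j hj)).trans_lt
                  (volume_cube_lt_top _ hBl)).ne)).symm
          _ ≤ volume.real B := by
              refine measureReal_mono (Set.iUnion₂_subset hsub) (volume_cube_lt_top _ hBl).ne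
      rw [volume_real_cube _ hBl, mul_pow, ← Finset.sum_div] at h1
      linarith
    have hint : ∀ j, IntegrableOn ((X j).indicator (1 : Rd d → ℝ)) (X i) := fun j =>
      (integrableOn_const (C := (1 : ℝ)) fX).indicator (mX j)
    have hSint : ∫ x in X i, S i x ≤ N * ℓ i ^ d / 2 := by
      rw [integral_finsetSum _ fun j _ => hint j]
      calc ∑ j ∈ s.filter (fun j => ℓ j ≤ ℓ i), ∫ x in X i, (X j).indicator (1 : Rd d → ℝ) x
          = ∑ j ∈ D, ∫ x in X i, (X j).indicator (1 : Rd d → ℝ) x := by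
            symm
            refine Finset.sum_subset (fun j hj => ?_) fun j hj hjD => ?_
            · have := Finset.mem_filter.1 hj
              exact Finset.mem_filter.2 ⟨this.1, this.2.1⟩
            · have hjs := Finset.mem_filter.1 hj
              have he : X j ∩ X i = ∅ := by
                by_contra h
                exact hjD (Finset.mem_filter.2 ⟨hjs.1, hjs.2, Set.nonempty_iff_ne_empty.2 h⟩)
              rw [setIntegral_eq_zero_of_forall_eq_zero]
              intro x hx
              exact Set.indicator_of_notMem (fun h => by
                have : x ∈ X j ∩ X i := ⟨h, hx⟩
                rw [he] at this
                exact this) _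
        _ ≤ ∑ j ∈ D, ℓ j ^ d := by
            refine Finset.sum_le_sum fun j hj => ?_
            have hjl := (hℓ j (Finset.mem_filter.1 hj).1).le
            rw [setIntegral_indicator (mX j)]
            simp only [Pi.one_apply, setIntegral_const, smul_eq_mul, mul_one]
            rw [← volume_real_gridCell (a j) hjl (n j)]
            exact measureReal_mono Set.inter_subset_right (volume_cube_lt_top _ hjl).ne
        _ ≤ N * ℓ i ^ d / 2 := by
            rw [hN]
            linarith
    -- Chebyshev
    have hcheb : N * volume.real (X i \ {x | S i x ≤ N}) ≤ N * ℓ i ^ d / 2 := by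
      have mD : MeasurableSet (X i \ {x | S i x ≤ N}) :=
        (mX i).diff (measurableSet_le (mS i) measurable_const)
      have hSi : IntegrableOn (S i) (X i) := integrable_finsetSum _ fun j _ => hint j
      calc N * volume.real (X i \ {x | S i x ≤ N})
          = ∫ x in X i \ {x | S i x ≤ N}, N := by
            rw [setIntegral_const, smul_eq_mul, mul_comm]
        _ ≤ ∫ x in X i \ {x | S i x ≤ N}, S i x := by
            refine setIntegral_mono_on (integrableOn_const
              ((measure_mono Set.sdiff_subset).trans_lt (lt_top_iff_ne_top.2 fX)).ne)
              (hSi.mono_set Set.sdiff_subset) mD fun x hx => ?_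
            exact (not_le.1 hx.2).le
        _ ≤ ∫ x in X i, S i x := setIntegral_mono_set hSi
            (Eventually.of_forall fun x => Finset.sum_nonneg fun j _ => ind0 _ _)
            Set.sdiff_subset.eventuallyLE
        _ ≤ _ := hSint
    have hadd := measureReal_inter_add_sdiff (μ := volume) (s := X i)
      (measurableSet_le (mS i) measurable_const : MeasurableSet {x | S i x ≤ N}) fX
    have : volume.real (X i \ {x | S i x ≤ N}) ≤ ℓ i ^ d / 2 := by
      rw [mul_div_assoc] at hcheb
      exact le_of_mul_le_mul_left hcheb hNpos
    rw [vX] at hadd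
    linarith
  · by_cases hne : (s.filter fun i => x ∈ X i ∩ {x | S i x ≤ N}).Nonempty
    · obtain ⟨i, hi, hmax⟩ := Finset.exists_max_image _ ℓ hne
      obtain ⟨-, -, hiS⟩ := Finset.mem_filter.1 hi
      refine le_trans ?_ hiS
      calc ∑ j ∈ s, (X j ∩ {x | S j x ≤ N}).indicator (1 : Rd d → ℝ) x
          = ∑ j ∈ s.filter (fun j => ℓ j ≤ ℓ i),
              (X j ∩ {x | S j x ≤ N}).indicator (1 : Rd d → ℝ) x := by
            symm
            refine Finset.sum_subset (Finset.filter_subset _ _) fun j hj hjn => ?_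
            refine Set.indicator_of_notMem (fun h => hjn ?_) _
            exact Finset.mem_filter.2 ⟨hj, hmax j (Finset.mem_filter.2 ⟨hj, h⟩)⟩
        _ ≤ S i x := Finset.sum_le_sum fun j _ =>
            Set.indicator_le_indicator_of_subset Set.inter_subset_left (fun _ => zero_le_one) x
    · rw [Finset.not_nonempty_iff_eq_empty, Finset.filter_eq_empty_iff] at hne
      rw [Finset.sum_eq_zero fun j hj => Set.indicator_of_notMem (hne hj) _]
      exact hNpos.le

/-! ### Signs -/

/-- The diagonal of a matrix is dominated by the matrix with suitable signs. -/
lemma exists_signs {ι : Type*} (s : Finset ι) (a : ι → ι → ℂ) :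
    ∃ ε : ι → ℂ, (∀ i, ‖ε i‖ = 1) ∧
      (∑ i ∈ s, a i i).re ≤ (∑ i ∈ s, ∑ j ∈ s, ε i * ε j * a i j).re := by
  classical
  induction s using Finset.induction_on with
  | empty => exact ⟨fun _ => 1, by simp, by simp⟩
  | insert k s hk ih =>
    obtain ⟨ε, h1, h2⟩ := ih
    -- With `σ² = 1`, the new row and column contribute `σ x` besides the diagonal entry `a k k`, so
    -- the sign of `Re x` decides `σ`.
    set x : ℂ := ∑ i ∈ s, ε i * a i k + ∑ j ∈ s, ε j * a k j with hx
    obtain ⟨σ, hσ1, hσ2, hσ3⟩ : ∃ σ : ℂ, ‖σ‖ = 1 ∧ σ * σ = 1 ∧ 0 ≤ (σ * x).re := by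
      by_cases h : 0 ≤ x.re
      · exact ⟨1, by simp, by simp, by simpa using h⟩
      · exact ⟨-1, by simp, by simp, by simpa using (not_le.1 h).le⟩
    refine ⟨Function.update ε k σ, fun i => ?_, ?_⟩
    · by_cases hi : i = k
      · simp [hi, hσ1]
      · simp [hi, h1]
    · have hne : ∀ i ∈ s, i ≠ k := fun i hi h => hk (h ▸ hi)
      have e1 : ∀ i ∈ s, Function.update ε k σ i = ε i := fun i hi =>
        Function.update_of_ne (hne i hi) _ _
      rw [Finset.sum_insert hk, Finset.sum_insert hk, Finset.sum_insert hk]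
      have e2 : ∑ i ∈ s, ∑ j ∈ insert k s,
          Function.update ε k σ i * Function.update ε k σ j * a i j =
          σ * ∑ i ∈ s, ε i * a i k + ∑ i ∈ s, ∑ j ∈ s, ε i * ε j * a i j := by
        rw [Finset.mul_sum, ← Finset.sum_add_distrib]
        refine Finset.sum_congr rfl fun i hi => ?_
        rw [Finset.sum_insert hk, e1 i hi, Function.update_self]
        congr 1
        · ring
        · exact Finset.sum_congr rfl fun j hj => by rw [e1 j hj]
      have e3 : ∑ j ∈ s, Function.update ε k σ k * Function.update ε k σ j * a k j =
          σ * ∑ j ∈ s, ε j * a k j := by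
        rw [Finset.mul_sum]
        refine Finset.sum_congr rfl fun j hj => ?_
        rw [e1 j hj, Function.update_self]
        ring
      rw [e2, e3, Function.update_self, hσ2, one_mul]
      have e4 : a k k + σ * ∑ j ∈ s, ε j * a k j +
          (σ * ∑ i ∈ s, ε i * a i k + ∑ i ∈ s, ∑ j ∈ s, ε i * ε j * a i j) =
          a k k + σ * x + ∑ i ∈ s, ∑ j ∈ s, ε i * ε j * a i j := by
        rw [hx]
        ring
      rw [e4, Complex.add_re, Complex.add_re, Complex.add_re]
      linarith

end

section

variable {d : ℕ}

/-! ### Testing the commutator on families of functions -/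

/-- `N` bounds the commutator. -/
def CommBound (T : BilinOp d) (b : Rd d → ℂ) (p q r s : ℝ≥0∞) (N : ℝ≥0∞) : Prop :=
  ∀ f g w : Rd d → ℂ, IsCommValue T b p q r s f g w →
    eLpNorm w r volume ≤ N * eLpNorm f p volume * eLpNorm g q volume

variable {T : BilinOp d} {p q r s r' : ℝ≥0∞} {M₁ : ℝ≥0} {N : ℝ≥0∞} {b : Rd d → ℂ}

lemma norm_integral_mul_le (h : ENNReal.HolderTriple r r' 1) {w φ : Rd d → ℂ}
    (hw : AEStronglyMeasurable w volume) (hφ : AEStronglyMeasurable φ volume) :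
    ‖∫ x, w x * φ x‖ₑ ≤ eLpNorm w r volume * eLpNorm φ r' volume := by
  refine (enorm_integral_le_lintegral_enorm _).trans ?_
  have := eLpNorm_mul_le h hw hφ
  rwa [eLpNorm_one_eq_lintegral_enorm] at this

lemma eLpNorm_sum_le_of_norm_one {ι : Type*} (S : Finset ι) (ε : ι → ℂ)
    (hε : ∀ i, ‖ε i‖ ≤ 1) (f : ι → Rd d → ℂ) (e : ℝ≥0∞) :
    eLpNorm (∑ i ∈ S, ε i • f i) e volume ≤ eLpNorm (fun x => ∑ i ∈ S, ‖f i x‖) e volume := by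
  refine eLpNorm_mono_real fun x => ?_
  rw [Finset.sum_apply]
  refine (norm_sum_le _ _).trans (Finset.sum_le_sum fun i _ => ?_)
  rw [Pi.smul_apply, norm_smul]
  exact mul_le_of_le_one_left (norm_nonneg _) (hε i)

/-- This replaces averaging over random signs. The phases `θ` make the diagonal terms non-negative,
the first choice of signs separates the index of `f` from that of `(g, h)`, and the second the index
of `g` from that of `h`. One application of the commutator bound to the signed sums then controls
the whole diagonal. -/
lemma exists_sum_comm_le (hp : 1 ≤ p) (hp' : p ≠ ∞) (hq : 1 ≤ q) (hq' : q ≠ ∞)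
    (ht : 1 ≤ hσ p q) (hT₁ : BoundedBy T p q (hσ p q) M₁) (hr : ENNReal.HolderTriple r r' 1)
    (hN : CommBound T b p q r s N) (hb : Measurable b) {ι : Type*} (S : Finset ι)
    {f g h : ι → Rd d → ℂ} (hf : ∀ i, MemLp (f i) p volume) (hbf : ∀ i, MemLp (b * f i) p volume)
    (hg : ∀ i, MemLp (g i) q volume) (hh : ∀ i (e : ℝ≥0∞), MemLp (h i) e volume)
    (hbh : ∀ i (e : ℝ≥0∞), MemLp (b * h i) e volume) :
    ∃ v u : ι → Rd d → ℂ, (∀ i, IsExtValue T p q (hσ p q) (f i) (g i) (v i)) ∧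
      (∀ i, IsExtValue T p q (hσ p q) (b * f i) (g i) (u i)) ∧
      ENNReal.ofReal (∑ i ∈ S, ‖∫ x, (b * v i - u i) x * h i x‖) ≤
        N * eLpNorm (fun x => ∑ i ∈ S, ‖f i x‖) p volume *
          eLpNorm (fun x => ∑ i ∈ S, ‖g i x‖) q volume *
          eLpNorm (fun x => ∑ i ∈ S, ‖h i x‖) r' volume := by
  set t := hσ p q with ht_def
  choose v hv using fun i j => hT₁.exists_isExtValue hp hp' hq hq' ht (hf i) (hg j)
  choose u hu using fun i j => hT₁.exists_isExtValue hp hp' hq hq' ht (hbf i) (hg j)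
  refine ⟨fun i => v i i, fun i => u i i, fun i => hv i i, fun i => hu i i, ?_⟩
  -- integrability of the trilinear form
  have hint : ∀ i j k, Integrable (fun x => (b * v i j - u i j) x * h k x) volume := by
    intro i j k
    have : Fact (1 ≤ t) := ⟨ht⟩
    have hc : ENNReal.HolderConjugate t (ENNReal.conjExponent t) := .conjExponent ht
    have i1 : Integrable (v i j * (b * h k)) volume :=
      (hv i j).memLp_value.integrable_mul (hbh k (ENNReal.conjExponent t))
    have i2 : Integrable (u i j * h k) volume :=
      (hu i j).memLp_value.integrable_mul (hh k (ENNReal.conjExponent t))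
    refine (i1.sub i2).congr (Eventually.of_forall fun x => ?_)
    simp only [Pi.sub_apply, Pi.mul_apply]
    ring
  set A : ι → ι → ι → ℂ := fun i j k => ∫ x, (b * v i j - u i j) x * h k x with hA
  set θ : ι → ℂ := fun k => phase (A k k k) with hθ
  obtain ⟨ε, hε1, hε2⟩ := exists_signs S fun i k => θ k * A i k k
  obtain ⟨ε', hε'1, hε'2⟩ := exists_signs S fun j k => ∑ i ∈ S, ε i * ε k * (θ k * A i j k)
  -- the total functions
  set F : Rd d → ℂ := ∑ i ∈ S, ε i • f i with hF
  set G : Rd d → ℂ := ∑ j ∈ S, ε' j • g j with hG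
  set H : Rd d → ℂ := ∑ k ∈ S, (ε' k * ε k * θ k) • h k with hH
  set V : Rd d → ℂ := ∑ j ∈ S, ε' j • ∑ i ∈ S, ε i • v i j with hV
  set U : Rd d → ℂ := ∑ j ∈ S, ε' j • ∑ i ∈ S, ε i • u i j with hU
  have hFm : MemLp F p volume := memLp_finsetSum' _ fun i _ => (hf i).const_smul _
  have hbF : b * F = ∑ i ∈ S, ε i • (b * f i) := by
    rw [hF, Finset.mul_sum]
    exact Finset.sum_congr rfl fun i _ => by rw [mul_smul_comm]
  have hbFm : MemLp (b * F) p volume := by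
    rw [hbF]
    exact memLp_finsetSum' _ fun i _ => (hbf i).const_smul _
  have hGm : MemLp G q volume := memLp_finsetSum' _ fun i _ => (hg i).const_smul _
  have hVe : IsExtValue T p q t F G V :=
    IsExtValue.sum_right hp hp' hq ht hT₁ S ε' hFm fun j _ =>
      IsExtValue.sum_left hp hq hq' ht hT₁ S ε (hg j) fun i _ => hv i j
  have hUe : IsExtValue T p q t (b * F) G U := by
    refine IsExtValue.sum_right hp hp' hq ht hT₁ S ε' hbFm fun j _ => ?_
    rw [hbF]
    exact IsExtValue.sum_left hp hq hq' ht hT₁ S ε (hg j) fun i _ => hu i j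
  -- Since `b F ∈ L^p`, the splitting with zero second part is admissible.
  have hcomm : IsCommValue T b p q r s F G (b * V - (U + 0)) :=
    ⟨V, b * F, 0, U, 0, hVe, by simp, hUe, IsExtValue.zero_left hq hq' hGm, rfl⟩
  rw [add_zero] at hcomm
  have hexp : ∫ x, (b * V - U) x * H x =
      ∑ j ∈ S, ∑ k ∈ S, ε' j * ε' k * ∑ i ∈ S, ε i * ε k * (θ k * A i j k) := by
    have e1 : ∀ x, (b * V - U) x * H x = ∑ j ∈ S, ∑ k ∈ S, ∑ i ∈ S,
        (ε' j * ε' k * (ε i * ε k * θ k)) * ((b * v i j - u i j) x * h k x) := by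
      intro x
      have e2 : (b * V - U) x = ∑ j ∈ S, ε' j * ∑ i ∈ S, ε i * (b * v i j - u i j) x := by
        simp only [hV, hU, Pi.sub_apply, Pi.mul_apply, Finset.sum_apply, Pi.smul_apply,
          smul_eq_mul, Finset.mul_sum]
        rw [← Finset.sum_sub_distrib]
        refine Finset.sum_congr rfl fun j _ => ?_
        rw [← Finset.sum_sub_distrib]
        refine Finset.sum_congr rfl fun i _ => ?_
        ring
      rw [e2, Finset.sum_mul]
      refine Finset.sum_congr rfl fun j _ => ?_
      rw [hH, Finset.sum_apply, Finset.mul_sum]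
      refine Finset.sum_congr rfl fun k _ => ?_
      rw [Finset.mul_sum, Finset.sum_mul]
      refine Finset.sum_congr rfl fun i _ => ?_
      rw [Pi.smul_apply, smul_eq_mul]
      ring
    simp_rw [e1]
    rw [integral_finsetSum _ fun j _ => integrable_finsetSum _ fun k _ =>
      integrable_finsetSum _ fun i _ => (hint i j k).const_mul _]
    refine Finset.sum_congr rfl fun j _ => ?_
    rw [integral_finsetSum _ fun k _ => integrable_finsetSum _ fun i _ => (hint i j k).const_mul _]
    refine Finset.sum_congr rfl fun k _ => ?_
    rw [integral_finsetSum _ fun i _ => (hint i j k).const_mul _, Finset.mul_sum]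
    refine Finset.sum_congr rfl fun i _ => ?_
    rw [integral_const_mul, hA]
    ring
  have hdiag : ∑ i ∈ S, ‖A i i i‖ ≤ ‖∫ x, (b * V - U) x * H x‖ := by
    rw [hexp]
    have e3 : (∑ k ∈ S, θ k * A k k k) = ((∑ k ∈ S, ‖A k k k‖ : ℝ) : ℂ) := by
      rw [Complex.ofReal_sum]
      refine Finset.sum_congr rfl fun k _ => ?_
      rw [hθ, mul_comm]
      exact phase_mul _
    have e4 : ∑ k ∈ S, ∑ i ∈ S, ε i * ε k * (θ k * A i k k) =
        ∑ i ∈ S, ∑ k ∈ S, ε i * ε k * (θ k * A i k k) := Finset.sum_comm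
    rw [e3, Complex.ofReal_re] at hε2
    rw [e4] at hε'2
    exact hε2.trans (hε'2.trans (Complex.re_le_norm _))
  have hθ1 : ∀ k, ‖ε' k * ε k * θ k‖ ≤ 1 := fun k => by
    rw [norm_mul, norm_mul, hε1, hε'1, one_mul, one_mul]
    exact norm_phase_le _
  calc ENNReal.ofReal (∑ i ∈ S, ‖A i i i‖)
      ≤ ENNReal.ofReal ‖∫ x, (b * V - U) x * H x‖ := ENNReal.ofReal_le_ofReal hdiag
    _ = ‖∫ x, (b * V - U) x * H x‖ₑ := ofReal_norm _
    _ ≤ eLpNorm (b * V - U) r volume * eLpNorm H r' volume :=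
        norm_integral_mul_le hr ((hb.aestronglyMeasurable.mul hVe.memLp_value.1).sub
          hUe.memLp_value.1) (memLp_finsetSum' _ fun i _ => (hh i r').const_smul _).1
    _ ≤ (N * eLpNorm F p volume * eLpNorm G q volume) * eLpNorm H r' volume := by
        gcongr
        exact hN _ _ _ hcomm
    _ ≤ _ := by
        gcongr
        · exact eLpNorm_sum_le_of_norm_one S ε (fun i => (hε1 i).le) f p
        · exact eLpNorm_sum_le_of_norm_one S ε' (fun i => (hε'1 i).le) g q
        · exact eLpNorm_sum_le_of_norm_one S _ hθ1 h r'

/-- A function dominated by `C W^{1/p}` has `L^p` norm at most `C (∫ W)^{1/p}`. -/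
lemma eLpNorm_le_of_le_rpow {e : ℝ≥0∞} (he : e ≠ 0) {φ W : Rd d → ℝ} {C : ℝ} (hC : 0 ≤ C)
    (hW : ∀ x, 0 ≤ W x) (hφ0 : ∀ x, 0 ≤ φ x) (hφ : ∀ x, φ x ≤ C * W x ^ (e⁻¹).toReal) :
    eLpNorm φ e volume ≤ ENNReal.ofReal C * (∫⁻ x, ENNReal.ofReal (W x)) ^ (e⁻¹).toReal := by
  -- The conjugate of `r = 1` is infinite; the power of `W` is then `0`, and the hypothesis is a
  -- uniform bound.
  by_cases het : e = ∞
  · subst het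
    simp only [ENNReal.inv_top, ENNReal.toReal_zero, Real.rpow_zero, mul_one] at hφ
    rw [ENNReal.inv_top, ENNReal.toReal_zero, ENNReal.rpow_zero, mul_one, eLpNorm_exponent_top]
    refine eLpNormEssSup_le_of_ae_bound (Eventually.of_forall fun x => ?_)
    rw [Real.norm_of_nonneg (hφ0 x)]
    exact hφ x
  · have he0 : 0 < e.toReal := ENNReal.toReal_pos he het
    rw [eLpNorm_eq_lintegral_rpow_enorm_toReal he het, ENNReal.toReal_inv]
    calc (∫⁻ x, ‖φ x‖ₑ ^ e.toReal) ^ (1 / e.toReal)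
        ≤ (∫⁻ x, ENNReal.ofReal C ^ e.toReal * ENNReal.ofReal (W x)) ^ (1 / e.toReal) := by
          refine ENNReal.rpow_le_rpow (lintegral_mono fun x => ?_) (by positivity)
          have h1 : ‖φ x‖ₑ ≤ ENNReal.ofReal C * ENNReal.ofReal (W x) ^ (e.toReal)⁻¹ := by
            rw [ENNReal.ofReal_rpow_of_nonneg (hW x) (by positivity), ← ENNReal.ofReal_mul hC,
              ← ENNReal.toReal_inv, Real.enorm_of_nonneg (hφ0 x)]
            exact ENNReal.ofReal_le_ofReal (hφ x)
          calc ‖φ x‖ₑ ^ e.toReal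
              ≤ (ENNReal.ofReal C * ENNReal.ofReal (W x) ^ (e.toReal)⁻¹) ^ e.toReal :=
                ENNReal.rpow_le_rpow h1 he0.le
            _ = _ := by
                rw [ENNReal.mul_rpow_of_nonneg _ _ he0.le, ← ENNReal.rpow_mul,
                  inv_mul_cancel₀ he0.ne', ENNReal.rpow_one]
      _ = _ := by
          rw [lintegral_const_mul' _ _ (ENNReal.rpow_ne_top_of_nonneg he0.le
            ENNReal.ofReal_ne_top), ENNReal.mul_rpow_of_nonneg _ _ (by positivity),
            ← ENNReal.rpow_mul, one_div, mul_inv_cancel₀ he0.ne', ENNReal.rpow_one]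

end

section

variable {d : ℕ}

/-! ### The testing inequality for families of cubes -/

/-- Every cube has two companions, at a distance comparable to its size, with a local kernel. -/
def HasLocalKernels (T : BilinOp d) (Λ : ℕ) (c : ℝ) : Prop :=
  ∀ (a : Rd d) (ℓ : ℝ), 0 < ℓ → ∃ nX nZ : Fin d → ℤ, (∀ i, |nX i| ≤ Λ) ∧ (∀ i, |nZ i| ≤ Λ) ∧
    ∃ K K₀, LocalKernel T (gridCell a ℓ nX) (cube a ℓ) (gridCell a ℓ nZ) ℓ c K K₀

lemma measurableSet_norm_le {b : Rd d → ℂ} (hb : Measurable b) (n : ℕ) :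
    MeasurableSet {x | ‖b x‖ ≤ n} := measurableSet_le hb.norm measurable_const

lemma tendsto_setIntegral_trunc {E : Type*} [NormedAddCommGroup E] [NormedSpace ℝ E]
    {b : Rd d → ℂ} (hb : Measurable b) {A : Set (Rd d)}
    (hA : MeasurableSet A) {g : Rd d → E} (hg : IntegrableOn g A) :
    Tendsto (fun n : ℕ => ∫ x in A ∩ {x | ‖b x‖ ≤ n}, g x) atTop (𝓝 (∫ x in A, g x)) := by
  have hU : ⋃ n : ℕ, A ∩ {x | ‖b x‖ ≤ n} = A := by
    rw [← Set.inter_iUnion, Set.inter_eq_left]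
    intro x _
    obtain ⟨n, hn⟩ := exists_nat_ge ‖b x‖
    exact Set.mem_iUnion.2 ⟨n, hn⟩
  have := tendsto_setIntegral_of_monotone (μ := volume) (f := g)
    (s := fun n : ℕ => A ∩ {x | ‖b x‖ ≤ n}) (fun n => hA.inter (measurableSet_norm_le hb n))
    (fun m n hmn => Set.inter_subset_inter_right _ fun x (hx : ‖b x‖ ≤ m) =>
      hx.trans (by exact_mod_cast hmn)) (by rwa [hU])
  rwa [hU] at this

lemma tendsto_volume_trunc {b : Rd d → ℂ} (hb : Measurable b) {A : Set (Rd d)}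
    (hA : MeasurableSet A) (hfin : volume A ≠ ∞) :
    Tendsto (fun n : ℕ => volume.real (A ∩ {x | ‖b x‖ ≤ n})) atTop (𝓝 (volume.real A)) := by
  have := tendsto_setIntegral_trunc hb hA (integrableOn_const (C := (1 : ℝ)) hfin)
  simpa using this

lemma lintegral_sum_indicator_le {ι : Type*} [Fintype ι] {A : ι → Set (Rd d)} {τ ℓ : ι → ℝ}
    (hA : ∀ i, MeasurableSet (A i)) (hτ : ∀ i, 0 ≤ τ i) (hℓ : ∀ i, 0 ≤ ℓ i)
    (hv : ∀ i, volume (A i) ≤ ENNReal.ofReal (ℓ i ^ d)) :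
    ∫⁻ x, ENNReal.ofReal (∑ i, (A i).indicator (fun _ => τ i) x) ≤
      ENNReal.ofReal (∑ i, τ i * ℓ i ^ d) := by
  have e1 : ∀ x, ENNReal.ofReal (∑ i, (A i).indicator (fun _ => τ i) x) =
      ∑ i, (A i).indicator (fun _ => ENNReal.ofReal (τ i)) x := by
    intro x
    rw [ENNReal.ofReal_sum_of_nonneg fun i _ => Set.indicator_nonneg (fun _ _ => hτ i) x]
    refine Finset.sum_congr rfl fun i _ => ?_
    by_cases hx : x ∈ A i <;> simp [hx]
  simp_rw [e1]
  rw [lintegral_finsetSum _ fun i _ => measurable_const.indicator (hA i),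
    ENNReal.ofReal_sum_of_nonneg fun i _ => mul_nonneg (hτ i) (pow_nonneg (hℓ i) d)]
  refine Finset.sum_le_sum fun i _ => ?_
  rw [lintegral_indicator_const (hA i), ENNReal.ofReal_mul (hτ i)]
  gcongr
  exact hv i

/-- At most `B` of the sets contain `x`, and each of the corresponding `τ i ^ e` is at most the
`e`-th power of the full sum. Under bounded overlap, no growth condition on the weights is needed.
-/
lemma sum_indicator_rpow_le {ι : Type*} [Fintype ι] {A : ι → Set (Rd d)} {τ : ι → ℝ} {B e : ℝ}
    (hτ : ∀ i, 0 ≤ τ i) (he : 0 ≤ e) (x : Rd d)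
    (hB : ∑ i, (A i).indicator (1 : Rd d → ℝ) x ≤ B) :
    ∑ i, (A i).indicator (fun _ => τ i ^ e) x ≤
      B * (∑ i, (A i).indicator (fun _ => τ i) x) ^ e := by
  have h0 : ∀ i, 0 ≤ (A i).indicator (fun _ => τ i) x := fun i =>
    Set.indicator_nonneg (fun _ _ => hτ i) x
  have h1 : 0 ≤ (∑ i, (A i).indicator (fun _ => τ i) x) ^ e :=
    Real.rpow_nonneg (Finset.sum_nonneg fun i _ => h0 i) _
  refine le_trans ?_ (mul_le_mul_of_nonneg_right hB h1)
  rw [Finset.sum_mul]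
  refine Finset.sum_le_sum fun i _ => ?_
  by_cases hx : x ∈ A i
  · simp only [Set.indicator_of_mem hx, Pi.one_apply, one_mul]
    refine Real.rpow_le_rpow (hτ i) ?_ he
    have := Finset.single_le_sum (f := fun i => (A i).indicator (fun _ => τ i) x)
      (fun j _ => h0 j) (Finset.mem_univ i)
    simpa [hx] using this
  · simp [hx]

/-- The average differs from `m` by at most the mean of `‖f - m‖`, so it is optimal up to a factor
two. -/
lemma integral_norm_sub_average_le {E : Type*} [NormedAddCommGroup E] [NormedSpace ℝ E]
    [CompleteSpace E] {α : Type*} [MeasurableSpace α]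
    {μ : Measure α} [IsFiniteMeasure μ] (h0 : μ.real Set.univ ≠ 0) {f : α → E}
    (hf : Integrable f μ) (m : E) :
    ∫ x, ‖f x - ⨍ y, f y ∂μ‖ ∂μ ≤ 2 * ∫ x, ‖f x - m‖ ∂μ := by
  have hfm : Integrable (fun x => f x - m) μ := hf.sub (integrable_const m)
  set a := ⨍ y, f y ∂μ with ha
  have h3 : μ.real Set.univ * ‖m - a‖ ≤ ∫ x, ‖f x - m‖ ∂μ := by
    have : ∫ y, (f y - m) ∂μ = μ.real Set.univ • (a - m) := by
      rw [integral_sub hf (integrable_const _), integral_const, ha, average_eq, smul_sub,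
        smul_smul, mul_inv_cancel₀ h0, one_smul]
    have h4 := norm_integral_le_integral_norm (μ := μ) fun y => f y - m
    rw [this, norm_smul, Real.norm_of_nonneg (by positivity)] at h4
    rwa [norm_sub_rev]
  calc ∫ x, ‖f x - a‖ ∂μ ≤ ∫ x, (‖f x - m‖ + ‖m - a‖) ∂μ := by
        refine integral_mono (hf.sub (integrable_const _)).norm
          (hfm.norm.add (integrable_const _)) fun x => ?_
        simp only
        rw [show f x - a = (f x - m) + (m - a) by abel]
        exact norm_add_le _ _
    _ = ∫ x, ‖f x - m‖ ∂μ + μ.real Set.univ * ‖m - a‖ := by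
        rw [integral_add hfm.norm (integrable_const _), integral_const, smul_eq_mul]
    _ ≤ _ := by linarith

variable {T : BilinOp d} {p q r s r' : ℝ≥0∞} {M₁ : ℝ≥0} {N : ℝ≥0∞} {b : Rd d → ℂ} {Λ : ℕ} {c : ℝ}

/-- The testing inequality, on the set where `|b| ≤ n`. -/
lemma testing_trunc (hp : 1 ≤ p) (hp' : p ≠ ∞) (hq : 1 ≤ q) (hq' : q ≠ ∞)
    (ht : 1 ≤ hσ p q) (hT₁ : BoundedBy T p q (hσ p q) M₁) (hr : ENNReal.HolderTriple r r' 1)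
    (hN : CommBound T b p q r s N) (hb : Measurable b) {ι : Type*} [Fintype ι]
    {a : ι → Rd d} {ℓ τ : ι → ℝ} (hℓ : ∀ i, 0 < ℓ i) (hτ : ∀ i, 0 < τ i)
    {nX nZ : ι → Fin d → ℤ} {H G : ι → Set (Rd d)}
    (hK : ∀ i, ∃ K K₀, LocalKernel T (gridCell (a i) (ℓ i) (nX i)) (cube (a i) (ℓ i))
      (gridCell (a i) (ℓ i) (nZ i)) (ℓ i) c K K₀)
    (hH : ∀ i, H i ⊆ gridCell (a i) (ℓ i) (nX i)) (hG : ∀ i, G i ⊆ gridCell (a i) (ℓ i) (nZ i))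
    (mH : ∀ i, MeasurableSet (H i)) (mG : ∀ i, MeasurableSet (G i)) {B Cf : ℝ} (hCf : 0 ≤ Cf)
    (hB : 0 ≤ B)
    (oH : ∀ x, ∑ i, (H i).indicator (1 : Rd d → ℝ) x ≤ B)
    (oG : ∀ x, ∑ i, (G i).indicator (1 : Rd d → ℝ) x ≤ B)
    (hf : ∀ x, ∑ i, (cube (a i) (ℓ i)).indicator (fun _ => τ i ^ (p⁻¹).toReal) x ≤
      Cf * (∑ i, (cube (a i) (ℓ i)).indicator (fun _ => τ i) x) ^ (p⁻¹).toReal)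
    (n : ℕ) (vH : ∀ i, ℓ i ^ d / 4 ≤ volume.real (H i ∩ {x | ‖b x‖ ≤ n}))
    (vY : ∀ i, ℓ i ^ d / 4 ≤ volume.real (cube (a i) (ℓ i) ∩ {x | ‖b x‖ ≤ n}))
    (vG : ∀ i, ℓ i ^ d / 4 ≤ volume.real (G i)) :
    ENNReal.ofReal (c * ∑ i, τ i ^ ((p⁻¹).toReal + (q⁻¹).toReal + (r'⁻¹).toReal) *
      ∫ y in cube (a i) (ℓ i) ∩ {x | ‖b x‖ ≤ n}, ‖b y - ⨍ x in H i ∩ {x | ‖b x‖ ≤ n}, b x‖) ≤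
    ENNReal.ofReal (64 * Cf * B * B) * N * ENNReal.ofReal (∑ i, τ i * ℓ i ^ d) ^
      ((p⁻¹).toReal + (q⁻¹).toReal + (r'⁻¹).toReal) := by
  have mBn := measurableSet_norm_le hb n
  choose K K₀ hK using hK
  choose f h mf mh bf bh key using fun i => (hK i).exists_test hp hp' hq hq' ht hT₁ (hℓ i)
    (Set.inter_subset_left.trans (hH i)) (Set.inter_subset_left (t := {x | ‖b x‖ ≤ n})) (hG i)
    ((mH i).inter mBn) ((measurableSet_cube _ _).inter mBn) (mG i) (vH i) (vY i) (vG i)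
    hb (n := n) n.cast_nonneg (fun x hx => hx.2) (fun x hx => hx.2)
  set ep := (p⁻¹).toReal with hep
  set eg := (q⁻¹).toReal with heg
  set er := (r'⁻¹).toReal with her
  set Wt := ENNReal.ofReal (∑ i, τ i * ℓ i ^ d) with hWt
  have hr0 : r' ≠ 0 := by
    rintro rfl
    have := hr.inv_add_inv_eq_inv
    simp at this
  -- bounded functions with bounded support
  have bdd : ∀ {A : Set (Rd d)} {i : ι} {ν : Fin d → ℤ} {φ : Rd d → ℂ},
      A ⊆ gridCell (a i) (ℓ i) ν → Measurable φ →
      (∀ x, ‖φ x‖ ≤ (A ∩ {x | ‖b x‖ ≤ n}).indicator 1 x) → ∀ (α : ℝ) (e : ℝ≥0∞),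
      MemLp ((α : ℂ) • φ) e volume ∧ MemLp (b * (α : ℂ) • φ) e volume := by
    intro A i ν φ hA hφ hφA α e
    have h0 : ∀ x ∉ A ∩ {x | ‖b x‖ ≤ n}, φ x = 0 := fun x hx => by
      have := hφA x
      rw [Set.indicator_of_notMem hx] at this
      exact norm_le_zero_iff.1 this
    have h1 : ∀ x, ‖φ x‖ ≤ 1 := fun x => (hφA x).trans
      (Set.indicator_le_self' (fun _ _ => zero_le_one) x)
    have h00 : ∀ x ∉ cube (gridPt (a i) (ℓ i) ν) (ℓ i), φ x = 0 := fun x hx =>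
      h0 x fun hx' => hx (hA hx'.1)
    refine ⟨(memLp_of_bounded hφ.aestronglyMeasurable h1 (hℓ i) h00 e).const_smul _, ?_⟩
    rw [mul_smul_comm]
    refine (memLp_of_bounded (a := gridPt (a i) (ℓ i) ν) (hb.mul hφ).aestronglyMeasurable (M := n)
      (fun x => ?_) (hℓ i) (fun x hx => by simp [h00 x hx]) e).const_smul _
    by_cases hx : x ∈ A ∩ {x | ‖b x‖ ≤ n}
    · exact norm_mul_le_of_le_one hx.2 (h1 x)
    · simp [h0 x hx]
  have hP : ∀ i, cube (a i) (ℓ i) ⊆ gridCell (a i) (ℓ i) 0 := fun i =>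
    (gridCell_zero _ _).symm.subset
  have gmem : ∀ i, MemLp ((G i).indicator (1 : Rd d → ℂ)) q volume := fun i =>
    memLp_indicator_const q (mG i) 1
      (Or.inr ((measure_mono (hG i)).trans_lt (volume_cube_lt_top _ (hℓ i).le)).ne)
  have τpos : ∀ i (e : ℝ), 0 < τ i ^ e := fun i e => Real.rpow_pos_of_pos (hτ i) e
  -- the pairing, for each of the two choices of test functions
  have pair : ∀ κ : Bool, ∃ v u : ι → Rd d → ℂ,
      (∀ i, IsExtValue T p q (hσ p q) (f i κ) ((G i).indicator 1) (v i)) ∧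
      (∀ i, IsExtValue T p q (hσ p q) (b * f i κ) ((G i).indicator 1) (u i)) ∧
      ENNReal.ofReal (∑ i, τ i ^ (ep + eg + er) * ‖∫ x, (b * v i - u i) x * h i κ x‖) ≤
        ENNReal.ofReal (Cf * B * B) * N * Wt ^ (ep + eg + er) := by
    intro κ
    -- The powers `1/p`, `1/q`, `1/r'` of the weights are chosen so that each of the three sums is
    -- dominated by the same power of `∑ τ_i 1_{A_i}`; each norm is then a power of the single
    -- quantity `∑ τ_i ℓ_i^d`.
    obtain ⟨v, u, hv, hu, huv⟩ := exists_sum_comm_le hp hp' hq hq' ht hT₁ hr hN hb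
      (Finset.univ : Finset ι)
      (f := fun i => ((τ i ^ ep : ℝ) : ℂ) • f i κ)
      (g := fun i => ((τ i ^ eg : ℝ) : ℂ) • (G i).indicator 1)
      (h := fun i => ((τ i ^ er : ℝ) : ℂ) • h i κ)
      (fun i => (bdd (hP i) (mf i κ) (bf i κ) _ p).1)
      (fun i => (bdd (hP i) (mf i κ) (bf i κ) _ p).2)
      (fun i => (gmem i).const_smul _)
      (fun i e => (bdd (hH i) (mh i κ) (bh i κ) _ e).1)
      (fun i e => (bdd (hH i) (mh i κ) (bh i κ) _ e).2)
    set α : ι → ℂ := fun i => ((τ i ^ ep : ℝ) : ℂ) with hα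
    set β : ι → ℂ := fun i => ((τ i ^ eg : ℝ) : ℂ) with hβ
    set γ : ι → ℂ := fun i => ((τ i ^ er : ℝ) : ℂ) with hγ
    have α0 : ∀ i, α i ≠ 0 := fun i => Complex.ofReal_ne_zero.2 (τpos i ep).ne'
    have β0 : ∀ i, β i ≠ 0 := fun i => Complex.ofReal_ne_zero.2 (τpos i eg).ne'
    -- The values found belong to the weighted functions; the weights are positive and are divided
    -- out by bilinearity.
    refine ⟨fun i => (β i)⁻¹ • (α i)⁻¹ • v i, fun i => (β i)⁻¹ • (α i)⁻¹ • u i,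
      fun i => ?_, fun i => ?_, ?_⟩
    · have := ((hv i).smul_left (α i)⁻¹).smul_right (β i)⁻¹
      rwa [inv_smul_smul₀ (α0 i), inv_smul_smul₀ (β0 i)] at this
    · have := ((hu i).smul_left (α i)⁻¹).smul_right (β i)⁻¹
      rwa [mul_smul_comm, inv_smul_smul₀ (α0 i), inv_smul_smul₀ (β0 i)] at this
    · have e1 : ∀ i, τ i ^ (ep + eg + er) *
          ‖∫ x, (b * ((β i)⁻¹ • (α i)⁻¹ • v i) - (β i)⁻¹ • (α i)⁻¹ • u i) x * h i κ x‖ =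
          ‖∫ x, (b * v i - u i) x * (γ i • h i κ) x‖ := by
        intro i
        have e2 : ∀ x, (b * v i - u i) x * (γ i • h i κ) x = (α i * β i * γ i) *
            ((b * ((β i)⁻¹ • (α i)⁻¹ • v i) - (β i)⁻¹ • (α i)⁻¹ • u i) x * h i κ x) := by
          intro x
          simp only [Pi.sub_apply, Pi.mul_apply, Pi.smul_apply, smul_eq_mul]
          have := α0 i
          have := β0 i
          field_simp
        simp_rw [e2]
        rw [integral_const_mul, norm_mul, norm_mul, norm_mul, hα, hβ, hγ]
        simp only [Complex.norm_real]
        rw [Real.norm_of_nonneg (τpos i ep).le, Real.norm_of_nonneg (τpos i eg).le,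
          Real.norm_of_nonneg (τpos i er).le, Real.rpow_add (hτ i), Real.rpow_add (hτ i)]
      simp_rw [e1]
      refine huv.trans ?_
      have nrm : ∀ i (e : ℝ) (φ : Rd d → ℂ) (A A' : Set (Rd d)) x, (‖φ x‖ ≤ (A ∩ A').indicator 1 x) →
          ‖(((τ i ^ e : ℝ) : ℂ) • φ) x‖ ≤ A.indicator (fun _ => τ i ^ e) x := by
        intro i e φ A A' x hx
        rw [Pi.smul_apply, norm_smul, Complex.norm_real, Real.norm_of_nonneg (τpos i e).le]
        by_cases hxA : x ∈ A
        · rw [Set.indicator_of_mem hxA]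
          refine mul_le_of_le_one_right (τpos i e).le (hx.trans ?_)
          exact Set.indicator_le_self' (fun _ _ => zero_le_one) x
        · rw [Set.indicator_of_notMem (fun h => hxA h.1)] at hx
          rw [Set.indicator_of_notMem hxA, norm_le_zero_iff.1 hx, norm_zero, mul_zero]
      have W0 : ∀ (A : ι → Set (Rd d)) x, 0 ≤ ∑ i, (A i).indicator (fun _ => τ i) x :=
        fun A x => Finset.sum_nonneg fun i _ => Set.indicator_nonneg (fun _ _ => (hτ i).le) x
      have vol : ∀ {A : Set (Rd d)} {i : ι} {ν : Fin d → ℤ}, A ⊆ gridCell (a i) (ℓ i) ν →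
          volume A ≤ ENNReal.ofReal (ℓ i ^ d) := fun hA =>
        (measure_mono hA).trans (volume_cube _ (hℓ _).le).le
      -- The `f i` occupy whole cubes, which may overlap arbitrarily often; `hf` takes the place of
      -- bounded overlap.
      have b1 : eLpNorm (fun x => ∑ i, ‖(α i • f i κ) x‖) p volume ≤
          ENNReal.ofReal Cf * Wt ^ ep := by
        refine (eLpNorm_le_of_le_rpow (one_pos.trans_le hp).ne' hCf (W0 fun i => cube (a i) (ℓ i))
          (fun x => Finset.sum_nonneg fun i _ => norm_nonneg _) fun x => ?_).trans ?_
        · exact (Finset.sum_le_sum fun i _ => nrm i ep _ _ _ x (bf i κ x)).trans (hf x)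
        · gcongr
          exact lintegral_sum_indicator_le (fun i => measurableSet_cube _ _) (fun i => (hτ i).le)
            (fun i => (hℓ i).le) fun i => vol (hP i)
      have b2 : eLpNorm (fun x => ∑ i, ‖(β i • (G i).indicator (1 : Rd d → ℂ)) x‖) q volume ≤
          ENNReal.ofReal B * Wt ^ eg := by
        refine (eLpNorm_le_of_le_rpow (one_pos.trans_le hq).ne' hB (W0 G)
          (fun x => Finset.sum_nonneg fun i _ => norm_nonneg _) fun x => ?_).trans ?_
        · refine (Finset.sum_le_sum fun i _ => nrm i eg _ (G i) Set.univ x ?_).trans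
            (sum_indicator_rpow_le (fun i => (hτ i).le) ENNReal.toReal_nonneg x (oG x))
          by_cases hx : x ∈ G i <;> simp [hx]
        · gcongr
          exact lintegral_sum_indicator_le mG (fun i => (hτ i).le)
            (fun i => (hℓ i).le) fun i => vol (hG i)
      have b3 : eLpNorm (fun x => ∑ i, ‖(γ i • h i κ) x‖) r' volume ≤
          ENNReal.ofReal B * Wt ^ er := by
        refine (eLpNorm_le_of_le_rpow hr0 hB (W0 H)
          (fun x => Finset.sum_nonneg fun i _ => norm_nonneg _) fun x => ?_).trans ?_
        · exact (Finset.sum_le_sum fun i _ => nrm i er _ (H i) _ x (bh i κ x)).trans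
            (sum_indicator_rpow_le (fun i => (hτ i).le) ENNReal.toReal_nonneg x (oH x))
        · gcongr
          exact lintegral_sum_indicator_le mH (fun i => (hτ i).le)
            (fun i => (hℓ i).le) fun i => vol (hH i)
      calc _ ≤ N * (ENNReal.ofReal Cf * Wt ^ ep) * (ENNReal.ofReal B * Wt ^ eg) *
            (ENNReal.ofReal B * Wt ^ er) := by gcongr
        _ = _ := by
            rw [ENNReal.rpow_add_of_nonneg _ _ (add_nonneg ENNReal.toReal_nonneg
              ENNReal.toReal_nonneg) ENNReal.toReal_nonneg, ENNReal.rpow_add_of_nonneg _ _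
              ENNReal.toReal_nonneg ENNReal.toReal_nonneg, ENNReal.ofReal_mul (by positivity),
              ENNReal.ofReal_mul hCf]
            ring
  choose v u hv hu huv using pair
  have fin : c * ∑ i, τ i ^ (ep + eg + er) * ∫ y in cube (a i) (ℓ i) ∩ {x | ‖b x‖ ≤ n},
      ‖b y - ⨍ x in H i ∩ {x | ‖b x‖ ≤ n}, b x‖ ≤ 32 * ∑ κ : Bool, ∑ i, τ i ^ (ep + eg + er) *
        ‖∫ x, (b * v κ i - u κ i) x * h i κ x‖ := by
    rw [Finset.mul_sum, Finset.sum_comm, Finset.mul_sum]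
    refine Finset.sum_le_sum fun i _ => ?_
    have := mul_le_mul_of_nonneg_left (key i (fun κ => v κ i) (fun κ => u κ i)
      (fun κ => hv κ i) (fun κ => hu κ i)) (τpos i (ep + eg + er)).le
    rw [← Finset.mul_sum]
    linarith
  calc _ ≤ _ := ENNReal.ofReal_le_ofReal fin
    _ = 32 * ∑ κ : Bool, ENNReal.ofReal (∑ i, τ i ^ (ep + eg + er) *
        ‖∫ x, (b * v κ i - u κ i) x * h i κ x‖) := by
        have h0 : ∀ κ : Bool, 0 ≤ ∑ i, τ i ^ (ep + eg + er) *
            ‖∫ x, (b * v κ i - u κ i) x * h i κ x‖ := fun κ =>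
          Finset.sum_nonneg fun i _ => mul_nonneg (τpos i _).le (norm_nonneg _)
        rw [ENNReal.ofReal_mul (by norm_num), ENNReal.ofReal_sum_of_nonneg fun κ _ => h0 κ]
        norm_num
    _ ≤ 32 * ∑ _κ : Bool, ENNReal.ofReal (Cf * B * B) * N * Wt ^ (ep + eg + er) := by
        gcongr with κ
        exact huv κ
    _ = _ := by
        rw [show 64 * Cf * B * B = 64 * (Cf * B * B) by ring,
          ENNReal.ofReal_mul (p := 64) (by norm_num), Fintype.sum_bool]
        norm_num
        ring

/-- The testing inequality. -/
theorem testing (hp : 1 ≤ p) (hp' : p ≠ ∞) (hq : 1 ≤ q) (hq' : q ≠ ∞)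
    (ht : 1 ≤ hσ p q) (hT₁ : BoundedBy T p q (hσ p q) M₁) (hr : ENNReal.HolderTriple r r' 1)
    (hN : CommBound T b p q r s N) (hb : Measurable b) (hbi : LocallyIntegrable b volume)
    (hK : HasLocalKernels T Λ c) (hc : 0 ≤ c) {ι : Type*} [Fintype ι]
    {a : ι → Rd d} {ℓ τ : ι → ℝ} (hℓ : ∀ i, 0 < ℓ i) (hτ : ∀ i, 0 < τ i) (E : ι → Set (Rd d))
    (hE : ∀ i, E i ⊆ cube (a i) (ℓ i)) (mE : ∀ i, MeasurableSet (E i))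
    (dE : Pairwise (Function.onFun Disjoint E)) (vE : ∀ i, ℓ i ^ d / 2 ≤ volume.real (E i))
    {Cf : ℝ} (hCf : 0 ≤ Cf)
    (hf : ∀ x, ∑ i, (cube (a i) (ℓ i)).indicator (fun _ => τ i ^ (p⁻¹).toReal) x ≤
      Cf * (∑ i, (cube (a i) (ℓ i)).indicator (fun _ => τ i) x) ^ (p⁻¹).toReal) :
    ENNReal.ofReal (c * ∑ i, τ i ^ ((p⁻¹).toReal + (q⁻¹).toReal + (r'⁻¹).toReal) *
      ∫ y in cube (a i) (ℓ i), ‖b y - ⨍ x in cube (a i) (ℓ i), b x‖) ≤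
    ENNReal.ofReal (128 * Cf * (4 * (4 * Λ + 7) ^ d) ^ 2) * N *
      ENNReal.ofReal (∑ i, τ i * ℓ i ^ d) ^
        ((p⁻¹).toReal + (q⁻¹).toReal + (r'⁻¹).toReal) := by
  choose nX nZ hnX hnZ hKer using fun i => hK (a i) (ℓ i) (hℓ i)
  obtain ⟨H, hH, mH, vH, oH⟩ := exists_bounded_overlap Finset.univ a ℓ E nX Λ (fun i _ => hℓ i)
    (fun i _ => hnX i) (fun i _ => hE i) (fun i _ => mE i) (by
      simpa [Set.pairwise_univ, Set.PairwiseDisjoint] using dE) (fun i _ => vE i)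
  obtain ⟨G, hG, mG, vG, oG⟩ := exists_bounded_overlap Finset.univ a ℓ E nZ Λ (fun i _ => hℓ i)
    (fun i _ => hnZ i) (fun i _ => hE i) (fun i _ => mE i) (by
      simpa [Set.pairwise_univ, Set.PairwiseDisjoint] using dE) (fun i _ => vE i)
  simp only [Finset.mem_univ, forall_const] at hH vH hG vG
  set θ := (p⁻¹).toReal + (q⁻¹).toReal + (r'⁻¹).toReal with hθ
  set B : ℝ := 4 * (4 * Λ + 7) ^ d with hB
  have hld : ∀ i, 0 < ℓ i ^ d := fun i => pow_pos (hℓ i) d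
  have fH : ∀ i, volume (H i) ≠ ∞ := fun i =>
    ((measure_mono (hH i)).trans_lt (volume_cube_lt_top _ (hℓ i).le)).ne
  have fP : ∀ i, volume (cube (a i) (ℓ i)) ≠ ∞ := fun i => (volume_cube_lt_top _ (hℓ i).le).ne
  have iP : ∀ i, IntegrableOn b (cube (a i) (ℓ i)) := fun i => integrableOn_cube hbi _ (hℓ i)
  have iH : ∀ i, IntegrableOn b (H i) := fun i =>
    (integrableOn_cube hbi _ (hℓ i)).mono_set (hH i)
  set osc : ι → ℝ := fun i => ∫ y in cube (a i) (ℓ i), ‖b y - ⨍ x in H i, b x‖ with hosc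
  set oscn : ι → ℕ → ℝ := fun i n => ∫ y in cube (a i) (ℓ i) ∩ {x | ‖b x‖ ≤ n},
    ‖b y - ⨍ x in H i ∩ {x | ‖b x‖ ≤ n}, b x‖ with hoscn
  -- Restriction to `|b| ≤ n` makes `b f` bounded. For large `n` at least half of the lower bound
  -- `ℓ^d / 2` for the volume survives, which is the quarter that `LocalKernel.exists_test` allows.
  have ev1 : ∀ᶠ n : ℕ in atTop, ∀ i, ℓ i ^ d / 4 ≤ volume.real (H i ∩ {x | ‖b x‖ ≤ n}) :=
    eventually_all.2 fun i => (tendsto_volume_trunc hb (mH i) (fH i)).eventually_const_le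
      (by linarith [vH i, hld i])
  have ev2 : ∀ᶠ n : ℕ in atTop, ∀ i,
      ℓ i ^ d / 4 ≤ volume.real (cube (a i) (ℓ i) ∩ {x | ‖b x‖ ≤ n}) :=
    eventually_all.2 fun i => (tendsto_volume_trunc hb (measurableSet_cube _ _)
      (fP i)).eventually_const_le (by
        rw [volume_real_cube _ (hℓ i).le]
        linarith [hld i])
  have lim : ∀ i, Tendsto (oscn i) atTop (𝓝 (osc i)) := by
    intro i
    have vpos : volume.real (H i) ≠ 0 := by linarith [vH i, hld i]
    have h1 : Tendsto (fun n : ℕ => ⨍ x in H i ∩ {x | ‖b x‖ ≤ n}, b x) atTop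
        (𝓝 (⨍ x in H i, b x)) := by
      simp_rw [setAverage_eq]
      exact ((tendsto_volume_trunc hb (mH i) (fH i)).inv₀ vpos).smul
        (tendsto_setIntegral_trunc hb (mH i) (iH i))
    have h2 : Tendsto (fun n : ℕ => ∫ y in cube (a i) (ℓ i) ∩ {x | ‖b x‖ ≤ n},
        ‖b y - ⨍ x in H i, b x‖) atTop (𝓝 (osc i)) :=
      tendsto_setIntegral_trunc hb (measurableSet_cube _ _)
        ((iP i).sub (integrableOn_const (fP i))).norm
    have h3 : Tendsto (fun n : ℕ => oscn i n - ∫ y in cube (a i) (ℓ i) ∩ {x | ‖b x‖ ≤ n},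
        ‖b y - ⨍ x in H i, b x‖) atTop (𝓝 0) := by
      have h4 : Tendsto (fun n : ℕ => ‖(⨍ x in H i ∩ {x | ‖b x‖ ≤ n}, b x) - ⨍ x in H i, b x‖ *
          volume.real (cube (a i) (ℓ i))) atTop (𝓝 0) := by
        have := (tendsto_iff_norm_sub_tendsto_zero.1 h1).mul_const
          (volume.real (cube (a i) (ℓ i)))
        rwa [zero_mul] at this
      refine squeeze_zero_norm (fun n => ?_) h4
      set m := ⨍ x in H i ∩ {x | ‖b x‖ ≤ n}, b x
      set m' := ⨍ x in H i, b x
      have fPn : volume (cube (a i) (ℓ i) ∩ {x | ‖b x‖ ≤ n}) < ∞ :=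
        (measure_mono Set.inter_subset_left).trans_lt (lt_top_iff_ne_top.2 (fP i))
      have iPn := (iP i).mono_set (Set.inter_subset_left (t := {x | ‖b x‖ ≤ n}))
      rw [hoscn]
      simp only
      have j1 : IntegrableOn (fun y => b y - m) (cube (a i) (ℓ i) ∩ {x | ‖b x‖ ≤ n}) :=
        iPn.sub (integrableOn_const fPn.ne)
      have j2 : IntegrableOn (fun y => b y - m') (cube (a i) (ℓ i) ∩ {x | ‖b x‖ ≤ n}) :=
        iPn.sub (integrableOn_const fPn.ne)
      rw [← integral_sub j1.norm j2.norm]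
      refine (norm_setIntegral_le_of_norm_le_const (C := ‖m - m'‖) fPn fun x _ => ?_).trans ?_
      · rw [Real.norm_eq_abs]
        refine (abs_norm_sub_norm_le _ _).trans ?_
        rw [show b x - m - (b x - m') = -(m - m') by ring, norm_neg]
      · gcongr
        · exact fP i
        · exact Set.inter_subset_left
    have := h3.add h2
    simpa using this
  have main : ENNReal.ofReal (c * ∑ i, τ i ^ θ * osc i) ≤
      ENNReal.ofReal (64 * Cf * B * B) * N * ENNReal.ofReal (∑ i, τ i * ℓ i ^ d) ^ θ := by
    have hl : Tendsto (fun n => ENNReal.ofReal (c * ∑ i, τ i ^ θ * oscn i n)) atTop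
        (𝓝 (ENNReal.ofReal (c * ∑ i, τ i ^ θ * osc i))) :=
      ENNReal.tendsto_ofReal ((tendsto_finsetSum _ fun i _ => (lim i).const_mul _).const_mul _)
    refine le_of_tendsto hl ?_
    filter_upwards [ev1, ev2] with n h1 h2
    exact testing_trunc hp hp' hq hq' ht hT₁ hr hN hb hℓ hτ hKer hH hG mH mG hCf (by positivity)
      oH oG hf n h1 h2 fun i => by linarith [vG i, hld i]
  -- The mean over the companion set is exchanged for the mean over the cube itself, at the cost of
  -- a factor two.
  have le2 : c * ∑ i, τ i ^ θ * ∫ y in cube (a i) (ℓ i), ‖b y - ⨍ x in cube (a i) (ℓ i), b x‖ ≤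
      2 * (c * ∑ i, τ i ^ θ * osc i) := by
    suffices h : ∑ i, τ i ^ θ * ∫ y in cube (a i) (ℓ i), ‖b y - ⨍ x in cube (a i) (ℓ i), b x‖ ≤
        ∑ i, 2 * (τ i ^ θ * osc i) by
      rw [← Finset.mul_sum] at h
      linarith [mul_le_mul_of_nonneg_left h hc]
    refine Finset.sum_le_sum fun i _ => ?_
    have : IsFiniteMeasure ((volume : Measure (Rd d)).restrict (cube (a i) (ℓ i))) :=
      ⟨by rw [Measure.restrict_apply_univ]; exact lt_top_iff_ne_top.2 (fP i)⟩
    have h5 := integral_norm_sub_average_le (μ := volume.restrict (cube (a i) (ℓ i)))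
      (by
        rw [measureReal_restrict_apply_univ, volume_real_cube _ (hℓ i).le]
        exact (hld i).ne') (iP i) (⨍ x in H i, b x)
    have h6 := mul_le_mul_of_nonneg_left h5 (Real.rpow_nonneg (hτ i).le θ)
    simp only [hosc]
    linarith
  calc _ ≤ _ := ENNReal.ofReal_le_ofReal le2
    _ = 2 * ENNReal.ofReal (c * ∑ i, τ i ^ θ * osc i) := by
        rw [ENNReal.ofReal_mul (by norm_num)]
        norm_num
    _ ≤ 2 * (ENNReal.ofReal (64 * Cf * B * B) * N *
        ENNReal.ofReal (∑ i, τ i * ℓ i ^ d) ^ θ) := by gcongr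
    _ = _ := by
        rw [show 128 * Cf * B ^ 2 = 2 * (64 * Cf * B * B) by ring,
          ENNReal.ofReal_mul (p := 2) (by norm_num)]
        norm_num
        ring

end

section

variable {d : ℕ}

/-! ### Stopping cubes -/

/-- The dyadic cell of generation `κ.1` and index `κ.2` of `cube a ℓ`. -/
def dyCell (a : Rd d) (ℓ : ℝ) (κ : ℕ × (Fin d → ℤ)) : Set (Rd d) := gridCell a (ℓ / 2 ^ κ.1) κ.2

/-- The average of `u` over the dyadic cell of generation `k` that contains `x`. -/
def avgAt (u : Rd d → ℝ) (a : Rd d) (ℓ : ℝ) (k : ℕ) (x : Rd d) : ℝ := ⨍ y in dcell a ℓ k x, u y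

/-- The cells on which `u` has average at least `t` for the first time. -/
def IsStop (u : Rd d → ℝ) (a : Rd d) (ℓ t : ℝ) (κ : ℕ × (Fin d → ℤ)) : Prop :=
  ∀ x ∈ dyCell a ℓ κ, t ≤ avgAt u a ℓ κ.1 x ∧ ∀ m < κ.1, avgAt u a ℓ m x < t

open Classical in
/-- The stopping cells of `cube a ℓ` of generation at most `n`. -/
def stops (u : Rd d → ℝ) (a : Rd d) (ℓ : ℝ) (n : ℕ) (t : ℝ) : Finset (ℕ × (Fin d → ℤ)) :=
  ((Finset.range (n + 1)).biUnion fun k => (dyadicIdx d k).image (Prod.mk k)).filter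
    (IsStop u a ℓ t)

/-- The points of `cube a ℓ` at which some average of `u` over a cell of generation at most `n`
is at least `t`. -/
def hitSet (u : Rd d → ℝ) (a : Rd d) (ℓ : ℝ) (n : ℕ) (t : ℝ) : Set (Rd d) :=
  {x | x ∈ cube a ℓ ∧ ∃ k ≤ n, t ≤ avgAt u a ℓ k x}

variable {u : Rd d → ℝ} {a : Rd d} {ℓ t t' : ℝ} {n : ℕ} {κ κ' : ℕ × (Fin d → ℤ)}

lemma mem_dyCell (hℓ : 0 < ℓ) {x : Rd d} :
    x ∈ dyCell a ℓ κ ↔ gridIdx a (ℓ / 2 ^ κ.1) x = κ.2 := mem_gridCell (by positivity)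

lemma measurableSet_dyCell : MeasurableSet (dyCell a ℓ κ) := measurableSet_gridCell _ _ _

lemma volume_real_dyCell (hℓ : 0 < ℓ) : volume.real (dyCell a ℓ κ) = (ℓ / 2 ^ κ.1) ^ d :=
  volume_real_gridCell _ (by positivity) _

lemma volume_dyCell_ne_top (hℓ : 0 < ℓ) : volume (dyCell a ℓ κ) ≠ ∞ :=
  (volume_cube_lt_top _ (by positivity)).ne

lemma dcell_eq_dyCell (hℓ : 0 < ℓ) {x : Rd d} (hx : x ∈ dyCell a ℓ κ) :
    dcell a ℓ κ.1 x = dyCell a ℓ κ := by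
  rw [dcell, (mem_dyCell hℓ).1 hx, dyCell]

lemma avgAt_eq (hℓ : 0 < ℓ) {x y : Rd d} {m k : ℕ} (hmk : m ≤ k)
    (h : gridIdx a (ℓ / 2 ^ k) x = gridIdx a (ℓ / 2 ^ k) y) : avgAt u a ℓ m x = avgAt u a ℓ m y := by
  rw [avgAt, avgAt, dcell, dcell, gridIdx_eq_of_le a hℓ hmk h]

lemma mem_stops : κ ∈ stops u a ℓ n t ↔
    κ.1 ≤ n ∧ κ.2 ∈ dyadicIdx d κ.1 ∧ IsStop u a ℓ t κ := by
  obtain ⟨k, ν⟩ := κ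
  simp only [stops, Finset.mem_filter, Finset.mem_biUnion, Finset.mem_range, Finset.mem_image,
    Prod.mk.injEq]
  constructor
  · rintro ⟨⟨k', h1, ν', h2, rfl, rfl⟩, h3⟩
    exact ⟨by omega, h2, h3⟩
  · rintro ⟨h1, h2, h3⟩
    exact ⟨⟨k, by omega, ν, h2, rfl, rfl⟩, h3⟩

lemma dyCell_subset_cube (hℓ : 0 < ℓ) (hκ : κ ∈ stops u a ℓ n t) :
    dyCell a ℓ κ ⊆ cube a ℓ := fun x hx => by
  rw [← gridIdx_mem_dyadicIdx hℓ (k := κ.1), (mem_dyCell hℓ).1 hx]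
  exact (mem_stops.1 hκ).2.1

/-- All averages before the generation of `κ` are below `t ≤ t'`, so a cell of the higher level
through the same point cannot have stopped earlier. -/
lemma generation_le (hκ : κ ∈ stops u a ℓ n t) (hκ' : κ' ∈ stops u a ℓ n t') (htt : t ≤ t')
    {x : Rd d} (hx : x ∈ dyCell a ℓ κ) (hx' : x ∈ dyCell a ℓ κ') : κ.1 ≤ κ'.1 := by
  by_contra! h
  have h1 := ((mem_stops.1 hκ).2.2 x hx).2 _ h
  have h2 := ((mem_stops.1 hκ').2.2 x hx').1
  linarith

lemma dyCell_subset (hℓ : 0 < ℓ) (hκ : κ ∈ stops u a ℓ n t) (hκ' : κ' ∈ stops u a ℓ n t')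
    (htt : t ≤ t') {x : Rd d} (hx : x ∈ dyCell a ℓ κ) (hx' : x ∈ dyCell a ℓ κ') :
    dyCell a ℓ κ' ⊆ dyCell a ℓ κ := fun y hy => by
  rw [mem_dyCell hℓ] at hx hx' hy ⊢
  rw [← hx]
  exact gridIdx_eq_of_le a hℓ
    (generation_le hκ hκ' htt ((mem_dyCell hℓ).2 hx) ((mem_dyCell hℓ).2 hx')) (hy.trans hx'.symm)

lemma pairwiseDisjoint_stops (hℓ : 0 < ℓ) :
    (stops u a ℓ n t : Set (ℕ × (Fin d → ℤ))).PairwiseDisjoint (dyCell a ℓ) := by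
  intro κ hκ κ' hκ' hne
  refine Set.disjoint_left.2 fun x hx hx' => hne ?_
  have h1 : κ.1 = κ'.1 := le_antisymm (generation_le hκ hκ' le_rfl hx hx')
    (generation_le hκ' hκ le_rfl hx' hx)
  rw [mem_dyCell hℓ] at hx hx'
  refine Prod.ext h1 ?_
  rw [← hx, ← hx', h1]

/-- A point belongs to the cell of the first generation whose average reaches `t`. Averages up to
that generation are constant on this cell, so the whole cell stops. -/
lemma hitSet_eq (hℓ : 0 < ℓ) : hitSet u a ℓ n t = ⋃ κ ∈ stops u a ℓ n t, dyCell a ℓ κ := by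
  classical
  ext x
  simp only [Set.mem_iUnion, exists_prop]
  constructor
  · rintro ⟨hx, hk⟩
    have hk' : ∃ k, t ≤ avgAt u a ℓ k x := hk.imp fun k hk => hk.2
    obtain ⟨k, hkn, hkt⟩ := hk
    have hidx : x ∈ dyCell a ℓ (Nat.find hk', gridIdx a (ℓ / 2 ^ Nat.find hk') x) :=
      (mem_dyCell hℓ).2 rfl
    refine ⟨(Nat.find hk', gridIdx a (ℓ / 2 ^ Nat.find hk') x), mem_stops.2
      ⟨(Nat.find_min' hk' hkt).trans hkn, (gridIdx_mem_dyadicIdx hℓ).2 hx, fun y hy => ?_⟩, hidx⟩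
    have hy' := (mem_dyCell hℓ).1 hy
    refine ⟨?_, fun m hm => ?_⟩
    · rw [avgAt_eq hℓ le_rfl hy']
      exact Nat.find_spec hk'
    · rw [avgAt_eq hℓ hm.le hy']
      exact not_le.1 (Nat.find_min hk' hm)
  · rintro ⟨κ, hκ, hx⟩
    exact ⟨dyCell_subset_cube hℓ hκ hx, κ.1, (mem_stops.1 hκ).1, ((mem_stops.1 hκ).2.2 x hx).1⟩

lemma measurableSet_hitSet (hℓ : 0 < ℓ) : MeasurableSet (hitSet u a ℓ n t) := by
  rw [hitSet_eq hℓ]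
  exact Finset.measurableSet_biUnion _ fun κ _ => measurableSet_dyCell

lemma hitSet_anti (htt : t ≤ t') : hitSet u a ℓ n t' ⊆ hitSet u a ℓ n t :=
  fun _ ⟨hx, k, hk, h⟩ => ⟨hx, k, hk, htt.trans h⟩

lemma sum_indicator_stops (hℓ : 0 < ℓ) (g : ℝ) (x : Rd d) :
    ∑ κ ∈ stops u a ℓ n t, (dyCell a ℓ κ).indicator (fun _ => g) x =
      (hitSet u a ℓ n t).indicator (fun _ => g) x := by
  rw [hitSet_eq hℓ, Finset.indicator_biUnion _ _ (pairwiseDisjoint_stops hℓ)]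

lemma setIntegral_hitSet {E : Type*} [NormedAddCommGroup E] [NormedSpace ℝ E] (hℓ : 0 < ℓ)
    {φ : Rd d → E} (hφ : IntegrableOn φ (cube a ℓ)) :
    ∫ x in hitSet u a ℓ n t, φ x = ∑ κ ∈ stops u a ℓ n t, ∫ x in dyCell a ℓ κ, φ x := by
  rw [hitSet_eq hℓ]
  exact integral_biUnion_finset _ (fun κ _ => measurableSet_dyCell) (pairwiseDisjoint_stops hℓ)
    fun κ hκ => hφ.mono_set (dyCell_subset_cube hℓ hκ)

lemma le_average_dyCell (hℓ : 0 < ℓ) (hκ : κ ∈ stops u a ℓ n t) :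
    t ≤ ⨍ y in dyCell a ℓ κ, u y := by
  have hx : gridPt a (ℓ / 2 ^ κ.1) κ.2 ∈ dyCell a ℓ κ := self_mem_cube _ (by positivity)
  have := ((mem_stops.1 hκ).2.2 _ hx).1
  rwa [avgAt, dcell_eq_dyCell hℓ hx] at this

lemma mul_volume_le_integral (hℓ : 0 < ℓ) (hκ : κ ∈ stops u a ℓ n t) :
    t * volume.real (dyCell a ℓ κ) ≤ ∫ y in dyCell a ℓ κ, u y := by
  have h := le_average_dyCell hℓ hκ
  have h0 : 0 < volume.real (dyCell a ℓ κ) := by rw [volume_real_dyCell hℓ]; positivity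
  rwa [setAverage_eq, smul_eq_mul, inv_mul_eq_div, le_div_iff₀ h0] at h

/-- A child has `2^{-d}` times the volume of its parent and, as `u ≥ 0`, no more mass. -/
lemma avgAt_succ_le (hu : LocallyIntegrable u volume) (hu0 : ∀ x, 0 ≤ u x) (hℓ : 0 < ℓ) (k : ℕ)
    (x : Rd d) : avgAt u a ℓ (k + 1) x ≤ 2 ^ d * avgAt u a ℓ k x := by
  have hk : 0 < ℓ / 2 ^ k := by positivity
  have hk' : 0 < ℓ / 2 ^ (k + 1) := by positivity
  have hsub : dcell a ℓ (k + 1) x ⊆ dcell a ℓ k x := fun y hy => by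
    rw [mem_dcell hℓ] at hy ⊢
    exact gridIdx_eq_of_le a hℓ k.le_succ hy
  have hint : IntegrableOn u (dcell a ℓ k x) := integrableOn_cube hu _ hk
  have h1 : ∫ y in dcell a ℓ (k + 1) x, u y ≤ ∫ y in dcell a ℓ k x, u y :=
    setIntegral_mono_set hint (Eventually.of_forall hu0) (Eventually.of_forall hsub)
  rw [avgAt, avgAt, setAverage_eq, setAverage_eq, smul_eq_mul, smul_eq_mul, dcell, dcell,
    volume_real_gridCell _ hk.le, volume_real_gridCell _ hk'.le]
  have e : ((ℓ / 2 ^ (k + 1)) ^ d)⁻¹ = 2 ^ d * ((ℓ / 2 ^ k) ^ d)⁻¹ := by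
    rw [pow_succ, ← div_div, div_pow _ (2 : ℝ), inv_div, div_eq_mul_inv]
  rw [e, mul_assoc]
  exact mul_le_mul_of_nonneg_left (mul_le_mul_of_nonneg_left h1 (by positivity)) (by positivity)

lemma avgAt_zero (hℓ : 0 < ℓ) {x : Rd d} (hx : x ∈ cube a ℓ) :
    avgAt u a ℓ 0 x = ⨍ y in cube a ℓ, u y := by
  rw [avgAt, dcell, pow_zero, div_one, (gridIdx_eq_zero hℓ).2 hx, gridCell_zero]

lemma avgAt_le_pow (hu : LocallyIntegrable u volume) (hu0 : ∀ x, 0 ≤ u x) (hℓ : 0 < ℓ) (k : ℕ)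
    {x : Rd d} (hx : x ∈ cube a ℓ) : avgAt u a ℓ k x ≤ (2 ^ d) ^ k * ⨍ y in cube a ℓ, u y := by
  induction k with
  | zero => simp [avgAt_zero hℓ hx]
  | succ k ih =>
    refine (avgAt_succ_le hu hu0 hℓ k x).trans ?_
    rw [pow_succ' _ k, mul_assoc]
    gcongr

/-- The parent of a stopping cell still has average below `t`. The whole cube has no parent, which
is why its own average is assumed to be at most `t`. -/
lemma average_dyCell_le (hu : LocallyIntegrable u volume) (hu0 : ∀ x, 0 ≤ u x) (hℓ : 0 < ℓ)
    (ht0 : 0 ≤ t) (ht : ⨍ y in cube a ℓ, u y ≤ t) (hκ : κ ∈ stops u a ℓ n t) :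
    ⨍ y in dyCell a ℓ κ, u y ≤ 2 ^ d * t := by
  have hx : gridPt a (ℓ / 2 ^ κ.1) κ.2 ∈ dyCell a ℓ κ := self_mem_cube _ (by positivity)
  set x := gridPt a (ℓ / 2 ^ κ.1) κ.2
  rw [← dcell_eq_dyCell hℓ hx]
  change avgAt u a ℓ κ.1 x ≤ _
  rcases hk : κ.1 with _ | k
  · rw [avgAt_zero hℓ (dyCell_subset_cube hℓ hκ hx)]
    have : (1 : ℝ) ≤ 2 ^ d := one_le_pow₀ (by norm_num)
    nlinarith
  · refine (avgAt_succ_le hu hu0 hℓ k x).trans ?_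
    gcongr
    exact (((mem_stops.1 hκ).2.2 x hx).2 k (by omega)).le

open Classical in
/-- Inside a stopping cell, the cells of a higher level. -/
lemma setIntegral_dyCell_inter_hitSet {E : Type*} [NormedAddCommGroup E] [NormedSpace ℝ E]
    (hℓ : 0 < ℓ) (hκ : κ ∈ stops u a ℓ n t) (htt : t ≤ t')
    {φ : Rd d → E} (hφ : IntegrableOn φ (cube a ℓ)) :
    ∫ x in dyCell a ℓ κ ∩ hitSet u a ℓ n t', φ x =
      ∑ κ' ∈ stops u a ℓ n t' with dyCell a ℓ κ' ⊆ dyCell a ℓ κ, ∫ x in dyCell a ℓ κ', φ x := by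
  have e : dyCell a ℓ κ ∩ hitSet u a ℓ n t' =
      ⋃ κ' ∈ (stops u a ℓ n t').filter fun κ' => dyCell a ℓ κ' ⊆ dyCell a ℓ κ, dyCell a ℓ κ' := by
    rw [hitSet_eq hℓ]
    ext x
    simp only [Set.mem_inter_iff, Set.mem_iUnion, exists_prop, Finset.mem_filter]
    constructor
    · rintro ⟨hx, κ', hκ', hx'⟩
      exact ⟨κ', ⟨hκ', dyCell_subset hℓ hκ hκ' htt hx hx'⟩, hx'⟩
    · rintro ⟨κ', ⟨hκ', hs⟩, hx'⟩
      exact ⟨hs hx', κ', hκ', hx'⟩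
  rw [e]
  exact integral_biUnion_finset _ (fun κ _ => measurableSet_dyCell)
    ((pairwiseDisjoint_stops (u := u) (n := n) (t := t') hℓ).subset
      fun κ hκ => (Finset.mem_filter.1 hκ).1)
    fun κ hκ => hφ.mono_set (dyCell_subset_cube hℓ (Finset.mem_filter.1 hκ).1)

/-- A localised weak-type bound: the intersection is a disjoint union of cells of level `t'` inside
the given one, each with average at least `t'`. -/
lemma mul_volume_inter_hitSet_le (hu : LocallyIntegrable u volume) (hu0 : ∀ x, 0 ≤ u x)
    (hℓ : 0 < ℓ) (hκ : κ ∈ stops u a ℓ n t) (htt : t ≤ t') :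
    t' * volume.real (dyCell a ℓ κ ∩ hitSet u a ℓ n t') ≤ ∫ x in dyCell a ℓ κ, u x := by
  have hQ := integrableOn_cube hu a hℓ
  classical
  have h1 := setIntegral_dyCell_inter_hitSet hℓ hκ htt (φ := fun _ => (1 : ℝ))
    (integrableOn_const (volume_cube_lt_top _ hℓ.le).ne)
  have h2 := setIntegral_dyCell_inter_hitSet hℓ hκ htt hQ
  simp only [integral_const, measureReal_restrict_apply_univ, smul_eq_mul,
    mul_one] at h1
  rw [h1, Finset.mul_sum]
  refine (Finset.sum_le_sum fun κ' hκ' => mul_volume_le_integral (κ := κ') hℓ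
    (Finset.mem_filter.1 hκ').1).trans (h2.symm.le.trans ?_)
  exact setIntegral_mono_set (hQ.mono_set (dyCell_subset_cube hℓ hκ)) (Eventually.of_forall hu0)
    (Eventually.of_forall Set.inter_subset_left)

/-- The part of a stopping cell that is not covered by cells of a much higher level. -/
lemma volume_sdiff_hitSet_ge (hu : LocallyIntegrable u volume) (hu0 : ∀ x, 0 ≤ u x)
    (hℓ : 0 < ℓ) (ht0 : 0 < t) (ht : ⨍ y in cube a ℓ, u y ≤ t) (hκ : κ ∈ stops u a ℓ n t) :
    (ℓ / 2 ^ κ.1) ^ d / 2 ≤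
      volume.real (dyCell a ℓ κ \ hitSet u a ℓ n (2 ^ (d + 2) * t)) := by
  have h1 : (1 : ℝ) ≤ 2 ^ d := one_le_pow₀ (by norm_num)
  have h2 := mul_volume_inter_hitSet_le hu hu0 hℓ hκ
    (show t ≤ 2 ^ (d + 2) * t by rw [pow_add]; nlinarith)
  have h3 := average_dyCell_le hu hu0 hℓ ht0.le ht hκ
  have h0 : 0 < volume.real (dyCell a ℓ κ) := by rw [volume_real_dyCell hℓ]; positivity
  rw [setAverage_eq, smul_eq_mul, inv_mul_eq_div, div_le_iff₀ h0] at h3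
  have h4 := measureReal_inter_add_sdiff (μ := volume) (s := dyCell a ℓ κ)
    (measurableSet_hitSet (u := u) (a := a) (n := n) (t := 2 ^ (d + 2) * t) hℓ)
    (volume_dyCell_ne_top hℓ)
  rw [← volume_real_dyCell (a := a) hℓ]
  -- The cell has mass at most `2^d t` times its volume, so level `2^{d+2} t` covers at most a
  -- quarter of it.
  have h5 : 2 ^ d * t * (4 * volume.real (dyCell a ℓ κ ∩ hitSet u a ℓ n (2 ^ (d + 2) * t))) ≤
      2 ^ d * t * volume.real (dyCell a ℓ κ) := by
    refine le_trans (le_of_eq ?_) (h2.trans h3)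
    ring
  have h6 := le_of_mul_le_mul_left h5 (by positivity)
  linarith

variable {b : Rd d → ℂ}

/-- The oscillation on a stopping cell controls the next level. -/
lemma mul_volume_inter_hitSet_le_osc (hb : LocallyIntegrable b volume) {c : ℂ}
    (hℓ : 0 < ℓ) (ht0 : 0 < t) (ht : ⨍ y in cube a ℓ, ‖b y - c‖ ≤ t)
    (hκ : κ ∈ stops (fun y => ‖b y - c‖) a ℓ n t) :
    2 ^ (d + 2) * t * volume.real (dyCell a ℓ κ ∩
      hitSet (fun y => ‖b y - c‖) a ℓ n (2 ^ (d + 2) * t)) ≤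
      2 * ∫ y in dyCell a ℓ κ, ‖b y - ⨍ x in dyCell a ℓ κ, b x‖ := by
  set u := fun y => ‖b y - c‖ with hu_def
  have hbc : LocallyIntegrable (fun y => b y - c) volume := hb.sub (locallyIntegrable_const c)
  have hu : LocallyIntegrable u volume := fun x => (hbc x).norm
  have hu0 : ∀ x, 0 ≤ u x := fun x => norm_nonneg _
  have h1 : (1 : ℝ) ≤ 2 ^ d := one_le_pow₀ (by norm_num)
  have htt : t ≤ 2 ^ (d + 2) * t := by rw [pow_add]; nlinarith
  set m := ⨍ x in dyCell a ℓ κ, b x with hm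
  have h0 : 0 < volume.real (dyCell a ℓ κ) := by rw [volume_real_dyCell hℓ]; positivity
  have ik : ∀ κ', IntegrableOn b (dyCell a ℓ κ') := fun κ' =>
    integrableOn_cube hb _ (by positivity)
  have ic : ∀ κ' (m : ℂ), IntegrableOn (fun y => b y - m) (dyCell a ℓ κ') := fun κ' m =>
    (ik κ').sub (integrableOn_const (volume_dyCell_ne_top hℓ))
  have hmc : ‖m - c‖ ≤ 2 ^ d * t := by
    refine le_trans ?_ (average_dyCell_le hu hu0 hℓ ht0.le ht hκ)
    have e : m - c = ⨍ y in dyCell a ℓ κ, (b y - c) := by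
      rw [hm, setAverage_eq, setAverage_eq, integral_sub (ik κ)
        (integrableOn_const (volume_dyCell_ne_top hℓ)), setIntegral_const, smul_sub, smul_smul,
        inv_mul_cancel₀ h0.ne', one_smul]
    rw [e, setAverage_eq, setAverage_eq, norm_smul, norm_inv, Real.norm_of_nonneg h0.le,
      smul_eq_mul]
    gcongr
    exact norm_integral_le_integral_norm _
  -- On such a cell `‖b - c‖` has mean at least `4 · 2^d t`, while `m` is within `2^d t` of `c`.
  -- Hence `‖b - m‖` retains more than half of the mean.
  have key : ∀ κ' ∈ stops u a ℓ n (2 ^ (d + 2) * t),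
      2 ^ (d + 2) * t * volume.real (dyCell a ℓ κ') ≤ 2 * ∫ y in dyCell a ℓ κ', ‖b y - m‖ := by
    intro κ' hκ'
    have h2 := mul_volume_le_integral hℓ hκ'
    have h3 : ∫ y in dyCell a ℓ κ', u y ≤ ∫ y in dyCell a ℓ κ', (‖b y - m‖ + ‖m - c‖) := by
      refine integral_mono (ic κ' c).norm ((ic κ' m).norm.add
        (integrableOn_const (volume_dyCell_ne_top hℓ))) fun y => ?_
      simp only [hu_def]
      rw [show b y - c = (b y - m) + (m - c) by abel]
      exact norm_add_le _ _
    rw [integral_add (ic κ' m).norm (integrableOn_const (volume_dyCell_ne_top hℓ)),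
      setIntegral_const, smul_eq_mul] at h3
    have h4 : volume.real (dyCell a ℓ κ') * ‖m - c‖ ≤ volume.real (dyCell a ℓ κ') * (2 ^ d * t) := by
      gcongr
    have h5 : 0 ≤ volume.real (dyCell a ℓ κ') * (2 ^ d * t) := by positivity
    have h6 : 2 ^ (d + 2) * t * volume.real (dyCell a ℓ κ') =
        4 * (volume.real (dyCell a ℓ κ') * (2 ^ d * t)) := by ring
    linarith
  classical
  have e1 := setIntegral_dyCell_inter_hitSet hℓ hκ htt (φ := fun _ => (1 : ℝ))
    (integrableOn_const (volume_cube_lt_top _ hℓ.le).ne)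
  have hQ : IntegrableOn (fun y => ‖b y - m‖) (cube a ℓ) :=
    ((integrableOn_cube hb a hℓ).sub
      (integrableOn_const (volume_cube_lt_top _ hℓ.le).ne)).norm
  have e2 := setIntegral_dyCell_inter_hitSet hℓ hκ htt hQ
  simp only [integral_const, measureReal_restrict_apply_univ, smul_eq_mul,
    mul_one] at e1
  rw [e1, Finset.mul_sum]
  refine (Finset.sum_le_sum fun κ' hκ' => key κ' (Finset.mem_filter.1 hκ').1).trans ?_
  rw [← Finset.mul_sum, ← e2]
  gcongr
  · exact Eventually.of_forall fun _ => norm_nonneg _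
  · exact (ic κ m).norm
  · exact Set.inter_subset_left

end

section

variable {d : ℕ}

/-! ### Lower bound for the commutator on a cube -/

/-- The levels of the stopping construction. -/
def level (d : ℕ) (a₀ : ℝ) (j : ℕ) : ℝ := a₀ * (2 ^ (d + 2)) ^ j

lemma level_pos {a₀ : ℝ} (h : 0 < a₀) (j : ℕ) : 0 < level d a₀ j := by
  rw [level]; positivity

lemma level_zero (a₀ : ℝ) : level d a₀ 0 = a₀ := by simp [level]

lemma level_succ (a₀ : ℝ) (j : ℕ) : level d a₀ (j + 1) = 2 ^ (d + 2) * level d a₀ j := by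
  rw [level, level]; ring

lemma level_mono {a₀ : ℝ} (h : 0 ≤ a₀) : Monotone (level d a₀) := fun i j hij => by
  rw [level, level]
  gcongr
  exact one_le_pow₀ (by norm_num)

/-- Index set of the stopping cells of levels `0, …, n`. -/
abbrev StopIdx (u : Rd d → ℝ) (a : Rd d) (ℓ : ℝ) (n : ℕ) (a₀ : ℝ) : Type :=
  Σ j : Fin (n + 1), ↥(stops u a ℓ n (level d a₀ j))

section

variable {u : Rd d → ℝ} {a : Rd d} {ℓ : ℝ} {n : ℕ}

lemma sum_stopIdx {E : Type*} [AddCommMonoid E] (a₀ : ℝ) (F : ℕ → ℕ × (Fin d → ℤ) → E) :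
    ∑ i : StopIdx u a ℓ n a₀, F i.1 i.2 =
      ∑ j ∈ Finset.range (n + 1), ∑ κ ∈ stops u a ℓ n (level d a₀ j), F j κ := by
  rw [Fintype.sum_sigma, Finset.sum_range fun j => ∑ κ ∈ stops u a ℓ n (level d a₀ j), F j κ]
  refine Finset.sum_congr rfl fun j _ => ?_
  exact Finset.sum_coe_sort (stops u a ℓ n (level d a₀ j)) (F j)

lemma sum_indicator_stopIdx (hℓ : 0 < ℓ) (a₀ : ℝ) (g : ℕ → ℝ) (x : Rd d) :
    ∑ i : StopIdx u a ℓ n a₀, (dyCell a ℓ i.2).indicator (fun _ => g i.1) x =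
      ∑ j ∈ Finset.range (n + 1), (hitSet u a ℓ n (level d a₀ j)).indicator (fun _ => g j) x := by
  rw [sum_stopIdx a₀ fun j κ => (dyCell a ℓ κ).indicator (fun _ => g j) x]
  exact Finset.sum_congr rfl fun j _ => sum_indicator_stops hℓ (g j) x

lemma sum_indicator_stopIdx_of_notMem (hℓ : 0 < ℓ) (a₀ : ℝ) (g : ℕ → ℝ) {x : Rd d}
    (hx : x ∉ cube a ℓ) :
    ∑ i : StopIdx u a ℓ n a₀, (dyCell a ℓ i.2).indicator (fun _ => g i.1) x = 0 := by
  rw [sum_indicator_stopIdx hℓ]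
  exact Finset.sum_eq_zero fun j _ => Set.indicator_of_notMem (fun h => hx h.1) _

/-- The hit sets decrease with the level, so `x` meets exactly the levels `0, …, m`, and its
averages stay below level `m + 1`. For `m = n` there is no further level to test; there the growth
by at most `2^d` per generation keeps the average of generation `n` below level `n + 1`. -/
lemma exists_top_level (hu : LocallyIntegrable u volume) (hu0 : ∀ x, 0 ≤ u x) (hℓ : 0 < ℓ)
    {a₀ : ℝ} (ha : a₀ = ⨍ y in cube a ℓ, u y) (n : ℕ) {x : Rd d} (hx : x ∈ cube a ℓ) :
    ∃ m ≤ n, avgAt u a ℓ n x ≤ 2 ^ (d + 2) * level d a₀ m ∧ ∀ g : ℕ → ℝ,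
      ∑ i : StopIdx u a ℓ n a₀, (dyCell a ℓ i.2).indicator (fun _ => g i.1) x =
        ∑ j ∈ Finset.range (m + 1), g j := by
  classical
  have ha0 : 0 ≤ a₀ := by
    rw [ha, setAverage_eq, smul_eq_mul]
    exact mul_nonneg (by positivity) (integral_nonneg hu0)
  set P : ℕ → Prop := fun j => x ∈ hitSet u a ℓ n (level d a₀ j) with hP
  have P0 : P 0 := ⟨hx, 0, Nat.zero_le n, by rw [avgAt_zero hℓ hx, level_zero, ha]⟩
  set m := Nat.findGreatest P n with hm
  have hmn : m ≤ n := Nat.findGreatest_le n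
  have hPm : P m := Nat.findGreatest_spec (Nat.zero_le n) P0
  have iff : ∀ j ≤ n, P j ↔ j ≤ m := fun j hj =>
    ⟨fun h => Nat.le_findGreatest hj h, fun h => hitSet_anti (level_mono ha0 h) hPm⟩
  refine ⟨m, hmn, ?_, fun g => ?_⟩
  · rw [← level_succ]
    rcases hmn.lt_or_eq with h | h
    · by_contra! h1
      have : P (m + 1) := ⟨hx, n, le_rfl, h1.le⟩
      have := (iff (m + 1) h).1 this
      omega
    · rw [h]
      refine (avgAt_le_pow hu hu0 hℓ n hx).trans ?_
      rw [← ha, level, mul_comm]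
      gcongr
      calc ((2 : ℝ) ^ d) ^ n ≤ (2 ^ (d + 2)) ^ n := by
            gcongr
            · norm_num
            · omega
        _ ≤ _ := pow_le_pow_right₀ (one_le_pow₀ (by norm_num)) n.le_succ
  · rw [sum_indicator_stopIdx hℓ]
    rw [← Finset.sum_subset (Finset.range_subset_range.2 (Nat.succ_le_succ hmn))]
    · refine Finset.sum_congr rfl fun j hj => ?_
      have hj' : j ≤ m := Nat.lt_succ_iff.1 (Finset.mem_range.1 hj)
      exact Set.indicator_of_mem ((iff j (hj'.trans hmn)).2 hj') _
    · intro j hj hj'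
      rw [Finset.mem_range] at hj hj'
      exact Set.indicator_of_notMem (fun h => hj' (by
        have := (iff j (by omega)).1 h
        omega)) _

lemma sum_range_pow_le {ρ : ℝ} (hρ : 1 < ρ) (m : ℕ) :
    ∑ j ∈ Finset.range (m + 1), ρ ^ j ≤ ρ / (ρ - 1) * ρ ^ m := by
  have h : 0 < ρ - 1 := by linarith
  rw [geom_sum_eq hρ.ne', div_mul_eq_mul_div, ← pow_succ']
  gcongr
  linarith

/-- The ratio of the geometric series that appears in the testing inequality. -/
def ratio (d : ℕ) (σ e : ℝ) : ℝ := (2 ^ (d + 2) : ℝ) ^ (σ * e)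

lemma one_lt_ratio {σ e : ℝ} (hσ : 0 < σ) (he : 0 < e) : 1 < ratio d σ e :=
  Real.one_lt_rpow (one_lt_pow₀ (by norm_num) (by omega)) (by positivity)

/-- The `e`-th powers of the weights of the cells through a point form a geometric progression, so
their sum is comparable to the last term. This is the domination that `testing` requires of the
`f_i`. -/
lemma sum_indicator_stopIdx_rpow_le (hu : LocallyIntegrable u volume) (hu0 : ∀ x, 0 ≤ u x)
    (hℓ : 0 < ℓ) {a₀ : ℝ} (ha : a₀ = ⨍ y in cube a ℓ, u y) (ha0 : 0 < a₀) (n : ℕ) {σ e : ℝ}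
    (hσ : 0 < σ) (he : 0 < e) (x : Rd d) :
    ∑ i : StopIdx u a ℓ n a₀, (dyCell a ℓ i.2).indicator (fun _ => (level d a₀ i.1 ^ σ) ^ e) x ≤
      (ratio d σ e / (ratio d σ e - 1)) * (∑ i : StopIdx u a ℓ n a₀,
        (dyCell a ℓ i.2).indicator (fun _ => level d a₀ i.1 ^ σ) x) ^ e := by
  have hρ := one_lt_ratio (d := d) hσ he
  have hC : 0 ≤ ratio d σ e / (ratio d σ e - 1) := div_nonneg (by linarith) (by linarith)
  by_cases hx : x ∈ cube a ℓ
  · obtain ⟨m, -, -, hm⟩ := exists_top_level hu hu0 hℓ ha n hx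
    rw [hm fun j => level d a₀ j ^ σ, hm fun j => (level d a₀ j ^ σ) ^ e]
    have h1 : ∀ j, (level d a₀ j ^ σ) ^ e = a₀ ^ (σ * e) * ratio d σ e ^ j := by
      intro j
      rw [← Real.rpow_mul (level_pos ha0 j).le, level, Real.mul_rpow ha0.le (by positivity), ratio,
        ← Real.rpow_natCast, ← Real.rpow_mul (by positivity), ← Real.rpow_natCast (_ ^ (σ * e)),
        ← Real.rpow_mul (by positivity), mul_comm (j : ℝ)]
    calc ∑ j ∈ Finset.range (m + 1), (level d a₀ j ^ σ) ^ e
        = a₀ ^ (σ * e) * ∑ j ∈ Finset.range (m + 1), ratio d σ e ^ j := by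
          rw [Finset.mul_sum]
          exact Finset.sum_congr rfl fun j _ => h1 j
      _ ≤ a₀ ^ (σ * e) * (ratio d σ e / (ratio d σ e - 1) * ratio d σ e ^ m) := by
          gcongr
          exact sum_range_pow_le hρ m
      _ = ratio d σ e / (ratio d σ e - 1) * (level d a₀ m ^ σ) ^ e := by
          rw [h1]; ring
      _ ≤ _ := by
          gcongr
          · exact Real.rpow_nonneg (level_pos ha0 m).le σ
          · exact Finset.single_le_sum (f := fun j => level d a₀ j ^ σ)
              (fun j _ => Real.rpow_nonneg (level_pos ha0 j).le σ) (Finset.self_mem_range_succ m)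
  · rw [sum_indicator_stopIdx_of_notMem hℓ a₀ (fun j => (level d a₀ j ^ σ) ^ e) hx,
      sum_indicator_stopIdx_of_notMem hℓ a₀ (fun j => level d a₀ j ^ σ) hx]
    exact mul_nonneg hC (Real.rpow_nonneg le_rfl e)

lemma measurable_avgAt (k : ℕ) : Measurable (avgAt u a ℓ k) := by
  have : avgAt u a ℓ k = (fun ν => ⨍ y in gridCell a (ℓ / 2 ^ k) ν, u y) ∘
      gridIdx a (ℓ / 2 ^ k) := rfl
  rw [this]
  exact (measurable_of_countable _).comp (measurable_gridIdx a)

/-- The dyadic averages are controlled by the stopping cells. -/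
lemma lintegral_avgAt_rpow_le (hu : LocallyIntegrable u volume) (hu0 : ∀ x, 0 ≤ u x) (hℓ : 0 < ℓ)
    {a₀ : ℝ} (ha : a₀ = ⨍ y in cube a ℓ, u y) (ha0 : 0 < a₀) (n : ℕ) {σ : ℝ} (hσ : 0 < σ) :
    ∫⁻ x in cube a ℓ, ENNReal.ofReal (avgAt u a ℓ n x) ^ σ ≤
      ENNReal.ofReal (2 ^ (d + 2)) ^ σ * ENNReal.ofReal
        (∑ i : StopIdx u a ℓ n a₀, level d a₀ i.1 ^ σ * (ℓ / 2 ^ i.2.1.1) ^ d) := by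
  have h1 : ∀ x ∈ cube a ℓ, ENNReal.ofReal (avgAt u a ℓ n x) ^ σ ≤
      ENNReal.ofReal (2 ^ (d + 2)) ^ σ * ENNReal.ofReal (∑ i : StopIdx u a ℓ n a₀,
        (dyCell a ℓ i.2).indicator (fun _ => level d a₀ i.1 ^ σ) x) := by
    intro x hx
    obtain ⟨m, -, hm1, hm⟩ := exists_top_level hu hu0 hℓ ha n hx
    rw [hm fun j => level d a₀ j ^ σ]
    calc ENNReal.ofReal (avgAt u a ℓ n x) ^ σ
        ≤ ENNReal.ofReal (2 ^ (d + 2) * level d a₀ m) ^ σ := by gcongr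
      _ = ENNReal.ofReal (2 ^ (d + 2)) ^ σ * ENNReal.ofReal (level d a₀ m ^ σ) := by
          rw [ENNReal.ofReal_mul (by positivity), ENNReal.mul_rpow_of_nonneg _ _ hσ.le,
            ENNReal.ofReal_rpow_of_pos (level_pos ha0 m)]
      _ ≤ _ := by
          gcongr
          exact Finset.single_le_sum (f := fun j => level d a₀ j ^ σ)
            (fun j _ => Real.rpow_nonneg (level_pos ha0 j).le σ) (Finset.self_mem_range_succ m)
  refine (setLIntegral_mono' (measurableSet_cube a ℓ) h1).trans ?_
  refine (setLIntegral_le_lintegral _ _).trans ?_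
  rw [lintegral_const_mul']
  · gcongr
    exact lintegral_sum_indicator_le (fun i => measurableSet_dyCell)
      (fun i => Real.rpow_nonneg (level_pos ha0 _).le σ) (fun i => by positivity)
      fun i => (volume_cube _ (by positivity)).le
  · exact ENNReal.rpow_ne_top_of_nonneg hσ.le ENNReal.ofReal_ne_top

variable {b : Rd d → ℂ}

/-- The mass of the stopping cells is controlled by the oscillations. -/
lemma sum_level_le (hb : LocallyIntegrable b volume) (hℓ : 0 < ℓ) {c : ℂ}
    (hc : c = ⨍ x in cube a ℓ, b x) {a₀ : ℝ} (ha : a₀ = ⨍ y in cube a ℓ, ‖b y - c‖)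
    (ha0 : 0 < a₀) (n : ℕ) (σ : ℝ) :
    ∑ i : StopIdx (fun y => ‖b y - c‖) a ℓ n a₀, level d a₀ i.1 ^ σ * (ℓ / 2 ^ i.2.1.1) ^ d ≤
      (1 + 2 * (2 ^ (d + 2) : ℝ) ^ (σ - 1)) *
        ∑ i : StopIdx (fun y => ‖b y - c‖) a ℓ n a₀, level d a₀ i.1 ^ (σ - 1) *
          ∫ y in dyCell a ℓ i.2, ‖b y - ⨍ x in dyCell a ℓ i.2, b x‖ := by
  set u := fun y => ‖b y - c‖ with hu_def
  set A : ℝ := 2 ^ (d + 2) with hA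
  have hA0 : 0 < A := by positivity
  have lp := fun j => level_pos (d := d) ha0 j
  have hone : ∀ S : Set (Rd d), IntegrableOn (fun _ => (1 : ℝ)) (cube a ℓ ∩ S) := fun S =>
    (integrableOn_const (volume_cube_lt_top a hℓ.le).ne).mono_set Set.inter_subset_left
  rw [sum_stopIdx a₀ fun j κ => level d a₀ j ^ σ * (ℓ / 2 ^ κ.1) ^ d,
    sum_stopIdx a₀ fun j κ => level d a₀ j ^ (σ - 1) *
          ∫ y in dyCell a ℓ κ, ‖b y - ⨍ x in dyCell a ℓ κ, b x‖]
  set O : ℕ → ℝ := fun j => ∑ κ ∈ stops u a ℓ n (level d a₀ j), level d a₀ j ^ (σ - 1) *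
          ∫ y in dyCell a ℓ κ, ‖b y - ⨍ x in dyCell a ℓ κ, b x‖ with hO
  have O0 : ∀ j, 0 ≤ O j := fun j => Finset.sum_nonneg fun κ _ =>
    mul_nonneg (Real.rpow_nonneg (lp j).le _) (integral_nonneg fun _ => norm_nonneg _)
  have vol : ∀ j, ∑ κ ∈ stops u a ℓ n (level d a₀ j), level d a₀ j ^ σ * (ℓ / 2 ^ κ.1) ^ d =
      level d a₀ j ^ σ * volume.real (hitSet u a ℓ n (level d a₀ j)) := by
    intro j
    have := setIntegral_hitSet (u := u) (a := a) (n := n) (t := level d a₀ j) hℓ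
      (φ := fun _ => (1 : ℝ)) (integrableOn_const (volume_cube_lt_top a hℓ.le).ne)
    simp only [integral_const, measureReal_restrict_apply_univ, smul_eq_mul, mul_one] at this
    rw [this, Finset.mul_sum]
    exact Finset.sum_congr rfl fun κ _ => by rw [volume_real_dyCell hℓ]
  simp_rw [vol]
  have rp : ∀ j, level d a₀ j ^ σ = level d a₀ j ^ (σ - 1) * level d a₀ j := fun j => by
    rw [← Real.rpow_add_one (lp j).ne']
    congr 1
    ring
  -- The whole cube is a stopping cell of level zero and, by the choice of `c` and `a₀`, its
  -- oscillation is exactly `a₀` times its volume.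
  have h0 : level d a₀ 0 ^ σ * volume.real (hitSet u a ℓ n (level d a₀ 0)) ≤ O 0 := by
    have mem : ((0, 0) : ℕ × (Fin d → ℤ)) ∈ stops u a ℓ n (level d a₀ 0) := by
      refine mem_stops.2 ⟨Nat.zero_le n, ?_, fun x hx => ⟨?_, fun m hm => absurd hm (by simp)⟩⟩
      · simp [dyadicIdx, Fintype.mem_piFinset]
      · rw [mem_dyCell hℓ] at hx
        simp only [pow_zero, div_one] at hx
        rw [avgAt_zero hℓ ((gridIdx_eq_zero hℓ).1 hx), level_zero, ha]
    have cell : dyCell a ℓ ((0, 0) : ℕ × (Fin d → ℤ)) = cube a ℓ := by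
      simp [dyCell, gridCell_zero]
    refine le_trans ?_ (Finset.single_le_sum (f := fun κ => level d a₀ 0 ^ (σ - 1) *
      ∫ y in dyCell a ℓ κ, ‖b y - ⨍ x in dyCell a ℓ κ, b x‖) (fun κ _ =>
        mul_nonneg (Real.rpow_nonneg (lp 0).le _) (integral_nonneg fun _ => norm_nonneg _)) mem)
    simp only [cell]
    rw [rp, mul_assoc]
    refine mul_le_mul_of_nonneg_left ?_ (Real.rpow_nonneg (lp 0).le _)
    have hv : 0 < volume.real (cube a ℓ) := by rw [volume_real_cube a hℓ.le]; positivity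
    have e : ∫ y in cube a ℓ, ‖b y - c‖ = a₀ * volume.real (cube a ℓ) := by
      rw [ha, setAverage_eq, smul_eq_mul]
      field_simp
    rw [← hc, e, level_zero]
    gcongr
    · exact (volume_cube_lt_top a hℓ.le).ne
    · exact fun x hx => hx.1
  -- One of the `σ` factors of the level `j + 1` is paid for by the oscillation over the cells of
  -- level `j`; the other `σ - 1` are compared with level `j`.
  have hs : ∀ j, level d a₀ (j + 1) ^ σ * volume.real (hitSet u a ℓ n (level d a₀ (j + 1))) ≤
      2 * A ^ (σ - 1) * O j := by
    intro j
    have h1 : volume.real (hitSet u a ℓ n (level d a₀ (j + 1))) =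
        ∑ κ ∈ stops u a ℓ n (level d a₀ j),
          volume.real (dyCell a ℓ κ ∩ hitSet u a ℓ n (level d a₀ (j + 1))) := by
      have m1 := measurableSet_hitSet (u := u) (a := a) (n := n) (t := level d a₀ (j + 1)) hℓ
      have := setIntegral_hitSet (u := u) (a := a) (n := n) (t := level d a₀ j) hℓ
        (φ := (hitSet u a ℓ n (level d a₀ (j + 1))).indicator fun _ => (1 : ℝ))
        ((integrableOn_const (volume_cube_lt_top a hℓ.le).ne).indicator m1)
      simp only [setIntegral_indicator m1, integral_const, measureReal_restrict_apply_univ,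
        smul_eq_mul, mul_one] at this
      rwa [Set.inter_eq_right.2 (hitSet_anti (level_mono ha0.le j.le_succ))] at this
    rw [h1, Finset.mul_sum, hO]
    simp only
    rw [Finset.mul_sum]
    refine Finset.sum_le_sum fun κ hκ => ?_
    have h2 := mul_volume_inter_hitSet_le_osc hb hℓ (lp j)
      (ha.symm.trans_le ((level_zero (d := d) a₀).symm.trans_le
        (level_mono ha0.le (Nat.zero_le j)))) hκ
    rw [← level_succ] at h2
    rw [rp, mul_assoc]
    have h3 := mul_le_mul_of_nonneg_left h2 (Real.rpow_nonneg (lp (j + 1)).le (σ - 1))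
    refine h3.trans (le_of_eq ?_)
    rw [level_succ, Real.mul_rpow hA0.le (lp j).le]
    ring
  rw [Finset.sum_range_succ']
  have h4 : ∑ j ∈ Finset.range n, O j ≤ ∑ j ∈ Finset.range (n + 1), O j :=
    Finset.sum_le_sum_of_subset_of_nonneg (Finset.range_subset_range.2 n.le_succ) fun j _ _ => O0 j
  have h5 : O 0 ≤ ∑ j ∈ Finset.range (n + 1), O j :=
    Finset.single_le_sum (f := O) (fun j _ => O0 j) (Finset.mem_range.2 n.succ_pos)
  have h6 : ∑ j ∈ Finset.range n, level d a₀ (j + 1) ^ σ *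
      volume.real (hitSet u a ℓ n (level d a₀ (j + 1))) ≤
      2 * A ^ (σ - 1) * ∑ j ∈ Finset.range n, O j := by
    rw [Finset.mul_sum]
    exact Finset.sum_le_sum fun j _ => hs j
  have h7 : 0 ≤ 2 * A ^ (σ - 1) := by positivity
  nlinarith [mul_le_mul_of_nonneg_left h4 h7]

/-- A point of such a set at level `j` avoids the hit set of level `j + 1`, hence all cells of
higher levels; cells of one level are disjoint. -/
lemma disjoint_stopIdx (hℓ : 0 < ℓ) {a₀ : ℝ} (ha0 : 0 < a₀) :
    Pairwise (Function.onFun Disjoint fun i : StopIdx u a ℓ n a₀ =>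
      dyCell a ℓ i.2 \ hitSet u a ℓ n (2 ^ (d + 2) * level d a₀ i.1)) := by
  have lt : ∀ i i' : StopIdx u a ℓ n a₀, ∀ x,
      x ∈ dyCell a ℓ i.2 \ hitSet u a ℓ n (2 ^ (d + 2) * level d a₀ i.1) →
      x ∈ dyCell a ℓ i'.2 \ hitSet u a ℓ n (2 ^ (d + 2) * level d a₀ i'.1) → i'.1 ≤ i.1 := by
    intro i i' x hx hx'
    by_contra! h
    refine hx.2 ?_
    rw [← level_succ]
    refine hitSet_anti (level_mono ha0.le (Nat.succ_le_of_lt h)) ?_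
    rw [hitSet_eq hℓ]
    exact Set.mem_biUnion i'.2.2 hx'.1
  rintro ⟨j, κ, hκ⟩ ⟨j', κ', hκ'⟩ hne
  refine Set.disjoint_left.2 fun x hx hx' => hne ?_
  obtain rfl : j = j' := le_antisymm (lt ⟨j', κ', hκ'⟩ ⟨j, κ, hκ⟩ x hx' hx)
    (lt ⟨j, κ, hκ⟩ ⟨j', κ', hκ'⟩ x hx hx')
  by_cases h : κ = κ'
  · subst h
    rfl
  · exact absurd hx'.1 (Set.disjoint_left.1 (pairwiseDisjoint_stops hℓ hκ hκ' h) hx.1)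

end

end

section

variable {d : ℕ} {T : BilinOp d} {p q r s : ℝ≥0∞} {M₁ : ℝ≥0} {N : ℝ≥0∞} {b : Rd d → ℂ} {Λ : ℕ}
  {c : ℝ}

/-! ### Lower bound for the commutator -/

/-- The constant in the lower bound. -/
def lowerConst (d Λ : ℕ) (p s : ℝ≥0∞) : ℝ :=
  2 ^ (d + 2) * ((1 + 2 * (2 ^ (d + 2) : ℝ) ^ (s.toReal - 1)) *
    (128 * (ratio d s.toReal (p⁻¹).toReal / (ratio d s.toReal (p⁻¹).toReal - 1)) *
      (4 * (4 * Λ + 7) ^ d) ^ 2))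

lemma lowerConst_pos (hp : 1 ≤ p) (hp' : p ≠ ∞) (hs : 1 ≤ s) (hs' : s ≠ ∞) :
    0 < lowerConst d Λ p s := by
  have h1 : 1 < ratio d s.toReal (p⁻¹).toReal := one_lt_ratio
    (ENNReal.toReal_pos (one_pos.trans_le hs).ne' hs')
    (ENNReal.toReal_pos (ENNReal.inv_ne_zero.2 hp') (ENNReal.inv_ne_top.2 (one_pos.trans_le hp).ne'))
  have h2 : 0 < ratio d s.toReal (p⁻¹).toReal / (ratio d s.toReal (p⁻¹).toReal - 1) :=
    div_pos (by linarith) (by linarith)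
  rw [lowerConst]
  positivity

/-- The lower bound on a cube, for the dyadic averages. -/
lemma eLpNorm_avgAt_le (hp : 1 ≤ p) (hp' : p ≠ ∞) (hq : 1 ≤ q) (hq' : q ≠ ∞) (hs : 1 ≤ s)
    (hs' : s ≠ ∞) (hr1 : 1 ≤ r) (hrel : r⁻¹ = s⁻¹ + p⁻¹ + q⁻¹)
    (hT₁ : BoundedBy T p q (hσ p q) M₁)
    (hN : CommBound T b p q r s N) (hb : Measurable b) (hbi : LocallyIntegrable b volume)
    (hK : HasLocalKernels T Λ c) (hc : 0 < c) (a : Rd d) {ℓ : ℝ} (hℓ : 0 < ℓ) {m : ℂ}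
    (hm : m = ⨍ x in cube a ℓ, b x) {a₀ : ℝ} (ha : a₀ = ⨍ y in cube a ℓ, ‖b y - m‖)
    (ha0 : 0 < a₀) (n : ℕ) :
    ENNReal.ofReal c * eLpNorm (avgAt (fun y => ‖b y - m‖) a ℓ n) s (volume.restrict (cube a ℓ)) ≤
      ENNReal.ofReal (lowerConst d Λ p s) * N := by
  set u := fun y => ‖b y - m‖ with hu_def
  set σ := s.toReal with hσd
  set e := (p⁻¹).toReal with he
  have hσ0 : 0 < σ := ENNReal.toReal_pos (one_pos.trans_le hs).ne' hs'
  have he0 : 0 < e := ENNReal.toReal_pos (ENNReal.inv_ne_zero.2 hp')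
    (ENNReal.inv_ne_top.2 (one_pos.trans_le hp).ne')
  have hbc : LocallyIntegrable (fun y => b y - m) volume := hbi.sub (locallyIntegrable_const m)
  have hu : LocallyIntegrable u volume := fun x => (hbc x).norm
  have hu0 : ∀ x, 0 ≤ u x := fun x => norm_nonneg _
  have ht : 1 ≤ hσ p q := one_le_hσ hr1 (by rw [hrel, add_assoc]; exact le_add_self)
  have lp := fun j => level_pos (d := d) ha0 j
  have hconj : ENNReal.HolderConjugate r (ENNReal.conjExponent r) := .conjExponent hr1
  set r' := ENNReal.conjExponent r with hr'
  set S := ∑ i : StopIdx u a ℓ n a₀, level d a₀ i.1 ^ σ * (ℓ / 2 ^ i.2.1.1) ^ d with hS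
  set O := ∑ i : StopIdx u a ℓ n a₀, level d a₀ i.1 ^ (σ - 1) *
          ∫ y in dyCell a ℓ i.2, ‖b y - ⨍ x in dyCell a ℓ i.2, b x‖ with hO
  set ρ := ratio d σ e with hρd
  have hρ : 1 < ρ := one_lt_ratio hσ0 he0
  set Cf := ρ / (ρ - 1) with hCf
  have hCf0 : 0 < Cf := div_pos (by linarith) (by linarith)
  set θ := (p⁻¹).toReal + (q⁻¹).toReal + (r'⁻¹).toReal with hθ
  have fin : ∀ {x : ℝ≥0∞}, 1 ≤ x → x⁻¹ ≠ ∞ := fun h =>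
    ENNReal.inv_ne_top.2 (one_pos.trans_le h).ne'
  -- With `τ = t^s` this gives `τ^θ = t^{s-1}`, precisely the weight of the oscillations in
  -- `sum_level_le`.
  have hθσ : θ = 1 - σ⁻¹ := by
    have h1 : (r⁻¹).toReal + (r'⁻¹).toReal = 1 := by
      rw [← ENNReal.toReal_add (fin hr1) (fin hconj.symm.one_le), hconj.inv_add_inv_eq_one]
      rfl
    have h2 : (r⁻¹).toReal = (s⁻¹).toReal + (p⁻¹).toReal + (q⁻¹).toReal := by
      rw [hrel, ENNReal.toReal_add (ENNReal.add_ne_top.2 ⟨fin hs, fin hp⟩) (fin hq),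
        ENNReal.toReal_add (fin hs) (fin hp)]
    have h3 : (s⁻¹).toReal = σ⁻¹ := ENNReal.toReal_inv s
    linarith
  have hθ0 : 0 ≤ θ := by positivity
  have test := testing (a := fun i : StopIdx u a ℓ n a₀ => gridPt a (ℓ / 2 ^ i.2.1.1) i.2.1.2)
    (ℓ := fun i : StopIdx u a ℓ n a₀ => ℓ / 2 ^ i.2.1.1) (τ := fun i => level d a₀ i.1 ^ σ)
    hp hp' hq hq' ht hT₁ hconj hN hb hbi hK hc.le (fun i => by positivity)
    (fun i => Real.rpow_pos_of_pos (lp _) σ)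
    (fun i => dyCell a ℓ i.2 \ hitSet u a ℓ n (2 ^ (d + 2) * level d a₀ i.1))
    (fun i => Set.sdiff_subset) (fun i => measurableSet_dyCell.diff (measurableSet_hitSet hℓ))
    (disjoint_stopIdx hℓ ha0)
    (fun i => volume_sdiff_hitSet_ge hu hu0 hℓ (lp _) (ha.symm.trans_le
      ((level_zero (d := d) a₀).symm.trans_le (level_mono ha0.le (Nat.zero_le _)))) i.2.2)
    hCf0.le (fun x => sum_indicator_stopIdx_rpow_le hu hu0 hℓ ha ha0 n hσ0 he0 x)
  have eO : ∑ i : StopIdx u a ℓ n a₀, (level d a₀ i.1 ^ σ) ^ θ *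
      ∫ y in dyCell a ℓ i.2, ‖b y - ⨍ x in dyCell a ℓ i.2, b x‖ = O := by
    refine Finset.sum_congr rfl fun i _ => ?_
    rw [← Real.rpow_mul (lp _).le, hθσ, mul_sub, mul_one, mul_inv_cancel₀ hσ0.ne']
  change ENNReal.ofReal (c * ∑ i : StopIdx u a ℓ n a₀, (level d a₀ i.1 ^ σ) ^ θ *
      ∫ y in dyCell a ℓ i.2, ‖b y - ⨍ x in dyCell a ℓ i.2, b x‖) ≤
    ENNReal.ofReal (128 * Cf * (4 * (4 * Λ + 7) ^ d) ^ 2) * N * ENNReal.ofReal S ^ θ at test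
  rw [eO] at test
  have mass : S ≤ (1 + 2 * (2 ^ (d + 2) : ℝ) ^ (σ - 1)) * O := sum_level_le hbi hℓ hm ha ha0 n σ
  set K₁ := 1 + 2 * (2 ^ (d + 2) : ℝ) ^ (σ - 1) with hK₁
  have hK₁0 : 0 < K₁ := by positivity
  set K₂ := 128 * Cf * (4 * (4 * (Λ : ℝ) + 7) ^ d) ^ 2 with hK₂
  have hK₂0 : 0 < K₂ := by positivity
  have hS0 : 0 < S := by
    obtain ⟨i⟩ : Nonempty (StopIdx u a ℓ n a₀) := by
      by_contra h
      rw [not_nonempty_iff] at h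
      obtain ⟨m, -, -, hm⟩ := exists_top_level hu hu0 hℓ ha n (self_mem_cube a hℓ)
      have := hm fun _ => 1
      simp only [Finset.univ_eq_empty, Finset.sum_empty, Finset.sum_const, Finset.card_range,
        nsmul_eq_mul, mul_one] at this
      norm_cast at this
    exact Finset.sum_pos (fun i _ => mul_pos (Real.rpow_pos_of_pos (lp _) σ) (by positivity))
      ⟨i, Finset.mem_univ i⟩
  set W := ENNReal.ofReal S with hW
  have hW0 : W ≠ 0 := (ENNReal.ofReal_pos.2 hS0).ne'
  have hWt : W ≠ ∞ := ENNReal.ofReal_ne_top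
  -- From `c S ≤ K₁ K₂ N S^{1-1/s}` the power of `S` is cancelled. This is legitimate because `S` is
  -- a finite, non-empty sum of positive terms.
  have step : ENNReal.ofReal c * W ^ σ⁻¹ ≤ ENNReal.ofReal (K₁ * K₂) * N := by
    have h1 : ENNReal.ofReal c * W ≤ ENNReal.ofReal K₁ * (ENNReal.ofReal K₂ * N * W ^ θ) := by
      calc ENNReal.ofReal c * W = ENNReal.ofReal (c * S) := (ENNReal.ofReal_mul hc.le).symm
        _ ≤ ENNReal.ofReal (K₁ * (c * O)) := ENNReal.ofReal_le_ofReal (by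
            have := mul_le_mul_of_nonneg_left mass hc.le
            linarith)
        _ = ENNReal.ofReal K₁ * ENNReal.ofReal (c * O) := ENNReal.ofReal_mul hK₁0.le
        _ ≤ _ := by gcongr
    have hWθ : W ^ θ ≠ 0 := (ENNReal.rpow_pos (pos_iff_ne_zero.2 hW0) hWt).ne'
    have hWθ' : W ^ θ ≠ ∞ := ENNReal.rpow_ne_top_of_nonneg hθ0 hWt
    rw [← ENNReal.mul_le_mul_iff_left hWθ hWθ', ENNReal.ofReal_mul hK₁0.le]
    calc ENNReal.ofReal c * W ^ σ⁻¹ * W ^ θ = ENNReal.ofReal c * W := by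
          rw [mul_assoc, ← ENNReal.rpow_add _ _ hW0 hWt, hθσ, add_sub_cancel, ENNReal.rpow_one]
      _ ≤ _ := h1
      _ = _ := by ring
  have hav : eLpNorm (avgAt u a ℓ n) s (volume.restrict (cube a ℓ)) ≤
      ENNReal.ofReal (2 ^ (d + 2)) * W ^ σ⁻¹ := by
    rw [eLpNorm_eq_lintegral_rpow_enorm_toReal (one_pos.trans_le hs).ne' hs', one_div]
    have h1 := lintegral_avgAt_rpow_le (n := n) hu hu0 hℓ ha ha0 hσ0
    have h2 : ∀ x, ‖avgAt u a ℓ n x‖ₑ = ENNReal.ofReal (avgAt u a ℓ n x) := fun x => by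
      refine Real.enorm_of_nonneg ?_
      rw [avgAt, setAverage_eq, smul_eq_mul]
      exact mul_nonneg (by positivity) (integral_nonneg hu0)
    simp_rw [h2]
    calc _ ≤ (ENNReal.ofReal (2 ^ (d + 2)) ^ σ * W) ^ σ⁻¹ := by gcongr
      _ = _ := by
        rw [ENNReal.mul_rpow_of_nonneg _ _ (by positivity), ← ENNReal.rpow_mul,
          mul_inv_cancel₀ hσ0.ne', ENNReal.rpow_one]
  calc _ ≤ ENNReal.ofReal c * (ENNReal.ofReal (2 ^ (d + 2)) * W ^ σ⁻¹) := by gcongr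
    _ = ENNReal.ofReal (2 ^ (d + 2)) * (ENNReal.ofReal c * W ^ σ⁻¹) := by ring
    _ ≤ ENNReal.ofReal (2 ^ (d + 2)) * (ENNReal.ofReal (K₁ * K₂) * N) := by gcongr
    _ = _ := by
        rw [lowerConst, ENNReal.ofReal_mul (p := 2 ^ (d + 2)) (by positivity), mul_assoc]

/-- The lower bound on a cube. -/
lemma eLpNorm_sub_average_cube_le (hp : 1 ≤ p) (hp' : p ≠ ∞) (hq : 1 ≤ q) (hq' : q ≠ ∞)
    (hs : 1 ≤ s) (hs' : s ≠ ∞) (hr1 : 1 ≤ r) (hrel : r⁻¹ = s⁻¹ + p⁻¹ + q⁻¹)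
    (hT₁ : BoundedBy T p q (hσ p q) M₁)
    (hN : CommBound T b p q r s N) (hb : Measurable b) (hbi : LocallyIntegrable b volume)
    (hK : HasLocalKernels T Λ c) (hc : 0 < c) (a : Rd d) {ℓ : ℝ} (hℓ : 0 < ℓ) :
    eLpNorm (fun x => b x - ⨍ y in cube a ℓ, b y) s (volume.restrict (cube a ℓ)) ≤
      ENNReal.ofReal (lowerConst d Λ p s / c) * N := by
  obtain ⟨m, hm⟩ : ∃ m, m = ⨍ x in cube a ℓ, b x := ⟨_, rfl⟩
  obtain ⟨a₀, ha⟩ : ∃ a₀, a₀ = ⨍ y in cube a ℓ, ‖b y - m‖ := ⟨_, rfl⟩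
  rw [← hm]
  have hbc : LocallyIntegrable (fun y => b y - m) volume := hbi.sub (locallyIntegrable_const m)
  have hu : LocallyIntegrable (fun y => ‖b y - m‖) volume := fun x => (hbc x).norm
  have hv : 0 < volume.real (cube a ℓ) := by rw [volume_real_cube a hℓ.le]; positivity
  have ha0 : 0 ≤ a₀ := by
    rw [ha, setAverage_eq, smul_eq_mul]
    exact mul_nonneg (by positivity) (integral_nonneg fun _ => norm_nonneg _)
  -- For `a₀ = 0` all levels would vanish, but then `b` is almost everywhere constant on the cube.
  rcases ha0.eq_or_lt with h0 | h0
  · have h1 : ∫ y in cube a ℓ, ‖b y - m‖ = 0 := by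
      rw [← h0, setAverage_eq, smul_eq_mul] at ha
      exact (mul_eq_zero.1 ha.symm).resolve_left (inv_ne_zero hv.ne')
    rw [integral_eq_zero_iff_of_nonneg (fun _ => norm_nonneg _) (integrableOn_cube hu a hℓ)] at h1
    have h2 : (fun x => b x - m) =ᵐ[volume.restrict (cube a ℓ)] 0 := by
      filter_upwards [h1] with x hx
      exact norm_eq_zero.1 hx
    rw [eLpNorm_congr_ae h2, eLpNorm_zero]
    exact zero_le
  · have hlim : ∀ᵐ x ∂(volume.restrict (cube a ℓ)), Tendsto
        (fun n => avgAt (fun y => ‖b y - m‖) a ℓ n x) atTop (𝓝 ‖b x - m‖) :=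
      ae_restrict_of_ae (ae_tendsto_average_dcell hu a hℓ)
    rw [← eLpNorm_norm]
    refine (Lp.eLpNorm_lim_le_liminf_eLpNorm
      (fun n => (measurable_avgAt n).aestronglyMeasurable) _ hlim).trans ?_
    refine liminf_le_of_frequently_le' (Eventually.of_forall fun n => ?_).frequently
    have := eLpNorm_avgAt_le hp hp' hq hq' hs hs' hr1 hrel hT₁ hN hb hbi hK hc a hℓ hm ha h0 n
    rw [ENNReal.ofReal_div_of_pos hc, ENNReal.mul_comm_div, mul_comm, ENNReal.mul_comm_div,
      ← mul_div_assoc, ENNReal.le_div_iff_mul_le (Or.inl (ENNReal.ofReal_pos.2 hc).ne')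
      (Or.inl ENNReal.ofReal_ne_top), mul_comm]
    rwa [mul_comm N]

/-- On the smallest cube both `b - m 0` and `b - m n` have norm at most `B`, so the averages `m n`
stay bounded. A subsequence converges to some `c`, and Fatou's lemma bounds `b - c` on the whole
space. -/
lemma homLsNorm_le_of_cubes (hs : 1 ≤ s) {B : ℝ≥0∞} (hb : Measurable b)
    (h : ∀ (a : Rd d) (ℓ : ℝ), 0 < ℓ →
      eLpNorm (fun x => b x - ⨍ y in cube a ℓ, b y) s (volume.restrict (cube a ℓ)) ≤ B) :
    homLsNorm b s ≤ B := by
  by_cases hB : B = ∞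
  · rw [hB]; exact le_top
  set Q : ℕ → Set (Rd d) := fun n => cube (WithLp.toLp 2 fun _ => -((n : ℝ) + 1)) (2 * (n + 1))
    with hQ
  set m : ℕ → ℂ := fun n => ⨍ y in Q n, b y with hm
  have hQB : ∀ n, eLpNorm (fun x => b x - m n) s (volume.restrict (Q n)) ≤ B := fun n =>
    h _ _ (by positivity)
  have mQ : ∀ n, MeasurableSet (Q n) := fun n => measurableSet_cube _ _
  have hsub : ∀ n, Q 0 ⊆ Q n := fun n x hx i => by
    have := hx i
    have hn : (0 : ℝ) ≤ n := n.cast_nonneg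
    simp only [Nat.cast_zero] at this
    constructor <;> [linarith [this.1]; linarith [this.2]]
  have hbd : ∀ n, ‖m n - m 0‖ₑ * volume (Q 0) ^ (1 / s.toReal) ≤ 2 * B := by
    intro n
    have h0 : volume.restrict (Q 0) ≠ 0 := by
      rw [Ne, Measure.restrict_eq_zero, hQ]
      simp only
      rw [volume_cube _ (by positivity)]
      exact (ENNReal.ofReal_pos.2 (by positivity)).ne'
    have h1 := eLpNorm_const (m n - m 0) (one_pos.trans_le hs).ne' h0
    rw [Measure.restrict_apply_univ] at h1
    rw [← h1]
    have h2 : (fun _ : Rd d => m n - m 0) = (fun x => b x - m 0) - fun x => b x - m n := by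
      funext x
      simp
    rw [h2, two_mul]
    refine (eLpNorm_sub_le (hb.sub_const _).aestronglyMeasurable
      (hb.sub_const _).aestronglyMeasurable hs).trans (add_le_add (hQB 0) ?_)
    exact (eLpNorm_mono_measure _ (Measure.restrict_mono (hsub n) le_rfl)).trans (hQB n)
  have hV0 : volume (Q 0) ^ (1 / s.toReal) ≠ 0 := by
    refine (ENNReal.rpow_pos ?_ (volume_cube_lt_top _ (by positivity)).ne).ne'
    simp only
    rw [volume_cube _ (by positivity)]
    exact ENNReal.ofReal_pos.2 (by positivity)
  obtain ⟨R, hR⟩ : ∃ R : ℝ, ∀ n, ‖m n - m 0‖ ≤ R := by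
    refine ⟨(2 * B / volume (Q 0) ^ (1 / s.toReal)).toReal, fun n => ?_⟩
    have h1 : ‖m n - m 0‖ₑ ≤ 2 * B / volume (Q 0) ^ (1 / s.toReal) :=
      (ENNReal.le_div_iff_mul_le (Or.inl hV0) (Or.inr (by finiteness))).2 (hbd n)
    rw [← toReal_enorm]
    exact ENNReal.toReal_mono (ENNReal.div_ne_top (by finiteness) hV0) h1
  obtain ⟨c, -, φ, hφ, hc⟩ := tendsto_subseq_of_bounded
    (Metric.isBounded_closedBall (x := m 0) (r := R)) (x := m) fun n => by
      rw [Metric.mem_closedBall, dist_eq_norm]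
      exact hR n
  refine (iInf_le _ c).trans ?_
  refine (Lp.eLpNorm_lim_le_liminf_eLpNorm
    (f := fun n => (Q (φ n)).indicator fun x => b x - m (φ n))
    (fun n => ((hb.sub_const _).indicator (mQ _)).aestronglyMeasurable) _
    (Eventually.of_forall fun x => ?_)).trans ?_
  · refine (tendsto_const_nhds.sub hc).congr' ?_
    filter_upwards [hφ.tendsto_atTop.eventually (exists_mem_cube_nat x)] with n hn
    rw [Set.indicator_of_mem (by exact hn)]
    rfl
  · refine liminf_le_of_frequently_le' (Eventually.of_forall fun n => ?_).frequently
    rw [eLpNorm_indicator_eq_eLpNorm_restrict (mQ _)]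
    exact hQB _

/-- The splitting of `bf` is required to hold everywhere, so a change of `b` on a null set is moved
into `φ`. This permits a Borel representative of `b`. -/
lemma CommBound.congr {b' : Rd d → ℂ} (hN : CommBound T b p q r s N) (hb : b =ᵐ[volume] b') :
    CommBound T b' p q r s N := by
  rintro f g w ⟨v, φ, ψ, u₁, u₂, hv, he, h1, h2, rfl⟩
  have hw : b' * v - (u₁ + u₂) =ᵐ[volume] b * v - (u₁ + u₂) := by
    filter_upwards [hb] with x hx
    simp [hx]
  rw [eLpNorm_congr_ae hw]
  have hφ : φ =ᵐ[volume] b * f - ψ := by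
    filter_upwards [hb] with x hx
    have := congrFun he x
    simp only [Pi.mul_apply, Pi.add_apply, Pi.sub_apply] at this ⊢
    rw [hx, this, add_sub_cancel_right]
  refine hN f g _ ⟨v, b * f - ψ, ψ, u₁, u₂, hv, (sub_add_cancel _ _).symm, ?_, h2, rfl⟩
  obtain ⟨F, G, hF, hG, hl⟩ := h1.approx
  refine ⟨h1.memLp_left.ae_eq hφ, h1.memLp_right, h1.memLp_value, F, G, hF.congr fun n => ?_, hG, hl⟩
  refine eLpNorm_congr_ae ?_
  filter_upwards [hφ] with x hx
  simp [hx]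

/-- The lower bound for the commutator. -/
theorem homLsNorm_le_commNorm (hp : 1 ≤ p) (hp' : p ≠ ∞) (hq : 1 ≤ q) (hq' : q ≠ ∞)
    (hs : 1 ≤ s) (hs' : s ≠ ∞) (hr1 : 1 ≤ r) (hrel : r⁻¹ = s⁻¹ + p⁻¹ + q⁻¹)
    (hT₁ : BoundedBy T p q (hσ p q) M₁) (hbi : LocallyIntegrable b volume)
    (hK : HasLocalKernels T Λ c) (hc : 0 < c) :
    homLsNorm b s ≤ ENNReal.ofReal (lowerConst d Λ p s / c) * commNorm T b p q r s := by
  have hpos : 0 < lowerConst d Λ p s / c := div_pos (lowerConst_pos hp hp' hs hs') hc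
  rw [mul_comm, ← ENNReal.div_le_iff_le_mul (Or.inl (ENNReal.ofReal_pos.2 hpos).ne')
    (Or.inl ENNReal.ofReal_ne_top)]
  refine le_sInf fun N hN => ?_
  rw [ENNReal.div_le_iff_le_mul (Or.inl (ENNReal.ofReal_pos.2 hpos).ne')
    (Or.inl ENNReal.ofReal_ne_top), mul_comm]
  have hm := hbi.aestronglyMeasurable
  set b' := hm.mk b with hb'
  have hbb : b =ᵐ[volume] b' := hm.ae_eq_mk
  have hb'm : Measurable b' := hm.stronglyMeasurable_mk.measurable
  have hb'i : LocallyIntegrable b' volume := hbi.congr hbb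
  have hh : homLsNorm b s = homLsNorm b' s := by
    refine iInf_congr fun c => eLpNorm_congr_ae ?_
    filter_upwards [hbb] with x hx
    rw [hx]
  rw [hh]
  exact homLsNorm_le_of_cubes hs hb'm fun a ℓ hℓ => eLpNorm_sub_average_cube_le hp hp' hq hq' hs hs'
    hr1 hrel hT₁ (CommBound.congr hN hbb) hb'm hb'i hK hc a hℓ

end

section

variable {d : ℕ}

/-! ### Variable kernels -/

/-- Otherwise `ω > η` on `(0, 1]`, and `1 / t` would be integrable there. -/
lemma IsDiniModulus.exists_le {ω : ℝ → ℝ} (hω : IsDiniModulus ω) {η : ℝ} (hη : 0 < η) :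
    ∃ t₀, 0 < t₀ ∧ ∀ t, 0 ≤ t → t ≤ t₀ → ω t ≤ η := by
  suffices h : ∃ t₀, 0 < t₀ ∧ t₀ ≤ 1 ∧ ω t₀ ≤ η by
    obtain ⟨t₀, h0, -, h1⟩ := h
    exact ⟨t₀, h0, fun t ht htt => (hω.mono ht h0.le htt).trans h1⟩
  by_contra! h
  have h1 : IntegrableOn (fun t : ℝ => t⁻¹) (Set.Ioc 0 1) volume := by
    refine (hω.dini.const_mul η⁻¹).mono' measurable_inv.aestronglyMeasurable ?_
    filter_upwards [ae_restrict_mem measurableSet_Ioc] with t ht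
    have := h t ht.1 ht.2
    have ht0 := ht.1
    rw [norm_inv, Real.norm_of_nonneg ht.1.le, inv_eq_one_div, ← mul_div_assoc]
    gcongr
    rw [inv_mul_eq_div, le_div_iff₀ hη]
    linarith
  have h2 : IntervalIntegrable (fun t : ℝ => t⁻¹) volume 0 1 :=
    (intervalIntegrable_iff_integrableOn_Ioc_of_le zero_le_one).2 h1
  rw [intervalIntegrable_inv_iff] at h2
  simp at h2

section

variable {CK : ℝ} {ω : ℝ → ℝ} {K : Rd d → Rd d → Rd d → ℂ}

/-- The regularity of a kernel in all three variables. -/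
lemma IsCZKernel.norm_sub_le (hK : IsCZKernel CK ω K) (hω : IsDiniModulus ω)
    {x y z x' y' z' : Rd d} {δ : ℝ} (hx : ‖x - x'‖ ≤ δ) (hy : ‖y - y'‖ ≤ δ) (hz : ‖z - z'‖ ≤ δ)
    (hD : 0 < ‖x - y‖ + ‖x - z‖) (hδ : 16 * δ ≤ ‖x - y‖ + ‖x - z‖) :
    ‖K x' y' z' - K x y z‖ ≤ 3 * 16 ^ d * ω (4 * δ / (‖x - y‖ + ‖x - z‖)) *
      ((‖x - y‖ + ‖x - z‖) ^ (2 * d))⁻¹ := by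
  set D := ‖x - y‖ + ‖x - z‖ with hDdef
  have hδ0 : 0 ≤ δ := (norm_nonneg _).trans hx
  -- The variables are moved one at a time. Since `16 δ ≤ D`, the separation stays at least `D / 4`,
  -- which costs `4^{2d} = 16^d` in the size factor and a factor `4` in the argument of `ω`.
  have aux : ∀ {G : Rd d → Rd d → Rd d → ℂ} (_ : KernelRegular ω G) {u u' v w : Rd d}
      (_ : ‖u - u'‖ ≤ δ) (_ : D / 4 ≤ ‖u - v‖ + ‖u - w‖),
      ‖G u v w - G u' v w‖ ≤ 16 ^ d * ω (4 * δ / D) * (D ^ (2 * d))⁻¹ := by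
    intro G hG u u' v w hu hv
    set E := ‖u - v‖ + ‖u - w‖ with hE
    have hE0 : 0 < E := lt_of_lt_of_le (by positivity) hv
    have hm : E ≤ 2 * max ‖u - v‖ ‖u - w‖ := by
      linarith [le_max_left ‖u - v‖ ‖u - w‖, le_max_right ‖u - v‖ ‖u - w‖]
    have h1 := hG u u' v w (fun h => hE0.ne' (by simp [hE, h.1, h.2])) (by linarith)
    have h2 : ω (‖u - u'‖ / E) ≤ ω (4 * δ / D) := by
      refine hω.mono (Set.mem_Ici.2 (by positivity)) (Set.mem_Ici.2 (by positivity)) ?_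
      rw [div_le_div_iff₀ hE0 hD]
      nlinarith
    have h3 : 0 ≤ ω (4 * δ / D) := by
      rw [← hω.zero]
      exact hω.mono (Set.mem_Ici.2 le_rfl) (Set.mem_Ici.2 (by positivity)) (by positivity)
    have h4 : (E ^ (2 * d))⁻¹ ≤ 16 ^ d * (D ^ (2 * d))⁻¹ := by
      have : (16 : ℝ) ^ d * (D ^ (2 * d))⁻¹ = ((D / 4) ^ (2 * d))⁻¹ := by
        rw [div_pow, inv_div, pow_mul 4]
        norm_num [div_eq_mul_inv]
      rw [this]
      gcongr
    calc _ ≤ _ := h1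
      _ ≤ ω (4 * δ / D) * (16 ^ d * (D ^ (2 * d))⁻¹) := by gcongr
      _ = _ := by ring
  have s1 := aux hK.reg (v := y) (w := z) hx (by linarith)
  have t1 : ‖x - z‖ ≤ ‖x - y‖ + ‖y - z‖ := norm_sub_le_norm_sub_add_norm_sub x y z
  have t2 : ‖x - y‖ ≤ ‖x - x'‖ + ‖x' - y‖ := norm_sub_le_norm_sub_add_norm_sub x x' y
  have t3 : ‖x - z‖ ≤ ‖x - x'‖ + ‖x' - z‖ := norm_sub_le_norm_sub_add_norm_sub x x' z
  have t4 : ‖x - y‖ ≤ ‖x - z‖ + ‖z - y‖ := norm_sub_le_norm_sub_add_norm_sub x z y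
  have t5 : ‖z - y‖ ≤ ‖z - y'‖ + ‖y' - y‖ := norm_sub_le_norm_sub_add_norm_sub z y' y
  have s2 := aux hK.reg₁ (v := x') (w := z) hy (by
    rw [norm_sub_rev y x']
    linarith [norm_nonneg (y - z)])
  have s3 := aux hK.reg₂ (v := y') (w := x') hz (by
    rw [norm_sub_rev z x']
    rw [norm_sub_rev y' y] at t5
    linarith [norm_nonneg (x' - z), norm_nonneg (z - y')])
  have e : K x' y' z' - K x y z = -(K x y z - K x' y z) - (K x' y z - K x' y' z) -
      (K x' y' z - K x' y' z') := by ring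
  rw [e]
  refine (_root_.norm_sub_le _ _).trans ((add_le_add ((_root_.norm_sub_le _ _).trans
    (add_le_add ((norm_neg _).trans_le s1) s2)) s3).trans (le_of_eq ?_))
  ring

/-- The complement of the diagonal. -/
def offDiag (d : ℕ) : Set (Rd d × Rd d × Rd d) := {w | 0 < ‖w.1 - w.2.1‖ + ‖w.1 - w.2.2‖}

lemma isOpen_offDiag : IsOpen (offDiag d) := isOpen_lt continuous_const (by fun_prop)

/-- Measurability of the kernel is not part of `IsCZKernel`; it comes from continuity off the
diagonal. -/
lemma IsCZKernel.continuousOn (hK : IsCZKernel CK ω K) (hω : IsDiniModulus ω) :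
    ContinuousOn (fun w : Rd d × Rd d × Rd d => K w.1 w.2.1 w.2.2) (offDiag d) := by
  rintro ⟨x, y, z⟩ (hD : 0 < ‖x - y‖ + ‖x - z‖)
  refine ContinuousAt.continuousWithinAt ?_
  rw [Metric.continuousAt_iff]
  intro ε hε
  set D := ‖x - y‖ + ‖x - z‖ with hDdef
  obtain ⟨t₀, ht0, ht⟩ := hω.exists_le (η := ε / (2 * (3 * 16 ^ d * (D ^ (2 * d))⁻¹)))
    (by positivity)
  refine ⟨min (D / 16) (t₀ * D / 4), by positivity, ?_⟩
  rintro ⟨x', y', z'⟩ hw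
  rw [dist_comm, Prod.dist_eq, Prod.dist_eq] at hw
  simp only [dist_eq_norm] at hw ⊢
  set δ := max ‖x - x'‖ (max ‖y - y'‖ ‖z - z'‖) with hδ
  have hδ0 : 0 ≤ δ := (norm_nonneg _).trans (le_max_left _ _)
  have h16 : 16 * δ ≤ D := by linarith [hw.trans_le (min_le_left _ _)]
  have h4 : 4 * δ / D ≤ t₀ := by
    rw [div_le_iff₀ hD]
    linarith [hw.trans_le (min_le_right _ _)]
  have h1 := hK.norm_sub_le hω (δ := δ) (le_max_left _ _)
    ((le_max_left _ _).trans (le_max_right _ _)) ((le_max_right _ _).trans (le_max_right _ _)) hD h16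
  refine h1.trans_lt ?_
  rw [mul_right_comm]
  have h2 := ht _ (by positivity) h4
  have h3 : 0 < 3 * 16 ^ d * (D ^ (2 * d))⁻¹ := by positivity
  calc 3 * 16 ^ d * (D ^ (2 * d))⁻¹ * ω (4 * δ / D) ≤
        3 * 16 ^ d * (D ^ (2 * d))⁻¹ * (ε / (2 * (3 * 16 ^ d * (D ^ (2 * d))⁻¹))) := by gcongr
    _ = ε / 2 := by field_simp
    _ < ε := by linarith

end

/-- Lebesgue differentiation along the dyadic grid of the cube, whose cells through points of the
cube stay inside it. -/
lemma ae_eq_of_cubes {f g : Rd d → ℂ} (hf : LocallyIntegrable f volume)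
    (hg : LocallyIntegrable g volume) {a : Rd d} {ℓ : ℝ} (hℓ : 0 < ℓ)
    (h : ∀ (a' : Rd d) (ℓ' : ℝ), 0 < ℓ' → cube a' ℓ' ⊆ cube a ℓ →
      ∫ x in cube a' ℓ', f x = ∫ x in cube a' ℓ', g x) :
    ∀ᵐ x, x ∈ cube a ℓ → f x = g x := by
  filter_upwards [ae_tendsto_average_dcell hf a hℓ, ae_tendsto_average_dcell hg a hℓ]
    with x h1 h2 hx
  refine tendsto_nhds_unique h1 (h2.congr fun k => ?_)
  rw [setAverage_eq, setAverage_eq]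
  congr 1
  exact (h _ _ (by positivity) (dcell_subset_cube hℓ hx)).symm

/-- A kernel that is close to a constant on a product of three cubes is a local kernel. -/
lemma localKernel_of_pointwise {T : BilinOp d} (hT : MapsToLocInt T)
    {K : Rd d × Rd d × Rd d → ℂ} (hK : Measurable K) {aX aY aZ : Rd d} {ℓ c : ℝ} (hℓ : 0 < ℓ)
    {K₀ : ℂ} (hK₀ : ∀ x ∈ cube aX ℓ, ∀ y ∈ cube aY ℓ, ∀ z ∈ cube aZ ℓ,
      ‖K (x, y, z) - K₀‖ ≤ ‖K₀‖ / 128)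
    (hrepr : ∀ F G g : Sig d, (∀ y ∉ cube aY ℓ, (F : Rd d → ℂ) y = 0) →
      (∀ z ∉ cube aZ ℓ, (G : Rd d → ℂ) z = 0) → (∀ x ∉ cube aX ℓ, (g : Rd d → ℂ) x = 0) →
      ∫ x, T F G x * (g : Rd d → ℂ) x = ∫ x, ∫ z, ∫ y,
        K (x, y, z) * (F : Rd d → ℂ) y * (G : Rd d → ℂ) z * (g : Rd d → ℂ) x)
    (hc : c ≤ ‖K₀‖ * ℓ ^ (2 * d)) :
    LocalKernel T (cube aX ℓ) (cube aY ℓ) (cube aZ ℓ) ℓ c K K₀ := by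
  have ptw : ∀ x ∈ cube aX ℓ, ∀ y ∈ cube aY ℓ, ∀ z ∈ cube aZ ℓ,
      ‖K (x, y, z) - K₀‖ₑ ≤ ENNReal.ofReal (‖K₀‖ / 128) := fun x hx y hy z hz => by
    rw [← ofReal_norm]
    exact ENNReal.ofReal_le_ofReal (hK₀ x hx y hy z hz)
  have vprod : ENNReal.ofReal (‖K₀‖ / 128) * (ENNReal.ofReal (ℓ ^ d) * ENNReal.ofReal (ℓ ^ d)) =
      ENNReal.ofReal (‖K₀‖ * ℓ ^ (2 * d) / 128) := by
    rw [← ENNReal.ofReal_mul (by positivity), ← ENNReal.ofReal_mul (by positivity)]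
    congr 1
    ring
  have vYZ : volume (cube aY ℓ ×ˢ cube aZ ℓ) = ENNReal.ofReal (ℓ ^ d) * ENNReal.ofReal (ℓ ^ d) := by
    rw [Measure.volume_eq_prod, Measure.prod_prod, volume_cube _ hℓ.le, volume_cube _ hℓ.le]
  have mYZ : MeasurableSet (cube aY ℓ ×ˢ cube aZ ℓ) :=
    (measurableSet_cube _ _).prod (measurableSet_cube _ _)
  refine ⟨hK, fun F G hF hG => ?_, fun x hx => ?_, fun y hy => ?_, hc⟩
  · set H : Rd d → Rd d × Rd d → ℂ := fun x w => K (x, w) * (F : Rd d → ℂ) w.1 * (G : Rd d → ℂ) w.2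
      with hH
    have mH : Measurable (Function.uncurry H) := by
      have h1 := Sig_measurable F
      have h2 := Sig_measurable G
      refine (Measurable.mul ?_ ?_).mul ?_
      · exact hK
      · exact h1.comp (measurable_fst.comp measurable_snd)
      · exact h2.comp (measurable_snd.comp measurable_snd)
    have H0 : ∀ x, ∀ w ∉ cube aY ℓ ×ˢ cube aZ ℓ, H x w = 0 := by
      intro x w hw
      by_cases h1 : w.1 ∈ cube aY ℓ
      · simp [hH, hG w.2 fun h2 => hw ⟨h1, h2⟩]
      · simp [hH, hF _ h1]
    have iFG : Integrable (fun w : Rd d × Rd d => ‖(F : Rd d → ℂ) w.1‖ * ‖(G : Rd d → ℂ) w.2‖)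
        volume := by
      have h1 := memLp_one_iff_integrable.1 (Sig_memLp F 1)
      have h2 := memLp_one_iff_integrable.1 (Sig_memLp G 1)
      exact h1.norm.mul_prod h2.norm
    have Hb : ∀ x ∈ cube aX ℓ, ∀ w, ‖H x w‖ ≤
        2 * ‖K₀‖ * (‖(F : Rd d → ℂ) w.1‖ * ‖(G : Rd d → ℂ) w.2‖) := by
      intro x hx w
      by_cases hw : w ∈ cube aY ℓ ×ˢ cube aZ ℓ
      · have h1 := hK₀ x hx w.1 hw.1 w.2 hw.2
        have h2 : ‖K (x, w)‖ ≤ 2 * ‖K₀‖ := by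
          have := norm_le_norm_add_norm_sub' (K (x, w)) K₀
          linarith [norm_nonneg K₀]
        simp only [hH, norm_mul]
        rw [mul_assoc]
        gcongr
      · rw [H0 x w hw, norm_zero]
        positivity
    have iH : ∀ x ∈ cube aX ℓ, Integrable (H x) volume := fun x hx =>
      (iFG.const_mul _).mono' (mH.comp measurable_prodMk_left).aestronglyMeasurable
        (Eventually.of_forall (Hb x hx))
    set Φ : Rd d → ℂ := (cube aX ℓ).indicator fun x => ∫ w, H x w with hΦ
    have mΦ : StronglyMeasurable Φ :=
      (mH.stronglyMeasurable.integral_prod_right (ν := volume)).indicator (measurableSet_cube _ _)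
    have iΦ : Integrable Φ volume := by
      refine Integrable.mono' (g := (cube aX ℓ).indicator fun _ =>
        2 * ‖K₀‖ * ∫ w : Rd d × Rd d, (‖(F : Rd d → ℂ) w.1‖ * ‖(G : Rd d → ℂ) w.2‖))
        ((integrableOn_const (volume_cube_lt_top _ hℓ.le).ne).integrable_indicator
          (measurableSet_cube _ _)) mΦ.aestronglyMeasurable (Eventually.of_forall fun x => ?_)
      by_cases hx : x ∈ cube aX ℓ
      · simp only [hΦ, Set.indicator_of_mem hx]
        rw [← integral_const_mul]
        exact norm_integral_le_of_norm_le (iFG.const_mul _) (Eventually.of_forall (Hb x hx))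
      · simp [hΦ, hx]
    -- The representation is known only in integrated form; testing it on all subcubes of `X` makes
    -- it pointwise.
    have := ae_eq_of_cubes (hT F G) iΦ.locallyIntegrable hℓ (a := aX) fun a' ℓ' hℓ' hsub => by
      have h1 := hrepr F G ⟨_, indicator_cube_mem_Sig a' hℓ'⟩ hF hG fun x hx =>
        Set.indicator_of_notMem (fun h => hx (hsub h)) (fun _ => (1 : ℂ))
      have e1 : ∀ x, T F G x * (cube a' ℓ').indicator (fun _ => (1 : ℂ)) x =
          (cube a' ℓ').indicator (fun x => T F G x) x := fun x => by
        by_cases hx : x ∈ cube a' ℓ' <;> simp [hx]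
      have e2 : ∀ x, ∫ z, ∫ y, K (x, y, z) * (F : Rd d → ℂ) y * (G : Rd d → ℂ) z *
          (cube a' ℓ').indicator (fun _ => (1 : ℂ)) x = (cube a' ℓ').indicator Φ x := by
        intro x
        by_cases hx : x ∈ cube a' ℓ'
        · have h2 := integral_prod_symm (μ := volume) (ν := volume) _ (iH x (hsub hx))
          rw [← Measure.volume_eq_prod] at h2
          simp only [Set.indicator_of_mem hx, mul_one, hΦ, Set.indicator_of_mem (hsub hx)]
          rw [h2]
        · simp [hx]
      simp only [e1, e2] at h1
      rwa [integral_indicator (measurableSet_cube _ _),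
        integral_indicator (measurableSet_cube _ _)] at h1
    filter_upwards [this] with x hx hxX
    rw [hx hxX, hΦ, Set.indicator_of_mem hxX,
      setIntegral_eq_integral_of_forall_compl_eq_zero fun w hw => H0 x w hw]
  · calc _ ≤ ∫⁻ _ in cube aY ℓ ×ˢ cube aZ ℓ, ENNReal.ofReal (‖K₀‖ / 128) :=
          setLIntegral_mono' mYZ fun w hw => ptw x hx w.1 hw.1 w.2 hw.2
      _ = _ := by rw [setLIntegral_const, vYZ, vprod]
  · calc _ ≤ ∫⁻ _ in cube aX ℓ, ∫⁻ _ in cube aZ ℓ, ENNReal.ofReal (‖K₀‖ / 128) :=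
          setLIntegral_mono' (measurableSet_cube _ _) fun x hx =>
            setLIntegral_mono' (measurableSet_cube _ _) fun z hz => ptw x hx y hy z hz
      _ = _ := by
          rw [setLIntegral_const, setLIntegral_const, volume_cube _ hℓ.le, volume_cube _ hℓ.le,
            mul_assoc, vprod]

end

/-! ### Companion cubes for variable kernels -/

section

variable {d : ℕ}

lemma abs_gridIdx_le {a : Rd d} {ℓ R : ℝ} (hℓ : 0 < ℓ) {x : Rd d} (h : ‖x - a‖ ≤ R * ℓ)
    (i : Fin d) : |gridIdx a ℓ x i| ≤ ((⌈R⌉₊ + 1 : ℕ) : ℤ) := by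
  have h1 : |x i - a i| ≤ R * ℓ := by
    have := PiLp.norm_apply_le (x - a) i
    rw [Real.norm_eq_abs, PiLp.sub_apply] at this
    exact this.trans h
  have h2 : |(x i - a i) / ℓ| ≤ ⌈R⌉₊ := by
    rw [abs_div, abs_of_pos hℓ, div_le_iff₀ hℓ]
    exact h1.trans (by gcongr; exact Nat.le_ceil R)
  rw [abs_le] at h2 ⊢
  simp only [gridIdx]
  push_cast
  constructor
  · rw [Int.le_floor]
    push_cast
    linarith
  · have : ⌊(x i - a i) / ℓ⌋ ≤ (⌈R⌉₊ : ℤ) := by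
      have := Int.floor_le_floor h2.2
      rwa [Int.floor_natCast] at this
    omega

lemma tsupport_subset_closedBall {a : Rd d} {ℓ : ℝ} (hℓ : 0 ≤ ℓ) {x : Rd d} (hx : x ∈ cube a ℓ)
    {f : Rd d → ℂ} (hf : ∀ y ∉ cube a ℓ, f y = 0) :
    tsupport f ⊆ Metric.closedBall x (√d * ℓ) :=
  (closure_mono (Function.support_subset_iff'.2 hf)).trans (closure_cube_subset_closedBall hℓ hx)

/-- Non-degenerate operators with a variable kernel have local kernels. -/
theorem exists_hasLocalKernels_of_variable (hd : 0 < d) {CK c₀ : ℝ} {ω : ℝ → ℝ} (hc₀ : 0 < c₀)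
    (hω : IsDiniModulus ω) : ∃ (Λ : ℕ) (c : ℝ), 0 < c ∧ ∀ T : BilinOp d,
      IsNondegVariableSIO CK c₀ ω T → HasLocalKernels T Λ c := by
  -- As `384 = 3 · 128`, the factor `3 · 16^d` from `IsCZKernel.norm_sub_le` cancels and the
  -- relative error `1 / 128` remains.
  obtain ⟨t₀, ht0, ht⟩ := hω.exists_le (η := c₀ / (384 * 16 ^ d)) (by positivity)
  -- Non-degeneracy is used at scale `A ℓ`. For cubes of diameter at most `δ = √d ℓ`, the first term
  -- ensures `16 δ ≤ D` and the second `4 δ / D ≤ t₀`.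
  set A : ℝ := 16 * √d + 4 * √d / t₀ + 1 with hA
  have hA0 : 0 < A := by positivity
  have hA1 : 16 * √d ≤ A := by
    have : 0 ≤ 4 * √d / t₀ := by positivity
    linarith
  have hA2 : 4 * √d ≤ t₀ * A := by
    rw [← div_le_iff₀' ht0]
    have : 0 ≤ 16 * √d := by positivity
    linarith
  set κ : ℝ := max 1 (CK / c₀) with hκ
  have hκ1 : 1 ≤ κ := le_max_left _ _
  refine ⟨⌈κ * A⌉₊ + 1, c₀ * (A ^ (2 * d))⁻¹, by positivity, ?_⟩
  rintro T ⟨K, hK, hN, hT⟩ a ℓ hℓ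
  obtain ⟨x₀, z₀, h1, h2⟩ := hN.fst a (A * ℓ) (by positivity)
  set D := ‖x₀ - a‖ + ‖x₀ - z₀‖ with hD
  have hDA : A * ℓ < D := by
    refine h1.trans_le (max_le (by linarith [norm_nonneg (x₀ - z₀)])
      (max_le (by linarith [norm_nonneg (x₀ - a)]) ?_))
    rw [hD, norm_sub_rev x₀ a]
    exact norm_sub_le_norm_sub_add_norm_sub a x₀ z₀
  have hD0 : 0 < D := lt_trans (by positivity) hDA
  -- Size bound and lower bound together give `D^{2d} ≤ (CK / c₀) (A ℓ)^{2d}`. Because `κ ≥ 1`, also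
  -- `κ ≤ κ^{2d}`, and no root has to be taken.
  have hDκ : D ≤ κ * A * ℓ := by
    have h3 := h2.trans (hK.size x₀ a z₀ fun h => hD0.ne' (by simp [hD, h.1, h.2]))
    rw [← div_eq_mul_inv, ← div_eq_mul_inv, div_le_div_iff₀ (by positivity) (by positivity)] at h3
    by_contra! h4
    have h5 : (κ * A * ℓ) ^ (2 * d) < D ^ (2 * d) :=
      pow_lt_pow_left₀ h4 (by positivity) (by omega)
    have h6 : κ ≤ κ ^ (2 * d) := le_self_pow₀ hκ1 (by omega)
    have h7 : CK ≤ κ * c₀ := by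
      rw [← div_le_iff₀ hc₀]
      exact le_max_right _ _
    have h8 : 0 < (A * ℓ) ^ (2 * d) := by positivity
    rw [mul_assoc, mul_pow] at h5
    have h9 : κ * (A * ℓ) ^ (2 * d) ≤ κ ^ (2 * d) * (A * ℓ) ^ (2 * d) := by gcongr
    have h10 : c₀ * (κ * (A * ℓ) ^ (2 * d)) < c₀ * D ^ (2 * d) := by
      gcongr
      exact h9.trans_lt h5
    have h11 : CK * (A * ℓ) ^ (2 * d) ≤ κ * c₀ * (A * ℓ) ^ (2 * d) := by gcongr
    linarith
  set δ := √d * ℓ with hδ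
  have hδD : 16 * δ ≤ D := by
    have : 16 * √d * ℓ ≤ A * ℓ := by gcongr
    linarith
  -- The values of the kernel on the diagonal are arbitrary; setting them to zero makes it Borel.
  refine ⟨gridIdx a ℓ x₀, gridIdx a ℓ z₀, abs_gridIdx_le hℓ ?_, abs_gridIdx_le hℓ ?_,
    (offDiag d).indicator fun w => K w.1 w.2.1 w.2.2, K x₀ a z₀, ?_⟩
  · linarith [norm_nonneg (x₀ - z₀)]
  · have := norm_sub_le_norm_sub_add_norm_sub z₀ x₀ a
    rw [norm_sub_rev z₀ x₀] at this
    linarith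
  have hx₀ : x₀ ∈ gridCell a ℓ (gridIdx a ℓ x₀) := mem_gridCell_gridIdx a hℓ x₀
  have hz₀ : z₀ ∈ gridCell a ℓ (gridIdx a ℓ z₀) := mem_gridCell_gridIdx a hℓ z₀
  have ha : a ∈ cube a ℓ := self_mem_cube a hℓ
  have near : ∀ {x y z : Rd d}, ‖x₀ - x‖ ≤ δ → ‖a - y‖ ≤ δ → ‖z₀ - z‖ ≤ δ →
      0 < ‖x - y‖ + ‖x - z‖ := by
    intro x y z hx hy hz
    have t1 := norm_sub_le_norm_sub_add_norm_sub x₀ x a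
    have t2 := norm_sub_le_norm_sub_add_norm_sub x y a
    have t3 := norm_sub_le_norm_sub_add_norm_sub x₀ x z₀
    have t4 := norm_sub_le_norm_sub_add_norm_sub x z z₀
    rw [norm_sub_rev y a] at t2
    rw [norm_sub_rev z z₀] at t4
    have : 0 ≤ δ := (norm_nonneg _).trans hx
    linarith
  have inOff : ∀ x ∈ gridCell a ℓ (gridIdx a ℓ x₀), ∀ y ∈ cube a ℓ,
      ∀ z ∈ gridCell a ℓ (gridIdx a ℓ z₀), (x, y, z) ∈ offDiag d := fun x hx y hy z hz =>
    near (norm_sub_le_of_mem_cube hℓ.le hx₀ hx) (norm_sub_le_of_mem_cube hℓ.le ha hy)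
      (norm_sub_le_of_mem_cube hℓ.le hz₀ hz)
  refine localKernel_of_pointwise hT.locInt ?_ hℓ (fun x hx y hy z hz => ?_)
    (fun F G g hF hG hg => ?_) ?_
  · classical
    rw [← Set.piecewise_eq_indicator]
    exact (hK.continuousOn hω).measurable_piecewise continuousOn_const
      isOpen_offDiag.measurableSet
  · rw [Set.indicator_of_mem (inOff x hx y hy z hz)]
    refine (hK.norm_sub_le hω (δ := δ) (norm_sub_le_of_mem_cube hℓ.le hx₀ hx)
      (norm_sub_le_of_mem_cube hℓ.le ha hy) (norm_sub_le_of_mem_cube hℓ.le hz₀ hz) hD0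
      hδD).trans ?_
    have h3 : ω (4 * δ / D) ≤ c₀ / (384 * 16 ^ d) := by
      refine ht _ (by positivity) ?_
      rw [div_le_iff₀ hD0]
      calc 4 * δ = 4 * √d * ℓ := by ring
        _ ≤ t₀ * A * ℓ := by gcongr
        _ = t₀ * (A * ℓ) := by ring
        _ ≤ t₀ * D := by gcongr
    calc 3 * 16 ^ d * ω (4 * δ / D) * (D ^ (2 * d))⁻¹
        ≤ 3 * 16 ^ d * (c₀ / (384 * 16 ^ d)) * ((A * ℓ) ^ (2 * d))⁻¹ := by gcongr
      _ = c₀ * ((A * ℓ) ^ (2 * d))⁻¹ / 128 := by field_simp; norm_num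
      _ ≤ _ := by gcongr
  · rw [hT.repr F G g ?_]
    · refine integral_congr_ae (Eventually.of_forall fun x => ?_)
      simp only
      by_cases hx : x ∈ gridCell a ℓ (gridIdx a ℓ x₀)
      · congr 1
        funext z
        congr 1
        funext y
        by_cases hy : y ∈ cube a ℓ
        · by_cases hz : z ∈ gridCell a ℓ (gridIdx a ℓ z₀)
          · rw [Set.indicator_of_mem (inOff x hx y hy z hz)]
          · rw [hG z hz]
            simp
        · rw [hF y hy]
          simp
      · simp [hg x hx]
    · rw [Set.eq_empty_iff_forall_notMem]
      rintro w ⟨⟨hw1, hw2⟩, hw3⟩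
      have e1 := tsupport_subset_closedBall hℓ.le ha hF hw1
      have e2 := tsupport_subset_closedBall hℓ.le hz₀ hG hw2
      have e3 := tsupport_subset_closedBall hℓ.le hx₀ hg hw3
      rw [Metric.mem_closedBall, dist_comm, dist_eq_norm] at e1 e2 e3
      have := near e3 e1 e2
      simp at this
  · calc c₀ * (A ^ (2 * d))⁻¹ = c₀ * ((A * ℓ) ^ (2 * d))⁻¹ * ℓ ^ (2 * d) := by
          rw [mul_pow]
          field_simp
      _ ≤ _ := by gcongr

end

section

/-! ### Homogeneous kernels -/

lemma lintegral_polar {E : Type*} [NormedAddCommGroup E] [NormedSpace ℝ E] [MeasurableSpace E]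
    [BorelSpace E] [FiniteDimensional ℝ E] (μ : Measure E) [μ.IsAddHaarMeasure] {f : E → ℝ≥0∞}
    (hf : Measurable f) :
    ∫⁻ x in {0}ᶜ, f x ∂μ = ∫⁻ θ : Metric.sphere (0 : E) 1, ∫⁻ t : Set.Ioi (0 : ℝ),
      f (t.1 • θ.1) ∂(Measure.volumeIoiPow (Module.finrank ℝ E - 1)) ∂μ.toSphere := by
  have hm : Measurable fun w : Metric.sphere (0 : E) 1 × Set.Ioi (0 : ℝ) => f (w.2.1 • w.1.1) :=
    hf.comp (by fun_prop)
  rw [← lintegral_subtype_comap (measurableSet_singleton (0 : E)).compl,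
    ← lintegral_prod _ hm.aemeasurable,
    ← (Measure.measurePreserving_homeomorphUnitSphereProd μ).lintegral_comp hm]
  refine lintegral_congr fun x => ?_
  have hx : ‖(x : E)‖ ≠ 0 := norm_ne_zero_iff.2 x.2
  congr 1
  simp [smul_smul, mul_inv_cancel₀ hx]

variable {d : ℕ}

lemma finrank_Rdd : Module.finrank ℝ (Rdd d) = 2 * d := by
  rw [(WithLp.linearEquiv 2 ℝ (Rd d × Rd d)).finrank_eq, Module.finrank_prod]
  simp
  ring

/-- In polar coordinates, the cone over a null set of the sphere is a null set. -/
lemma ae_sphere_direction {A B : Rdd d → ℂ}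
    (h : ∀ᵐ θ : Metric.sphere (0 : Rdd d) 1 ∂sphereMeasure d, A θ = B θ) :
    ∀ᵐ v : Rdd d, v ≠ 0 → A (‖v‖⁻¹ • v) = B (‖v‖⁻¹ • v) := by
  have q := Measure.quasiMeasurePreserving_fst.comp
    (Measure.measurePreserving_homeomorphUnitSphereProd
      (volume : Measure (Rdd d))).quasiMeasurePreserving
  have h1 := q.ae h
  have hm : MeasurableSet ({0}ᶜ : Set (Rdd d)) := (measurableSet_singleton 0).compl
  have h2 : ∀ᵐ v ∂(volume : Measure (Rdd d)).restrict {0}ᶜ, A (‖v‖⁻¹ • v) = B (‖v‖⁻¹ • v) := by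
    rw [ae_restrict_iff_subtype hm]
    filter_upwards [h1] with v hv
    simpa using hv
  rwa [ae_restrict_iff' hm] at h2

/-- The homogeneous kernel `Ω(h / |h|) / |h|^{2d}`. -/
def homKernel (Ω : Rdd d → ℂ) (h : Rdd d) : ℂ := Ω (‖h‖⁻¹ • h) / ((‖h‖ ^ (2 * d) : ℝ) : ℂ)

lemma roughKernel_eq (Ω : Rdd d → ℂ) (x y z : Rd d) :
    roughKernel Ω x y z = homKernel Ω (WithLp.toLp 2 (x - y, x - z)) := rfl

lemma measurable_homKernel {Ω : Rdd d → ℂ} (hΩ : Measurable Ω) : Measurable (homKernel Ω) := by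
  unfold homKernel
  fun_prop

lemma homKernel_zero (hd : 0 < d) (Ω : Rdd d → ℂ) : homKernel Ω 0 = 0 := by
  simp [homKernel, hd.ne']

lemma homKernel_smul (Ω : Rdd d → ℂ) {t : ℝ} (ht : 0 < t) (h : Rdd d) :
    homKernel Ω (t • h) = (((t ^ (2 * d))⁻¹ : ℝ) : ℂ) * homKernel Ω h := by
  have e : ‖t • h‖⁻¹ • t • h = ‖h‖⁻¹ • h := by
    rw [norm_smul, Real.norm_of_nonneg ht.le, smul_smul, mul_inv, mul_right_comm,
      inv_mul_cancel₀ ht.ne', one_mul]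
  rw [homKernel, homKernel, e, norm_smul, Real.norm_of_nonneg ht.le, mul_pow]
  push_cast
  rw [div_eq_mul_inv, div_eq_mul_inv, mul_inv]
  ring

lemma homKernel_congr (hd : 0 < d) {A B : Rdd d → ℂ}
    (h : ∀ᵐ θ : Metric.sphere (0 : Rdd d) 1 ∂sphereMeasure d, A θ = B θ) :
    ∀ᵐ v : Rdd d, homKernel A v = homKernel B v := by
  filter_upwards [ae_sphere_direction h] with v hv
  by_cases h0 : v = 0
  · rw [h0, homKernel_zero hd, homKernel_zero hd]
  · rw [homKernel, homKernel, hv h0]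

lemma volumeIoiPow_Ioo_ne_zero (n : ℕ) :
    Measure.volumeIoiPow n {t | 1 < t.1 ∧ t.1 < 2} ≠ 0 := by
  intro h
  have h2 := Measure.volumeIoiPow_apply_Iio n ⟨2, by norm_num⟩
  have h3 := Measure.volumeIoiPow_apply_Iio n ⟨3 / 2, by norm_num⟩
  have hsub : Set.Iio (⟨2, by norm_num⟩ : Set.Ioi (0 : ℝ)) ⊆
      Set.Iio ⟨3 / 2, by norm_num⟩ ∪ {t | 1 < t.1 ∧ t.1 < 2} := by
    intro t ht
    by_cases h : t.1 < 3 / 2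
    · exact Or.inl h
    · exact Or.inr ⟨by linarith, ht⟩
  have h4 := (measure_mono (μ := Measure.volumeIoiPow n) hsub).trans (measure_union_le _ _)
  rw [h, add_zero, h2, h3, ENNReal.ofReal_le_ofReal_iff (by positivity)] at h4
  have h5 : ((3 : ℝ) / 2) ^ (n + 1) < 2 ^ (n + 1) :=
    pow_lt_pow_left₀ (by norm_num) (by norm_num) (by omega)
  have h6 : ((3 : ℝ) / 2) ^ (n + 1) / (n + 1) < 2 ^ (n + 1) / (n + 1) := by gcongr
  simp only at h4
  linarith

/-- The annulus `1 < |h| < 2`. -/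
def annulus (d : ℕ) : Set (Rdd d) := {h | 1 < ‖h‖ ∧ ‖h‖ < 2}

lemma isOpen_annulus : IsOpen (annulus d) :=
  (isOpen_lt continuous_const continuous_norm).inter (isOpen_lt continuous_norm continuous_const)

/-- By homogeneity the integral splits into an angular and a radial factor. As the radial factor is
neither `0` nor `∞`, integrability and non-vanishing pass from `Ω` to the kernel on the annulus. -/
lemma lintegral_annulus {Ω : Rdd d → ℂ} (hΩ : Measurable Ω) : ∃ W : ℝ≥0∞,
    W ≠ 0 ∧ W ≠ ∞ ∧ ∫⁻ h in annulus d, ‖homKernel Ω h‖ₑ =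
      (∫⁻ θ : Metric.sphere (0 : Rdd d) 1, ‖Ω θ‖ₑ ∂sphereMeasure d) * W := by
  set n := Module.finrank ℝ (Rdd d) - 1
  set w : Set.Ioi (0 : ℝ) → ℝ≥0∞ := {t : Set.Ioi (0 : ℝ) | 1 < t.1 ∧ t.1 < 2}.indicator fun t =>
    ENNReal.ofReal (t.1 ^ (2 * d))⁻¹ with hw
  have mS : MeasurableSet {t : Set.Ioi (0 : ℝ) | 1 < t.1 ∧ t.1 < 2} :=
    (measurableSet_lt measurable_const measurable_subtype_coe).inter
      (measurableSet_lt measurable_subtype_coe measurable_const)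
  have mw : Measurable w := Measurable.indicator (by fun_prop) mS
  refine ⟨∫⁻ t, w t ∂Measure.volumeIoiPow n, ?_, ?_, ?_⟩
  · rw [hw, lintegral_indicator mS]
    intro h
    have h1 : ENNReal.ofReal ((2 : ℝ) ^ (2 * d))⁻¹ *
        Measure.volumeIoiPow n {t | 1 < t.1 ∧ t.1 < 2} ≤ 0 := by
      rw [← h, ← setLIntegral_const]
      refine setLIntegral_mono' mS fun t ht => ?_
      refine ENNReal.ofReal_le_ofReal ?_
      have h0 : 0 < t.1 := t.2
      have := ht.2.le
      gcongr
    rcases mul_eq_zero.1 (le_zero_iff.1 h1) with h2 | h2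
    · exact (ENNReal.ofReal_pos.2 (by positivity)).ne' h2
    · exact volumeIoiPow_Ioo_ne_zero n h2
  · rw [hw, lintegral_indicator mS]
    refine ne_top_of_le_ne_top ?_ (setLIntegral_mono' (g := fun _ => 1) mS fun t ht => ?_)
    · rw [setLIntegral_one]
      refine ne_top_of_le_ne_top ?_ (measure_mono
        (show _ ⊆ Set.Iio (⟨2, by norm_num⟩ : Set.Ioi (0 : ℝ)) from fun t ht => ht.2))
      rw [Measure.volumeIoiPow_apply_Iio]
      exact ENNReal.ofReal_ne_top
    · rw [ENNReal.ofReal_le_one]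
      exact inv_le_one_of_one_le₀ (one_le_pow₀ ht.1.le)
  · have mk := measurable_homKernel hΩ
    have e1 : ∫⁻ h in annulus d, ‖homKernel Ω h‖ₑ =
        ∫⁻ h in {0}ᶜ, (annulus d).indicator (fun h => ‖homKernel Ω h‖ₑ) h := by
      rw [← lintegral_indicator isOpen_annulus.measurableSet,
        ← lintegral_indicator (measurableSet_singleton 0).compl]
      refine lintegral_congr fun h => ?_
      by_cases h0 : h = 0
      · simp [h0, annulus]
      · rw [Set.indicator_of_mem (s := {0}ᶜ) (by simpa using h0)]
    rw [e1, lintegral_polar _ (mk.enorm.indicator isOpen_annulus.measurableSet),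
      ← lintegral_mul_const _ (by exact (hΩ.comp measurable_subtype_coe).enorm)]
    refine lintegral_congr fun θ => ?_
    rw [← lintegral_const_mul _ mw]
    refine lintegral_congr fun t => ?_
    have ht : 0 < t.1 := t.2
    have hθ : ‖(θ : Rdd d)‖ = 1 := by simp
    have hn : ‖t.1 • (θ : Rdd d)‖ = t.1 := by
      rw [norm_smul, Real.norm_of_nonneg ht.le, hθ, mul_one]
    by_cases h : 1 < t.1 ∧ t.1 < 2
    · rw [Set.indicator_of_mem (by simpa [annulus, hn] using h), hw, Set.indicator_of_mem (by exact h),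
        homKernel_smul _ ht, homKernel, hθ]
      simp only [inv_one, one_smul, one_pow, Complex.ofReal_one, div_one]
      rw [enorm_mul, mul_comm]
      congr 1
      rw [← ofReal_norm, Complex.norm_real, Real.norm_of_nonneg (by positivity)]
    · rw [Set.indicator_of_notMem (by simpa [annulus, hn] using h), hw,
        Set.indicator_of_notMem (by exact h), mul_zero]

/-- A Lebesgue point of a homogeneous kernel, at which it does not vanish. -/
lemma exists_lebesgue_point {Ω : Rdd d → ℂ} (hΩ : Measurable Ω)
    (hi : Integrable (fun θ : Metric.sphere (0 : Rdd d) 1 => Ω θ) (sphereMeasure d))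
    (h0 : ¬ (fun θ : Metric.sphere (0 : Rdd d) 1 => Ω θ) =ᵐ[sphereMeasure d] 0) {η : ℝ}
    (hη : 0 < η) :
    ∃ (h₀ : Rdd d) (ρ : ℝ), 0 < ρ ∧ 2 * ρ ≤ ‖h₀‖ ∧ homKernel Ω h₀ ≠ 0 ∧
      ∫⁻ h in Metric.closedBall h₀ ρ, ‖homKernel Ω h - homKernel Ω h₀‖ₑ ≤
        ENNReal.ofReal (‖homKernel Ω h₀‖ * (η * ρ ^ (2 * d))) := by
  obtain ⟨W, hW0, hWt, hW⟩ := lintegral_annulus hΩ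
  have mk := measurable_homKernel hΩ
  have mA : MeasurableSet (annulus d) := isOpen_annulus.measurableSet
  have ik : IntegrableOn (homKernel Ω) (annulus d) := by
    refine ⟨mk.aestronglyMeasurable, ?_⟩
    rw [HasFiniteIntegral, hW]
    exact ENNReal.mul_lt_top hi.2 (lt_top_iff_ne_top.2 hWt)
  set k := (annulus d).indicator (homKernel Ω) with hk
  have ik' : Integrable k := (integrable_indicator_iff mA).2 ik
  have hne : ¬ k =ᵐ[volume] 0 := by
    intro h
    have h1 : ∫⁻ h, ‖k h‖ₑ = 0 := by
      rw [lintegral_congr_ae (g := fun _ => 0) (by filter_upwards [h] with v hv; simp [hv]),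
        lintegral_zero]
    simp_rw [hk, enorm_indicator_eq_indicator_enorm] at h1
    rw [lintegral_indicator mA, hW] at h1
    have h2 := (mul_eq_zero.1 h1).resolve_right hW0
    rw [lintegral_eq_zero_iff (by exact (hΩ.comp measurable_subtype_coe).enorm)] at h2
    refine h0 ?_
    filter_upwards [h2] with θ hθ
    simpa using hθ
  -- Almost every point is a Lebesgue point of the integrable function `k`, and `k` does not vanish
  -- almost everywhere.
  obtain ⟨h₀, hL, hk0⟩ : ∃ h₀, (Tendsto (fun ρ : ℝ => ⨍ y in Metric.closedBall h₀ ρ, ‖k y - k h₀‖)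
      (𝓝[>] 0) (𝓝 0)) ∧ k h₀ ≠ 0 := by
    by_contra! hcon
    refine hne ?_
    filter_upwards [IsUnifLocDoublingMeasure.ae_tendsto_average_norm_sub
      (volume : Measure (Rdd d)) ik'.locallyIntegrable 1] with h hh
    refine hcon h (hh (fun _ => h) (fun ρ : ℝ => ρ) tendsto_id ?_)
    filter_upwards [self_mem_nhdsWithin] with ρ (hρ : 0 < ρ)
    simpa using hρ.le
  have hA : h₀ ∈ annulus d := by
    by_contra h
    exact hk0 (Set.indicator_of_notMem h _)
  set V := (volume : Measure (Rdd d)).real (Metric.closedBall 0 1) with hV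
  have hV0 : 0 < V := ENNReal.toReal_pos (Metric.measure_closedBall_pos _ _ one_pos).ne'
    measure_closedBall_lt_top.ne
  have hkn : 0 < ‖k h₀‖ := norm_pos_iff.2 hk0
  have ev1 := hL.eventually_lt_const (show 0 < ‖k h₀‖ * η / V by positivity)
  obtain ⟨R, hR0, hR⟩ := Metric.nhds_basis_closedBall.mem_iff.1 (isOpen_annulus.mem_nhds hA)
  -- `ρ < R` keeps the ball in the annulus, where `k` is the kernel; `ρ < 1 / 2` and `1 < ‖h₀‖` give
  -- `2 ρ ≤ ‖h₀‖`.
  have ev2 : ∀ᶠ ρ : ℝ in 𝓝[>] 0, ρ < min R (1 / 2) :=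
    mem_nhdsWithin_of_mem_nhds (Iio_mem_nhds (by positivity))
  obtain ⟨ρ, hρ1, hρ2, hρ0⟩ := (ev1.and (ev2.and self_mem_nhdsWithin)).exists
  change 0 < ρ at hρ0
  have hρR := hρ2.trans_le (min_le_left _ _)
  have hρh := hρ2.trans_le (min_le_right _ _)
  have hsub : Metric.closedBall h₀ ρ ⊆ annulus d :=
    (Metric.closedBall_subset_closedBall hρR.le).trans hR
  have ek : ∀ h ∈ annulus d, k h = homKernel Ω h := fun h hh => Set.indicator_of_mem hh _
  refine ⟨h₀, ρ, hρ0, by linarith [hA.1], by rwa [← ek h₀ hA], ?_⟩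
  have hv : (volume : Measure (Rdd d)).real (Metric.closedBall h₀ ρ) = ρ ^ (2 * d) * V := by
    rw [Measure.addHaar_real_closedBall' _ _ hρ0.le, finrank_Rdd]
  rw [setAverage_eq, hv, smul_eq_mul, inv_mul_eq_div, div_lt_iff₀ (by positivity)] at hρ1
  have ii : IntegrableOn (fun y => k y - k h₀) (Metric.closedBall h₀ ρ) :=
    ik'.integrableOn.sub (integrableOn_const measure_closedBall_lt_top.ne)
  rw [setLIntegral_congr_fun (g := fun h => ‖k h - k h₀‖ₑ) measurableSet_closedBall
    (fun h hh => by simp only [ek h (hsub hh), ek h₀ hA]), ← ek h₀ hA,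
    ← ofReal_integral_norm_eq_lintegral_enorm ii]
  refine ENNReal.ofReal_le_ofReal (hρ1.le.trans (le_of_eq ?_))
  field_simp

/-- The kernel is homogeneous of degree `-2d` in dimension `2d`, so the Jacobian cancels the
scaling. One Lebesgue point thus serves all scales. -/
lemma lintegral_closedBall_smul (Ω : Rdd d → ℂ) (hΩ : Measurable Ω) (h₀ : Rdd d) (ρ : ℝ) {t : ℝ}
    (ht : 0 < t) :
    ∫⁻ h in Metric.closedBall (t • h₀) (t * ρ), ‖homKernel Ω h - homKernel Ω (t • h₀)‖ₑ =
      ∫⁻ h in Metric.closedBall h₀ ρ, ‖homKernel Ω h - homKernel Ω h₀‖ₑ := by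
  set g : Rdd d → ℝ≥0∞ := (Metric.closedBall (t • h₀) (t * ρ)).indicator fun h =>
    ‖homKernel Ω h - homKernel Ω (t • h₀)‖ₑ with hg
  have mg : Measurable g :=
    ((measurable_homKernel hΩ).sub_const _).enorm.indicator measurableSet_closedBall
  have h1 := Measure.map_addHaar_smul (volume : Measure (Rdd d)) ht.ne'
  have h2 : ∫⁻ h, g (t • h) = ENNReal.ofReal (t ^ (2 * d))⁻¹ * ∫⁻ h, g h := by
    rw [← lintegral_map mg (measurable_const_smul t), h1, lintegral_smul_measure, finrank_Rdd,
      abs_of_pos (by positivity), smul_eq_mul]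
  have h3 : ∀ h, g (t • h) = ENNReal.ofReal (t ^ (2 * d))⁻¹ *
      (Metric.closedBall h₀ ρ).indicator (fun h => ‖homKernel Ω h - homKernel Ω h₀‖ₑ) h := by
    intro h
    have e : t • h ∈ Metric.closedBall (t • h₀) (t * ρ) ↔ h ∈ Metric.closedBall h₀ ρ := by
      rw [Metric.mem_closedBall, Metric.mem_closedBall, dist_smul₀, Real.norm_of_nonneg ht.le,
        mul_le_mul_iff_right₀ ht]
    by_cases hh : h ∈ Metric.closedBall h₀ ρ
    · rw [hg, Set.indicator_of_mem (e.2 hh), Set.indicator_of_mem hh, homKernel_smul _ ht,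
        homKernel_smul _ ht, ← mul_sub, enorm_mul]
      congr 1
      rw [← ofReal_norm, Complex.norm_real, Real.norm_of_nonneg (by positivity)]
    · rw [hg, Set.indicator_of_notMem (fun h => hh (e.1 h)), Set.indicator_of_notMem hh, mul_zero]
  simp_rw [h3] at h2
  rw [lintegral_const_mul' _ _ ENNReal.ofReal_ne_top,
    ENNReal.mul_right_inj (ENNReal.ofReal_pos.2 (by positivity)).ne' ENNReal.ofReal_ne_top,
    lintegral_indicator measurableSet_closedBall, hg,
    lintegral_indicator measurableSet_closedBall] at h2
  exact h2.symm

end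

section

variable {d : ℕ}

/-! ### Rough kernels -/

lemma norm_toLp_le (u v : Rd d) : ‖(WithLp.toLp 2 (u, v) : Rdd d)‖ ≤ ‖u‖ + ‖v‖ := by
  rw [WithLp.prod_norm_eq_of_L2]
  refine Real.sqrt_le_iff.2 ⟨by positivity, ?_⟩
  change ‖u‖ ^ 2 + ‖v‖ ^ 2 ≤ (‖u‖ + ‖v‖) ^ 2
  nlinarith [norm_nonneg u, norm_nonneg v]

lemma measurePreserving_toLp_sub (x : Rd d) :
    MeasurePreserving (fun w : Rd d × Rd d => (WithLp.toLp 2 (x - w.1, x - w.2) : Rdd d))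
      volume volume :=
  (WithLp.volume_preserving_toLp (Rd d) (Rd d)).comp
    ((Measure.measurePreserving_sub_left (volume : Measure (Rd d)) x).prod
      (Measure.measurePreserving_sub_left (volume : Measure (Rd d)) x))

/-- For fixed `y`, the map `(x, z) ↦ (x - y, x - z)` preserves volume. This yields the marginal
bound `snd` of a local kernel. -/
lemma lintegral_toLp_sub_sub {g : Rdd d → ℝ≥0∞} (hg : Measurable g) (y : Rd d) :
    ∫⁻ x, ∫⁻ z, g (WithLp.toLp 2 (x - y, x - z)) = ∫⁻ h, g h := by
  have h1 : ∀ x : Rd d, ∫⁻ z, g (WithLp.toLp 2 (x - y, x - z)) =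
      ∫⁻ v, g (WithLp.toLp 2 (x - y, v)) := fun x =>
    lintegral_sub_left_eq_self (fun v => g (WithLp.toLp 2 (x - y, v))) x
  simp_rw [h1]
  rw [lintegral_sub_right_eq_self (fun u => ∫⁻ v, g (WithLp.toLp 2 (u, v))) y,
    ← (WithLp.volume_preserving_toLp (Rd d) (Rd d)).lintegral_comp hg, Measure.volume_eq_prod,
    lintegral_prod _ (by fun_prop)]

/-- Rough operators have local kernels. -/
theorem exists_hasLocalKernels_of_rough (hd : 0 < d) {Ω : Rdd d → ℂ} (hΩ : IsNondegOmega Ω) :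
    ∃ (Λ : ℕ) (c : ℝ), 0 < c ∧ ∀ T : BilinOp d, IsRoughSIO Ω T → HasLocalKernels T Λ c := by
  -- a Borel version
  have hm := hΩ.integrable.aestronglyMeasurable
  set B : Rdd d → ℂ := Function.extend Subtype.val (hm.mk _) 0 with hB
  have mB : Measurable B :=
    (MeasurableEmbedding.subtype_coe (by exact Metric.isClosed_sphere.measurableSet)).measurable_extend
      hm.stronglyMeasurable_mk.measurable measurable_zero
  have eB : ∀ᵐ θ : Metric.sphere (0 : Rdd d) 1 ∂sphereMeasure d, Ω θ = B θ := by
    filter_upwards [hm.ae_eq_mk] with θ hθ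
    rw [hθ, hB, Subtype.val_injective.extend_apply]
  have iB := hΩ.integrable.congr eB
  have neB : ¬ (fun θ : Metric.sphere (0 : Rdd d) 1 => B θ) =ᵐ[sphereMeasure d] 0 :=
    fun h => hΩ.ne_zero (Filter.EventuallyEq.trans eB h)
  have hsd : 0 < √(d : ℝ) := Real.sqrt_pos.2 (by exact_mod_cast hd)
  -- After dilation to radius `4 √d ℓ`, this `η` turns the mean deviation into `‖K₀‖ ℓ^{2d} / 128`.
  obtain ⟨h₀, ρ, hρ0, hρ, hk0, hk⟩ := exists_lebesgue_point mB iB neB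
    (η := ((4 * √d) ^ (2 * d))⁻¹ / 128) (by positivity)
  set k := homKernel B with hkdef
  have mk : Measurable k := measurable_homKernel mB
  -- The dilation `t = L ℓ` gives `t ρ = 4 √d ℓ`: in `(x - y, x - z)` four displacements occur, each
  -- at most the diameter of a cube.
  set L : ℝ := 4 * √d / ρ with hL
  have hL0 : 0 < L := by positivity
  have hLρ : L * ρ = 4 * √d := div_mul_cancel₀ _ hρ0.ne'
  refine ⟨⌈2 * L * ‖h₀‖⌉₊ + 1, ‖k h₀‖ * (L ^ (2 * d))⁻¹, mul_pos (norm_pos_iff.2 hk0)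
    (by positivity), fun T hT a ℓ hℓ => ?_⟩
  set t : ℝ := L * ℓ with ht
  have ht0 : 0 < t := by positivity
  have htρ : t * ρ = 4 * (√d * ℓ) := by
    rw [ht, mul_right_comm, hLρ]
    ring
  -- The centres are placed so that `(x₀ - a, x₀ - z₀) = t h₀`.
  set x₀ : Rd d := a + t • h₀.fst with hx₀
  set z₀ : Rd d := x₀ - t • h₀.snd with hz₀
  have n1 : ‖h₀.fst‖ ≤ ‖h₀‖ := WithLp.norm_fst_le _ h₀
  have n2 : ‖h₀.snd‖ ≤ ‖h₀‖ := WithLp.norm_snd_le _ h₀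
  set X := gridCell a ℓ (gridIdx a ℓ x₀) with hX
  set Z := gridCell a ℓ (gridIdx a ℓ z₀) with hZ
  have mx₀ : x₀ ∈ X := mem_gridCell_gridIdx a hℓ x₀
  have mz₀ : z₀ ∈ Z := mem_gridCell_gridIdx a hℓ z₀
  have ma : a ∈ cube a ℓ := self_mem_cube a hℓ
  set S := Metric.closedBall (t • h₀) (t * ρ) with hS
  have inS : ∀ x ∈ X, ∀ y ∈ cube a ℓ, ∀ z ∈ Z, (WithLp.toLp 2 (x - y, x - z) : Rdd d) ∈ S := by
    intro x hx y hy z hz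
    have e : (WithLp.toLp 2 (x - y, x - z) : Rdd d) - t • h₀ =
        WithLp.toLp 2 ((x - x₀) - (y - a), (x - x₀) - (z - z₀)) := by
      refine (WithLp.ofLp_injective 2) (Prod.ext ?_ ?_)
      · change x - y - t • h₀.fst = (x - x₀) - (y - a)
        rw [hx₀]
        abel
      · change x - z - t • h₀.snd = (x - x₀) - (z - z₀)
        rw [hz₀]
        abel
    rw [hS, Metric.mem_closedBall, dist_eq_norm, e, htρ]
    refine (norm_toLp_le _ _).trans ?_
    have b1 := norm_sub_le_of_mem_cube hℓ.le hx mx₀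
    have b2 := norm_sub_le_of_mem_cube hℓ.le hy ma
    have b3 := norm_sub_le_of_mem_cube hℓ.le hz mz₀
    have c1 := norm_sub_le (x - x₀) (y - a)
    have c2 := norm_sub_le (x - x₀) (z - z₀)
    linarith
  set K₀ := k (t • h₀) with hK₀
  have hK₀n : ‖K₀‖ = (t ^ (2 * d))⁻¹ * ‖k h₀‖ := by
    rw [hK₀, hkdef, homKernel_smul _ ht0, norm_mul, Complex.norm_real,
      Real.norm_of_nonneg (by positivity)]
  set g : Rdd d → ℝ≥0∞ := S.indicator fun h => ‖k h - K₀‖ₑ with hg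
  have mg : Measurable g := (mk.sub_const _).enorm.indicator measurableSet_closedBall
  have ig : ∫⁻ h, g h ≤ ENNReal.ofReal (‖K₀‖ * ℓ ^ (2 * d) / 128) := by
    rw [hg, lintegral_indicator measurableSet_closedBall]
    rw [hK₀, hkdef,
      lintegral_closedBall_smul B mB h₀ ρ ht0]
    refine hk.trans (ENNReal.ofReal_le_ofReal (le_of_eq ?_))
    change _ = ‖K₀‖ * ℓ ^ (2 * d) / 128
    rw [hK₀n, ht, ← hLρ, mul_pow, mul_pow]
    field_simp
  have gk : ∀ x ∈ X, ∀ y ∈ cube a ℓ, ∀ z ∈ Z, ‖roughKernel B x y z - K₀‖ₑ =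
      g (WithLp.toLp 2 (x - y, x - z)) := fun x hx y hy z hz => by
    rw [hg, Set.indicator_of_mem (inS x hx y hy z hz), roughKernel_eq]
  refine ⟨gridIdx a ℓ x₀, gridIdx a ℓ z₀, abs_gridIdx_le hℓ ?_, abs_gridIdx_le hℓ ?_,
    fun w => roughKernel B w.1 w.2.1 w.2.2, K₀, ?_, fun F G hF hG => ?_, fun x hx => ?_,
    fun y hy => ?_, ?_⟩
  · have : ‖x₀ - a‖ = t * ‖h₀.fst‖ := by
      rw [hx₀, add_sub_cancel_left, norm_smul, Real.norm_of_nonneg ht0.le]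
    rw [this]
    have : t * ‖h₀.fst‖ ≤ t * ‖h₀‖ := by gcongr
    have h2 : 0 ≤ t * ‖h₀‖ := by positivity
    calc _ ≤ _ := this
      _ ≤ 2 * (t * ‖h₀‖) := by linarith
      _ = _ := by rw [ht]; ring
  · have : ‖z₀ - a‖ ≤ t * ‖h₀.fst‖ + t * ‖h₀.snd‖ := by
      have e : z₀ - a = t • h₀.fst - t • h₀.snd := by
        rw [hz₀, hx₀]
        abel
      rw [e]
      refine (norm_sub_le _ _).trans ?_
      rw [norm_smul, norm_smul, Real.norm_of_nonneg ht0.le]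
    have h1 : t * ‖h₀.fst‖ ≤ t * ‖h₀‖ := by gcongr
    have h2 : t * ‖h₀.snd‖ ≤ t * ‖h₀‖ := by gcongr
    calc _ ≤ 2 * (t * ‖h₀‖) := by linarith
      _ = _ := by rw [ht]; ring
  · unfold roughKernel
    fun_prop
  · filter_upwards [hT.lim F G] with x hx hxX
    refine tendsto_nhds_unique hx ?_
    -- As `2 ρ ≤ ‖h₀‖`, the product of cubes stays away from the singularity, and for small `ε` the
    -- truncation has no effect.
    have far : ∀ y ∈ cube a ℓ, ∀ z ∈ Z, t * ‖h₀‖ / 4 ≤ max ‖x - y‖ ‖x - z‖ := by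
      intro y hy z hz
      have h1 := inS x hxX y hy z hz
      rw [hS, Metric.mem_closedBall, dist_eq_norm] at h1
      have h2 := norm_toLp_le (x - y) (x - z)
      have h3 := norm_sub_norm_le (t • h₀) (WithLp.toLp 2 (x - y, x - z))
      rw [norm_sub_rev, norm_smul, Real.norm_of_nonneg ht0.le] at h3
      have h4 := mul_le_mul_of_nonneg_left hρ ht0.le
      linarith [le_max_left ‖x - y‖ ‖x - z‖, le_max_right ‖x - y‖ ‖x - z‖]
    have hh : 0 < t * ‖h₀‖ / 4 := by
      have : 0 < ‖h₀‖ := by linarith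
      positivity
    refine tendsto_const_nhds.congr' ?_
    filter_upwards [mem_nhdsWithin_of_mem_nhds (Iio_mem_nhds hh)] with ε (hε : ε < _)
    have z0 : ∀ (Ω : Rdd d → ℂ), ∀ w ∉ cube a ℓ ×ˢ Z,
        roughKernel Ω x w.1 w.2 * (F : Rd d → ℂ) w.1 * (G : Rd d → ℂ) w.2 = 0 := by
      intro Ω w hw
      by_cases h1 : w.1 ∈ cube a ℓ
      · rw [hG w.2 fun h2 => hw ⟨h1, h2⟩, mul_zero]
      · rw [hF _ h1, mul_zero, zero_mul]
    have e1 := setIntegral_eq_integral_of_forall_compl_eq_zero (μ := volume)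
      (s := {w : Rd d × Rd d | ε < max ‖x - w.1‖ ‖x - w.2‖}) fun w hw => z0 Ω w fun h =>
        hw (hε.trans_le (far w.1 h.1 w.2 h.2))
    rw [setIntegral_eq_integral_of_forall_compl_eq_zero fun w hw => z0 B w hw, e1]
    -- `Ω` and its Borel version agree in almost every direction, and the map `w ↦ (x - w.1, x -
    -- w.2)` preserves null sets.
    refine integral_congr_ae ?_
    filter_upwards [(measurePreserving_toLp_sub x).quasiMeasurePreserving.ae
      (homKernel_congr hd eB)] with w hw
    rw [roughKernel_eq, roughKernel_eq, hw]
  · calc ∫⁻ w in cube a ℓ ×ˢ Z, ‖roughKernel B x w.1 w.2 - K₀‖ₑ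
        = ∫⁻ w in cube a ℓ ×ˢ Z, g (WithLp.toLp 2 (x - w.1, x - w.2)) :=
          setLIntegral_congr_fun ((measurableSet_cube _ _).prod (measurableSet_cube _ _))
            fun w hw => gk x hx w.1 hw.1 w.2 hw.2
      _ ≤ ∫⁻ w : Rd d × Rd d, g (WithLp.toLp 2 (x - w.1, x - w.2)) := setLIntegral_le_lintegral _ _
      _ = ∫⁻ h, g h := (measurePreserving_toLp_sub x).lintegral_comp mg
      _ ≤ _ := ig
  · calc ∫⁻ x in X, ∫⁻ z in Z, ‖roughKernel B x y z - K₀‖ₑ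
        = ∫⁻ x in X, ∫⁻ z in Z, g (WithLp.toLp 2 (x - y, x - z)) :=
          setLIntegral_congr_fun (measurableSet_cube _ _) fun x hx =>
            setLIntegral_congr_fun (measurableSet_cube _ _) fun z hz => gk x hx y hy z hz
      _ ≤ ∫⁻ x, ∫⁻ z, g (WithLp.toLp 2 (x - y, x - z)) :=
          (setLIntegral_le_lintegral _ _).trans
            (lintegral_mono fun x => setLIntegral_le_lintegral _ _)
      _ = ∫⁻ h, g h := lintegral_toLp_sub_sub mg y
      _ ≤ _ := ig
  · rw [hK₀n, ht, mul_pow]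
    refine le_of_eq ?_
    field_simp

end

/-! ### Combination of the two bounds -/

section

/-- Operators with local kernels satisfy the commutator theorem. -/
theorem commEquiv_of_hasLocalKernels {d : ℕ} {p q r s : ℝ≥0∞}
    (hp : 1 ≤ p) (hp' : p < ∞) (hq : 1 ≤ q) (hq' : q < ∞) (hr : 1 ≤ r) (hs : 1 ≤ s) (hs' : s < ∞)
    (hrel : r⁻¹ = s⁻¹ + p⁻¹ + q⁻¹) {M₁ M₂ : ℝ≥0} {T : BilinOp d} {Λ : ℕ} {c : ℝ} (hc : 0 < c)
    (hT : HasLocalKernels T Λ c) (h₁ : BoundedBy T p q (hσ p q) M₁)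
    (h₂ : BoundedBy T (hσ s p) q r M₂) :
    CommEquiv T p q r s (max (M₁ + M₂ + 1) (lowerConst d Λ p s / c).toNNReal) := by
  intro b hb
  refine ⟨?_, ?_, fun hfin f g hf hg => ?_⟩
  · refine (commNorm_le hp hp'.ne hq hq'.ne hr hs'.ne hrel h₁ h₂ hb.aestronglyMeasurable).trans ?_
    gcongr
    exact le_max_left _ _
  · refine (homLsNorm_le_commNorm hp hp'.ne hq hq'.ne hs hs'.ne hr hrel h₁ hb hT hc).trans ?_
    gcongr
    exact ENNReal.coe_le_coe.2 (le_max_right _ _)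
  · exact exists_isCommValue hp hp'.ne hq hq'.ne hr hs'.ne hrel h₁ h₂ hb.aestronglyMeasurable
      hfin hf hg

end

end BilinearSIO

end

theorem theorem5p1 (d : ℕ) (hd : 0 < d) (p q r s : ℝ≥0∞)
    (hp : 1 ≤ p) (hp' : p < ∞) (hq : 1 ≤ q) (hq' : q < ∞)
    (hr : 1 ≤ r) (hr' : r < ∞) (hs : 1 ≤ s) (hs' : s < ∞)
    (hrel : r⁻¹ = s⁻¹ + p⁻¹ + q⁻¹) (M₁ M₂ : ℝ≥0) :
    (∀ (CK c₀ : ℝ) (ω : ℝ → ℝ), 0 < c₀ → IsDiniModulus ω →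
      ∃ C : ℝ≥0, ∀ T : BilinOp d, IsNondegVariableSIO CK c₀ ω T →
        BoundedBy T p q (hσ p q) M₁ → BoundedBy T (hσ s p) q r M₂ →
          CommEquiv T p q r s C) ∧
    (∀ Ω : Rdd d → ℂ, IsNondegOmega Ω →
      ∃ C : ℝ≥0, ∀ T : BilinOp d, IsRoughSIO Ω T →
        BoundedBy T p q (hσ p q) M₁ → BoundedBy T (hσ s p) q r M₂ →
          CommEquiv T p q r s C) := by
  refine ⟨fun CK c₀ ω hc₀ hω => ?_, fun Ω hΩ => ?_⟩
  -- `Λ` and `c` are found before `T`, so the resulting constant depends only on the given data.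
  · obtain ⟨Λ, c, hc, hK⟩ := exists_hasLocalKernels_of_variable (d := d) (CK := CK) hd hc₀ hω
    exact ⟨_, fun T hT h₁ h₂ =>
      commEquiv_of_hasLocalKernels hp hp' hq hq' hr hs hs' hrel hc (hK T hT) h₁ h₂⟩
  · obtain ⟨Λ, c, hc, hK⟩ := exists_hasLocalKernels_of_rough hd hΩ
    exact ⟨_, fun T hT h₁ h₂ =>
      commEquiv_of_hasLocalKernels hp hp' hq hq' hr hs hs' hrel hc (hK T hT) h₁ h₂⟩
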